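/- **Theorem (Contraction for the UBU discretization scheme).** *Potential.* Let $U:\mathbb{R}^d\to\mathbb{R}$ be differentiable with $L$-Lipschitz gradient, and let $\kappa>0$, $R\ge 0$ be such that $(\nabla U(x)-\nabla U(y))\cdot(x-y)\ge\kappa|x-y|^2$ whenever $|x-y|>R$. Write $U(x)=\frac12x^TKx+G(x)$, where $K$ is symmetric with smallest eigenvalue $\kappa$, $x\mapsto Kx$ is $L_K$-Lipschitz, $\nabla G$ is $L_G$-Lipschitz and $(\nabla G(x)-\nabla G(y))\cdot(x-y)\ge0$ whenever $|x-y|>R$. *Distance.* Let $\gamma>0$, $\tau=\min(\frac18,\frac{\kappa}{4\gamma^2})$, $\alpha=2L\gamma^{-2}$, $\epsilon=\frac12\min\big(1,\frac{2\alpha}{3\sqrt{L_K}\gamma^{-1}},\alpha\big)$, $\mathcal{E}=\min\big(\frac{\sqrt{\kappa}\gamma^{-1}}{\sqrt8\,\alpha},\frac12\big)$ and $\mathcal{R}=\tau^{-1}L_GR^2\gamma^{-2}$. For $a=(x,v)$, $b=(x',v')\in\mathbb{R}^{2d}$ put $z=x-x'$, $w=v-v'$, $q=z+\gamma^{-1}w$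 and $$r_l(a,b)^2=\gamma^{-2}z^TKz+\tfrac12|(1-2\tau)z+\gamma^{-1}w|^2+\tfrac12\gamma^{-2}|w|^2,\quad r_s(a,b)=\alpha|z|+|q|,\quad \Delta=r_s-\epsilon r_l,$$ $$D_{\mathcal K}=\sup\big\{\Delta(a,b):\ \kappa\gamma^{-2}|z|^2+\tfrac12|z+\gamma^{-1}w|^2+\tfrac12|\gamma^{-1}w|^2\le\mathcal{R}\big\},\quad R_1=\sup\{r_s(a,b):\Delta(a,b)\le D_{\mathcal K}\}.$$ Let $\phi(s)=\exp(-64\alpha\gamma^2(s\wedge R_1)^2)$, $\Phi(s)=\int_0^s\phi$, $\hat c=\big(\gamma\int_0^{R_1}\Phi/\phi\big)^{-1}$, $\psi(s)=1-\frac{\hat c\gamma}{2}\int_0^{s\wedge R_1}\Phi/\phi$, $f(r)=\int_0^r\phi\psi$ and $$\rho(a,b)=f\big(\Delta(a,b)\wedge D_{\mathcal K}+\epsilon r_l(a,b)\big).$$ If $R_1=0$, we use the conventions $\hat c=+\infty$, $\psi=1$ (so $f(r)=r$) and $1/(8LR_1^2)=+\infty$. *Scheme.* For $h>0$ let $\mathcal{B}(x,v,h)=(x,v-h\nabla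 U(x))$ and, with $\eta=e^{-\gamma h}$, $$\mathcal{U}(x,v,h,\xi^{(1)},\xi^{(2)})=\Big(x+\tfrac{1-\eta}{\gamma}v+\sqrt{\tfrac2\gamma}(\mathcal{Z}^{(1)}-\mathcal{Z}^{(2)}),\ \eta v+\sqrt{2\gamma}\,\mathcal{Z}^{(2)}\Big),$$ $$\mathcal{Z}^{(1)}=\sqrt h\,\xi^{(1)},\qquad \mathcal{Z}^{(2)}=\sqrt{\tfrac{1-\eta^2}{2\gamma}}\Big(\sqrt{\tfrac{1-\eta}{1+\eta}\tfrac{2}{\gamma h}}\,\xi^{(1)}+\sqrt{1-\tfrac{1-\eta}{1+\eta}\tfrac{2}{\gamma h}}\,\xi^{(2)}\Big).$$ One UBU step is a $\mathcal{U}$ step of size $h/2$, then a $\mathcal{B}$ step of size $h$, then a $\mathcal{U}$ step of size $h/2$ (denoted $\mathcal{U}_{1/2}\mathcal{B}\,\mathcal{U}_{1/2}$), all driven by independent standard normal vectors in $\mathbb{R}^d$. *Coupling.* For $k\ge1$, two copies of $k$ UBU steps are coupled through $(\mathcal{U}_{1/2}\mathcal{B}\,\mathcal{U}_{1/2})^k=\mathcal{U}_{1/2}(\mathcal{B}\,\mathcal{U})^{k-1}\mathcal{B}\,\mathcal{U}_{1/2}$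 (steps performed from left to right). The first $\mathcal{U}_{1/2}$ and the last $\mathcal{B}\,\mathcal{U}_{1/2}$ use the same noise in both copies. In each of the $k-1$ steps $\mathcal{B}\,\mathcal{U}$, from current states $a,b$, both copies use the same $\xi^{(2)}$. If $D_{\mathcal K}+\epsilon r_l(a,b)\le r_s(a,b)$, then $\xi^{(1)\prime}=\xi^{(1)}$. Otherwise, with $\beta=(2\gamma^{-1}h)^{-1/2}$, $e=q/|q|$ ($e=0$ if $q=0$), $\varphi$ the standard normal density on $\mathbb{R}$ and $\mathcal{V}$ an independent uniform variable on $[0,1]$, $$\xi^{(1)\prime}=\begin{cases}\xi^{(1)}+\beta q&\text{if }\mathcal{V}\le\varphi(e\cdot\xi^{(1)}+\beta|q|)/\varphi(e\cdot\xi^{(1)}),\\ \xi^{(1)}-2(e\cdot\xi^{(1)})e&\text{otherwise.}\end{cases}$$ *Claim.* Suppose $h>0$ and $\gamma>0$ satisfy $$\gamma\ge\sqrt{13L_G^2/\kappa},\qquad L\gamma^{-1}h\le\min\Big(\frac{1}{8LR_1^2},\frac{1}{256\cdot75(2L\gamma^{-2}+1)},\frac{L\gamma^{-2}}{15},\frac{L}{55L_K}\Big).$$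 Then for all $k\in\mathbb{N}$ and all $(x,v),(x',v')\in\mathbb{R}^{2d}$ the above is a coupling of the laws of the $k$-th iterates $(\mathbf X_k,\mathbf V_k)$, $(\mathbf X_k',\mathbf V_k')$ of the UBU chains started at $(x,v)$, $(x',v')$; under it $\rho((\mathbf X_k,\mathbf V_k),(\mathbf X_k',\mathbf V_k'))$ is integrable, and $$\mathbb{E}\big[\rho((\mathbf X_k,\mathbf V_k),(\mathbf X_k',\mathbf V_k'))\big]\le\mathbf{C}\,(1-ch)^k\rho((x,v),(x',v')),$$ where $$c=\min\Big(f'(R_1)\tfrac{7\epsilon\kappa\gamma^{-1}}{96}\mathcal{E},\ f'(R_1)\tfrac{7\epsilon\gamma}{256}\mathcal{E},\ f'(R_1)e^{-\gamma h}\tfrac{\gamma}{16},\ f'(R_1)e^{-\gamma h}\tfrac{\gamma\alpha}{4},\ \tfrac{9\hat c}{640},\ \tfrac{\hat c}{32(4\alpha+1)}\Big),$$ $$\mathbf{C}=\Big(1+\frac{\gamma h}{16}\Big)\max\Big(\Big(1+\frac{\alpha\gamma h}{2}\Big)^2,\ 1+\gamma h\max(1,L_K\gamma^{-2})\Big).$$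 -/

import Mathlib

open MeasureTheory ProbabilityTheory Set

noncomputable section

namespace KineticLangevin

/-- Positions (and velocities) in `ℝ^d`, with the Euclidean norm. -/
abbrev Pos (d : ℕ) : Type := EuclideanSpace ℝ (Fin d)

/-- Phase space `ℝ^{2d}`: pairs `(x, v)`. -/
abbrev Phase (d : ℕ) : Type := Pos d × Pos d

/-! ### Parameters and assumptions on the potential -/

/-- The parameters: the symmetric operator `K` of the quadratic part of the potential, the convexity
constant `κ`, the radius `R`, Lipschitz constants `L`, `LG`, `LK` of `∇U`, `∇G`, `x ↦ K x`, and the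
friction `γ`. They are related to each other by `PotentialAssumption`. -/
structure Params (d : ℕ) where
  K : Pos d →L[ℝ] Pos d
  κ : ℝ
  R : ℝ
  L : ℝ
  LG : ℝ
  LK : ℝ
  γ : ℝ

/-- The remainder `G` in the splitting `U(x) = ½ xᵀ K x + G(x)`. -/
def Params.G {d : ℕ} (p : Params d) (U : Pos d → ℝ) (x : Pos d) : ℝ :=
  U x - (1 / 2) * inner ℝ x (p.K x)

/-- `U` has an `L`-Lipschitz gradient and is `κ`-strongly convex outside a ball of radius `R`, and
`U(x) = ½ xᵀ K x + G(x)` with `K` symmetric with smallest eigenvalue `κ > 0` and Lipschitz constant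
`LK`, and `G` convex outside a ball of radius `R` with `LG`-Lipschitz gradient. -/
structure PotentialAssumption {d : ℕ} (U : Pos d → ℝ) (p : Params d) : Prop where
  differentiable : Differentiable ℝ U
  κ_pos : 0 < p.κ
  R_nonneg : 0 ≤ p.R
  strongly_convex_outside : ∀ x y : Pos d, p.R < ‖x - y‖ →
    p.κ * ‖x - y‖ ^ 2 ≤ inner ℝ (gradient U x - gradient U y) (x - y)
  lipschitz_gradient : ∀ x y : Pos d, ‖gradient U x - gradient U y‖ ≤ p.L * ‖x - y‖
  K_symmetric : ∀ x y : Pos d, inner ℝ (p.K x) y = inner ℝ x (p.K y)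
  κ_smallest_eigenvalue :
    IsLeast {μ : ℝ | Module.End.HasEigenvalue (p.K : Pos d →ₗ[ℝ] Pos d) μ} p.κ
  lipschitz_K : ∀ x y : Pos d, ‖p.K x - p.K y‖ ≤ p.LK * ‖x - y‖
  G_convex_outside : ∀ x y : Pos d, p.R < ‖x - y‖ →
    0 ≤ inner ℝ (gradient (p.G U) x - gradient (p.G U) y) (x - y)
  lipschitz_G : ∀ x y : Pos d, ‖gradient (p.G U) x - gradient (p.G U) y‖ ≤ p.LG * ‖x - y‖

/-! ### The distance `ρ` -/

namespace Params

variable {d : ℕ} (p : Params d)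

def τ : ℝ := min (1 / 8) (p.κ / p.γ ^ 2 / 4)

def α : ℝ := 2 * p.L / p.γ ^ 2

/-- The twisted `2`-norm distance `r_l`. -/
def rl (a b : Phase d) : ℝ :=
  √(inner ℝ (a.1 - b.1) (p.K (a.1 - b.1)) / p.γ ^ 2
    + (1 / 2) * ‖(1 - 2 * p.τ) • (a.1 - b.1) + p.γ⁻¹ • (a.2 - b.2)‖ ^ 2
    + (1 / 2) * (‖a.2 - b.2‖ ^ 2 / p.γ ^ 2))

/-- The vector `q = x - x' + γ⁻¹ (v - v')`. -/
def q (a b : Phase d) : Pos d := (a.1 - b.1) + p.γ⁻¹ • (a.2 - b.2)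

/-- The distance `r_s`. -/
def rs (a b : Phase d) : ℝ := p.α * ‖a.1 - b.1‖ + ‖p.q a b‖

def ε : ℝ := (1 / 2) * min 1 (min (2 * p.α / (3 * (√p.LK * p.γ⁻¹))) p.α)

/-- The constant written as a calligraphic `E`. -/
def calE : ℝ := min (√p.κ * p.γ⁻¹ / (√8 * p.α)) (1 / 2)

def Δ (a b : Phase d) : ℝ := p.rs a b - p.ε * p.rl a b

/-- The constant written as a calligraphic `R`. -/
def calR : ℝ := p.τ⁻¹ * p.LG * p.R ^ 2 / p.γ ^ 2

/-- The compact set written as a calligraphic `K`, a set of differences `(z, w)`. -/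
def compactSet : Set (Phase d) :=
  {u | p.κ / p.γ ^ 2 * ‖u.1‖ ^ 2 + (1 / 2) * ‖u.1 + p.γ⁻¹ • u.2‖ ^ 2
    + (1 / 2) * ‖p.γ⁻¹ • u.2‖ ^ 2 ≤ p.calR}

def DK : ℝ :=
  sSup {t | ∃ a b : Phase d, (a.1 - b.1, a.2 - b.2) ∈ p.compactSet ∧ t = p.Δ a b}

def R₁ : ℝ := sSup {t | ∃ a b : Phase d, p.Δ a b ≤ p.DK ∧ t = p.rs a b}

/-- `φ(s) = exp(-128 α γ² (s ∧ R₁)² / 2)`. -/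
def φ (s : ℝ) : ℝ := Real.exp (-128 * p.α * p.γ ^ 2 * ((min s p.R₁) ^ 2 / 2))

/-- `Φ(s) = ∫₀ˢ φ`. -/
def Φ (s : ℝ) : ℝ := ∫ x in (0 : ℝ)..s, p.φ x

/-- `ĉ = 1 / (γ ∫₀^{R₁} Φ/φ)`. In the degenerate case `R₁ = 0` the value here is `0`, so that
`ψ = 1` and `f(r) = r`; there the mathematical value is `+∞`, see `rate`. -/
def cHat : ℝ := 1 / (p.γ * ∫ s in (0 : ℝ)..p.R₁, p.Φ s * (p.φ s)⁻¹)

def ψ (s : ℝ) : ℝ :=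
  1 - p.cHat / 2 * p.γ * ∫ x in (0 : ℝ)..(min s p.R₁), p.Φ x * (p.φ x)⁻¹

/-- The concave function `f(r) = ∫₀ʳ φ ψ`. -/
def f (r : ℝ) : ℝ := ∫ s in (0 : ℝ)..r, p.φ s * p.ψ s

/-- The distance `ρ = f((Δ ∧ D_K) + ε r_l)`. -/
def ρ (a b : Phase d) : ℝ := p.f (min (p.Δ a b) p.DK + p.ε * p.rl a b)

/-! ### Conditions on friction and step size, contraction rate and prefactor -/

def FrictionCondition : Prop := √(13 * p.LG ^ 2 / p.κ) ≤ p.γ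

/-- `L γ⁻¹ h ≤ min(1/(8 L R₁²), 1/(256·75 (2 L γ⁻² + 1)), L γ⁻²/15, L/(55 L_K))`, where
`1/(8 L R₁²) = +∞` if `R₁ = 0`. -/
def StepCondition (h : ℝ) : Prop :=
  (p.R₁ ≠ 0 → p.L * p.γ⁻¹ * h ≤ 1 / (8 * p.L * p.R₁ ^ 2)) ∧
  p.L * p.γ⁻¹ * h ≤ 1 / (256 * 75 * (2 * p.L / p.γ ^ 2 + 1)) ∧
  p.L * p.γ⁻¹ * h ≤ p.L / p.γ ^ 2 / 15 ∧
  p.L * p.γ⁻¹ * h ≤ p.L / (55 * p.LK)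

/-- The terms in the minimum defining the rate that do not involve `ĉ`. -/
def rateMain (h : ℝ) : ℝ :=
  min (deriv p.f p.R₁ * (7 * p.ε * p.κ * p.γ⁻¹ / 96) * p.calE)
    (min (deriv p.f p.R₁ * (7 * p.ε * p.γ / 256) * p.calE)
      (min (deriv p.f p.R₁ * Real.exp (-p.γ * h) * (p.γ / 16))
        (deriv p.f p.R₁ * Real.exp (-p.γ * h) * (p.γ * p.α / 4))))

/-- The contraction rate `c`. If `R₁ = 0`, then `ĉ = +∞` and the two terms with `ĉ` drop out of the
minimum. -/
def rate (h : ℝ) : ℝ :=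
  if p.R₁ = 0 then p.rateMain h
  else min (p.rateMain h) (min (9 * p.cHat / 640) (p.cHat / (32 * (4 * p.α + 1))))

/-- The prefactor `C`. -/
def prefactor (h : ℝ) : ℝ :=
  (1 + p.γ * h / 16) *
    max ((1 + p.α * p.γ * h / 2) ^ 2) (1 + p.γ * h * max 1 (p.LK / p.γ ^ 2))

end Params

/-! ### The splitting schemes -/

/-- Two independent standard normal vectors in `ℝ^d`. -/
def noise₂ (d : ℕ) : Measure (Pos d × Pos d) :=
  (stdGaussian (Pos d)).prod (stdGaussian (Pos d))

instance (d : ℕ) : IsProbabilityMeasure (noise₂ d) := by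
  unfold noise₂; infer_instance

/-- The uniform distribution on `[0, 1]`. -/
def unif : Measure ℝ := volume.restrict (Icc 0 1)

instance : IsProbabilityMeasure unif := ⟨by simp [unif]⟩

/-- The exact `B` step: `(x, v) ↦ (x, v - h ∇U(x))`. -/
def stepB {d : ℕ} (U : Pos d → ℝ) (h : ℝ) (a : Phase d) : Phase d :=
  (a.1, a.2 - h • gradient U a.1)

def Z₁ {d : ℕ} (h : ℝ) (ξ₁ : Pos d) : Pos d := √h • ξ₁

def Z₂ {d : ℕ} (γ h : ℝ) (ξ₁ ξ₂ : Pos d) : Pos d :=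
  let η := Real.exp (-γ * h)
  √((1 - η ^ 2) / (2 * γ)) •
    (√((1 - η) / (1 + η) * (2 / (γ * h))) • ξ₁ + √(1 - (1 - η) / (1 + η) * (2 / (γ * h))) • ξ₂)

/-- The exact `U` step of size `h`, driven by the pair of normal vectors `ξ`. -/
def stepU {d : ℕ} (γ h : ℝ) (a : Phase d) (ξ : Pos d × Pos d) : Phase d :=
  let η := Real.exp (-γ * h)
  (a.1 + ((1 - η) / γ) • a.2 + √(2 / γ) • (Z₁ h ξ.1 - Z₂ γ h ξ.1 ξ.2),
    η • a.2 + √(2 * γ) • Z₂ γ h ξ.1 ξ.2)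

/-- One step of the UBU scheme. -/
def stepUBU {d : ℕ} (U : Pos d → ℝ) (γ h : ℝ) (a : Phase d)
    (ξ : (Pos d × Pos d) × (Pos d × Pos d)) : Phase d :=
  stepU γ (h / 2) (stepB U h (stepU γ (h / 2) a ξ.1)) ξ.2

/-- The Markov kernel of `a ↦ F a ξ` with random noise `ξ` of law `ν`. -/
def noisyStep {S T N : Type} [MeasurableSpace S] [MeasurableSpace T] [MeasurableSpace N]
    (ν : Measure N) (F : S → N → T) : Kernel S T :=
  (Kernel.id ×ₖ Kernel.const S ν).map (fun y : S × N => F y.1 y.2)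

/-- `k` steps of a Markov chain with transition kernel `P`. -/
def iterKernel {S : Type} [MeasurableSpace S] (P : Kernel S S) : ℕ → Kernel S S
  | 0 => Kernel.id
  | k + 1 => P ∘ₖ iterKernel P k

/-- The `k`-step transition kernel of the UBU scheme: `ubu U γ h k a` is the law of
`(X_k, V_k)` for the UBU chain started at `a`. -/
def ubu {d : ℕ} (U : Pos d → ℝ) (γ h : ℝ) (k : ℕ) : Kernel (Phase d) (Phase d) :=
  iterKernel (noisyStep ((noise₂ d).prod (noise₂ d)) (stepUBU U γ h)) k

/-! ### The coupling -/

namespace Params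

variable {d : ℕ} (p : Params d)

/-- The noise of the second copy: `ξ'` in terms of `ξ`, the uniform variable `u` and the current
states `a`, `b`. Far apart: synchronous. Close: `ξ' = ξ + β q` if
`u ≤ φ_{0,1}(e·ξ + β|q|)/φ_{0,1}(e·ξ)`, and otherwise the reflection `ξ - 2 (e·ξ) e`, with
`β = 1/√(2γ⁻¹h)` and `e = q/|q|` (for `q = 0` the coupling is synchronous). -/
def coupledNoise (h : ℝ) (a b : Phase d) (ξ : Pos d) (u : ℝ) : Pos d :=
  let β := 1 / √(2 * p.γ⁻¹ * h)
  let qq := p.q a b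
  let e := ‖qq‖⁻¹ • qq
  if p.DK + p.ε * p.rl a b ≤ p.rs a b then ξ
  else if u ≤ gaussianPDFReal 0 1 (inner ℝ e ξ + β * ‖qq‖) / gaussianPDFReal 0 1 (inner ℝ e ξ)
  then ξ + β • qq
  else ξ - (2 * inner ℝ e ξ) • e

/-- One coupled BU step: a `B` step followed by a full `U` step in both copies; the first normal
vector is coupled by `coupledNoise`, the second one synchronously. -/
def coupledStepBU (U : Pos d → ℝ) (h : ℝ) (z : Phase d × Phase d)
    (n : (Pos d × Pos d) × ℝ) : Phase d × Phase d :=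
  (stepU p.γ h (stepB U h z.1) n.1,
    stepU p.γ h (stepB U h z.2) (p.coupledNoise h z.1 z.2 n.1.1 n.2, n.1.2))

/-- A half `U` step in both copies, with the same noise. -/
def syncHalfU (h : ℝ) (z : Phase d × Phase d) (ξ : Pos d × Pos d) : Phase d × Phase d :=
  (stepU p.γ (h / 2) z.1 ξ, stepU p.γ (h / 2) z.2 ξ)

/-- A `B` step followed by a half `U` step in both copies, with the same noise. -/
def syncBHalfU (U : Pos d → ℝ) (h : ℝ) (z : Phase d × Phase d) (ξ : Pos d × Pos d) :
    Phase d × Phase d :=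
  p.syncHalfU h (stepB U h z.1, stepB U h z.2) ξ

/-- The coupling of `k` steps of two copies of the UBU scheme, through
`(U_{1/2} B U_{1/2})^k = U_{1/2} (B U)^{k-1} B U_{1/2}` (steps performed from left to right):
a synchronous `U_{1/2}` step, then `k - 1` coupled `BU` steps, then a synchronous `B U_{1/2}` step.
It maps `(a, b)` to the joint law of `((X_k, V_k), (X_k', V_k'))`. -/
def ubuCoupling (U : Pos d → ℝ) (h : ℝ) : ℕ → Kernel (Phase d × Phase d) (Phase d × Phase d)
  | 0 => Kernel.id
  | k + 1 =>
    noisyStep (noise₂ d) (p.syncBHalfU U h) ∘ₖ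
      (iterKernel (noisyStep ((noise₂ d).prod unif) (p.coupledStepBU U h)) k ∘ₖ
        noisyStep (noise₂ d) (p.syncHalfU h))

end Params

end KineticLangevin

end

/-! Let z, w be the differences of the two copies in position and velocity, u = γ⁻¹w, q = z + u, s =
γh, x = αs and σ = √(2γ⁻¹h). On differences a B step is a kick u ↦ u - s(γ⁻²Kz + g) (`exists_kick`),
and a U step with shared noise is a flight z ↦ z + δu, u ↦ (1 - δ)u with δ = 1 - e^{-s}, which
leaves q unchanged. Since ρ = f(min(r_s, D_K + ε r_l)) (`ρ_eq`), a coupled BU step can be estimated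
through either entry of the minimum. Concavity of f transfers these estimates to ρ by tangents
(`f_le_tangent`).

Far apart, where D_K + ε r_l ≤ r_s, the noise cancels and r_l contracts pathwise. The form r_l²
contracts as soon as z·g is bounded below by -τ times the form defining the compact set. That bound
holds because Δ ≥ D_K forces this form to be at least `calR` (`calR_le_of_DK_le`), while convexity
of G outside a ball gives z·g ≥ -τ·calR. As r_l ≥ E r_s, the decrease of ε r_l is a fixed fraction
of ρ (`ρ_coupledStepBU_le_far`).

Close together, r_s ≤ R₁ and ρ = f(r_s). By `exists_step_bounds`, r_s changes by a drift of at most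
-0.46x|z| + x|q| plus a multiple of a variable y of mean zero, since the coupled one-dimensional
noise has the right law (`lintegral_reflCoupling`). If |z| ≥ 4|q|, the drift suffices. Otherwise the
concavity of f must beat x|q|. For |q| ≥ 2σ the copies approach by at least 2σ with probability at
least 1/20, and the steepness of φ pays (`f_le_of_approach`). For |q| < 2σ the gain comes from
reflections that push the copies apart: there f bends, or the entry D_K + ε r_l takes over
(`f_le_of_reflect`). The expected size of these reflections is proportional to |q|/σ
(`le_integral_reflGain`).

For the marginals, two half U steps have the law of a full one (`map_stepU_stepU`), so the
rearranged chain is the UBU chain; each coordinate projection intertwines the coupled kernels with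
the single-copy ones (`intertwine_ubuCoupling`). The first and last uncontracted pieces each cost
one `halfStepFactor`. The rearrangement contains one BU step fewer than k, and the factor 1 + γh/16
compensates for it (`one_le_mul_one_sub_rate`). -/

namespace KineticLangevin

/-! ### Contraction of the twisted quadratic form under kick and flight. -/

section TwistedForm

variable {E : Type*} [NormedAddCommGroup E] [InnerProductSpace ℝ E]

/-- The quadratic form whose square root is `r_l`, in the variables `z` and `u = γ⁻¹ w`. -/
noncomputable def twistedForm (τ : ℝ) (K : E →L[ℝ] E) (z u : E) : ℝ :=
  inner ℝ z (K z) + (1 / 2) * ‖(1 - 2 * τ) • z + u‖ ^ 2 + (1 / 2) * ‖u‖ ^ 2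

lemma twistedForm_eq (τ : ℝ) (K : E →L[ℝ] E) (z u : E) :
    twistedForm τ K z u = inner ℝ z (K z) + (1 / 2) * (1 - 2 * τ) ^ 2 * ‖z‖ ^ 2
      + (1 - 2 * τ) * inner ℝ z u + ‖u‖ ^ 2 := by
  have h := norm_add_sq_real ((1 - 2 * τ) • z) u
  rw [norm_smul, mul_pow, Real.norm_eq_abs, sq_abs, inner_smul_left] at h
  simp only [conj_trivial] at h
  rw [twistedForm, h]
  ring

/-- This is the free flight with δ = 1 - e^{-γt}. The twist in the form makes the z·v coefficient
decrease, and with it the position part will contract once a kick by -Kz is added. -/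
lemma twistedForm_step (τ δ : ℝ) (K : E →L[ℝ] E)
    (hK : ∀ x y : E, inner ℝ (K x) y = inner ℝ x (K y)) (z v : E) :
    twistedForm τ K (z + δ • v) ((1 - δ) • v) =
      inner ℝ z (K z) + 2 * δ * inner ℝ (K z) v + δ ^ 2 * inner ℝ v (K v)
        + (1 / 2) * (1 - 2 * τ) ^ 2 * ‖z‖ ^ 2
        + (1 - 2 * τ) * (1 - 2 * τ * δ) * inner ℝ z v
        + (1 - (1 + 2 * τ) * δ + (1 / 2) * (1 + 4 * τ ^ 2) * δ ^ 2) * ‖v‖ ^ 2 := by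
  have h1 : inner ℝ v (K z) = inner ℝ (K z) v := real_inner_comm _ _
  have h2 : inner ℝ z (K v) = inner ℝ (K z) v := (hK z v).symm
  have h3 : inner ℝ v z = inner ℝ z v := real_inner_comm _ _
  rw [twistedForm_eq, ← real_inner_self_eq_norm_sq (z + δ • v),
    ← real_inner_self_eq_norm_sq ((1 - δ) • v)]
  simp only [map_add, map_smul, inner_add_left, inner_add_right, inner_smul_left,
    inner_smul_right, conj_trivial, h1, h2, h3, real_inner_self_eq_norm_sq]
  ring

/-- The form after a kick of size `s` with force `K z + g` followed by a free flight. -/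
lemma twistedForm_kick_step_le (τ δ s Λ : ℝ) (K : E →L[ℝ] E)
    (hK : ∀ x y : E, inner ℝ (K x) y = inner ℝ x (K y))
    (hΛ : ∀ x : E, inner ℝ x (K x) ≤ Λ * ‖x‖ ^ 2) (z u g : E) :
    twistedForm τ K (z + δ • (u - s • (K z + g))) ((1 - δ) • (u - s • (K z + g))) ≤
      twistedForm τ K z u
        + 2 * δ * (inner ℝ (K z) u - s * ‖K z‖ ^ 2 - s * inner ℝ (K z) g)
        - (1 - 2 * τ) * (2 * τ * δ * inner ℝ z u
            + (1 - 2 * τ * δ) * s * (inner ℝ z (K z) + inner ℝ z g))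
        + (1 - (1 + 2 * τ - (1 / 2) * (1 + 4 * τ ^ 2) * δ - δ * Λ) * δ)
          * (‖u‖ ^ 2 - 2 * s * (inner ℝ (K z) u + inner ℝ g u)
            + s ^ 2 * (‖K z‖ ^ 2 + 2 * inner ℝ (K z) g + ‖g‖ ^ 2)) - ‖u‖ ^ 2 := by
  set v := u - s • (K z + g) with hv
  have e1 : inner ℝ (K z) v = inner ℝ (K z) u - s * ‖K z‖ ^ 2 - s * inner ℝ (K z) g := by
    rw [hv]
    simp only [inner_sub_right, inner_smul_right, inner_add_right, real_inner_self_eq_norm_sq]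
    ring
  have e2 : inner ℝ z v = inner ℝ z u - s * (inner ℝ z (K z) + inner ℝ z g) := by
    rw [hv]
    simp only [inner_sub_right, inner_smul_right, inner_add_right]
  have e3 : ‖v‖ ^ 2 = ‖u‖ ^ 2 - 2 * s * (inner ℝ (K z) u + inner ℝ g u)
            + s ^ 2 * (‖K z‖ ^ 2 + 2 * inner ℝ (K z) g + ‖g‖ ^ 2) := by
    have h1 : inner ℝ u (K z) = inner ℝ (K z) u := real_inner_comm _ _
    have h2 : inner ℝ u g = inner ℝ g u := real_inner_comm _ _
    have h3 : inner ℝ g (K z) = inner ℝ (K z) g := real_inner_comm _ _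
    rw [hv, ← real_inner_self_eq_norm_sq (u - s • (K z + g))]
    simp only [inner_sub_right, inner_smul_right, inner_add_right, inner_sub_left,
      inner_smul_left, inner_add_left, conj_trivial, h1, h2, h3, real_inner_self_eq_norm_sq]
    ring
  have e4 : δ ^ 2 * inner ℝ v (K v) ≤ δ ^ 2 * (Λ * ‖v‖ ^ 2) :=
    mul_le_mul_of_nonneg_left (hΛ v) (sq_nonneg δ)
  rw [twistedForm_step τ δ K hK, twistedForm_eq, ← e3, ← e1, e2]
  nlinarith [e4]

lemma abs_mul_le_of_abs_le {c C x y : ℝ} (hc : |c| ≤ C) (hx : |x| ≤ y) : c * x ≤ C * y := by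
  calc c * x ≤ |c * x| := le_abs_self _
    _ = |c| * |x| := abs_mul _ _
    _ ≤ C * y := mul_le_mul hc hx (abs_nonneg _) ((abs_nonneg _).trans hc)

set_option maxHeartbeats 1000000 in
/-- Contraction of the form under a synchronous kick-flight step, as long as the force satisfies
the lower bound `-τ P ≤ z · g`. -/
lemma twistedForm_kick_step_contraction (τ δ s Λ κ : ℝ) (K : E →L[ℝ] E)
    (hK : ∀ x y : E, inner ℝ (K x) y = inner ℝ x (K y))
    (hΛ : ∀ x : E, inner ℝ x (K x) ≤ Λ * ‖x‖ ^ 2)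
    (hKΛ : ∀ x : E, ‖K x‖ ^ 2 ≤ Λ * inner ℝ x (K x))
    (hκ : ∀ x : E, κ * ‖x‖ ^ 2 ≤ inner ℝ x (K x))
    (hτ0 : 0 ≤ τ) (hτ8 : τ ≤ 1 / 8) (hτκ : 4 * τ ≤ κ) (hΛ0 : 0 ≤ Λ)
    (hs0 : 0 ≤ s) (hs : s ≤ 1 / 15) (hsΛ : s * Λ ≤ 1 / 55)
    (hδ1 : s - s ^ 2 / 2 ≤ δ) (hδ2 : δ ≤ s) (z u g : E)
    (hg : ‖g‖ ^ 2 ≤ κ / 13 * ‖z‖ ^ 2)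
    (hzg : -(τ * (κ * ‖z‖ ^ 2 + (1 / 2) * ‖z + u‖ ^ 2 + (1 / 2) * ‖u‖ ^ 2)) ≤ inner ℝ z g) :
    twistedForm τ K (z + δ • (u - s • (K z + g))) ((1 - δ) • (u - s • (K z + g))) ≤
      (1 - 7 / 12 * τ * s) * twistedForm τ K z u := by
  refine (twistedForm_kick_step_le τ δ s Λ K hK hΛ z u g).trans ?_
  have hku := abs_real_inner_le_norm (K z) u
  have hkg := abs_real_inner_le_norm (K z) g
  have hgu := abs_real_inner_le_norm g u
  have hzu := abs_real_inner_le_norm z u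
  have hk2 := hKΛ z
  have hm := hκ z
  have hP := norm_add_sq_real z u
  rw [twistedForm_eq]
  rw [hP] at hzg
  set m := inner ℝ z (K z)
  set ku := inner ℝ (K z) u
  set kg := inner ℝ (K z) g
  set gu := inner ℝ g u
  set zu := inner ℝ z u
  set zg := inner ℝ z g
  set Z := ‖z‖
  set W := ‖u‖
  set Y := ‖K z‖
  set G := ‖g‖
  have hZ : 0 ≤ Z := norm_nonneg _
  have hW : 0 ≤ W := norm_nonneg _
  have hY : 0 ≤ Y := norm_nonneg _
  have hG : 0 ≤ G := norm_nonneg _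
  have hκ0 : 0 ≤ κ := by linarith
  have hm0 : 0 ≤ m := le_trans (by positivity) hm
  have hδ0 : 0 ≤ δ := by
    clear * - hs0 hs hδ1
    nlinarith
  have hδΛ : δ * Λ ≤ 1 / 55 := le_trans (mul_le_mul_of_nonneg_right hδ2 hΛ0) hsΛ
  have hδΛ0 : 0 ≤ δ * Λ := by positivity
  have hτ2 : τ ^ 2 ≤ 1 / 64 := by
    clear * - hτ0 hτ8
    nlinarith
  have hτδ : 0 ≤ (1 / 2) * (1 + 4 * τ ^ 2) * δ := by positivity
  have hτδ' : (1 / 2) * (1 + 4 * τ ^ 2) * δ ≤ 17 / 480 := by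
    have := hδ2.trans hs
    clear * - hτ2 this hδ0
    nlinarith [sq_nonneg τ]
  -- `1 - ν * δ` is the coefficient of the squared kicked velocity, so `ν * δ` measures the damping.
  -- The term `δ * Λ` is the price of replacing ⟨v, Kv⟩ by Λ|v|².
  set ν := 1 + 2 * τ - (1 / 2) * (1 + 4 * τ ^ 2) * δ - δ * Λ with hν
  have hν1 : 0.94 + 2 * τ ≤ ν := by rw [hν]; linarith
  have hν2 : ν ≤ 1.25 := by rw [hν]; linarith
  have hν0 : 0 ≤ ν := by linarith
  have hνδ0 : 0 ≤ ν * δ := by positivity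
  have hνδ : ν * δ ≤ 1.25 * s := mul_le_mul hν2 hδ2 hδ0 (by norm_num)
  have hs2 : s ^ 2 ≤ s / 15 := by
    clear * - hs0 hs
    nlinarith
  have hsνδ0 : 0 ≤ s * (ν * δ) := by positivity
  have hsνδ : s * (ν * δ) ≤ s * (1.25 * s) := mul_le_mul_of_nonneg_left hνδ hs0
  have hs3 : s * s ^ 2 ≤ 1 / 15 * s ^ 2 := mul_le_mul_of_nonneg_right hs (sq_nonneg s)
  have hs2νδ0 : 0 ≤ s ^ 2 * (ν * δ) := by positivity
  have hs2νδ : s ^ 2 * (ν * δ) ≤ s ^ 2 * (1.25 * s) := mul_le_mul_of_nonneg_left hνδ (sq_nonneg s)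
  have hsδ1 : s * (s - s ^ 2 / 2) ≤ s * δ := mul_le_mul_of_nonneg_left hδ1 hs0
  have hsδ2 : s * δ ≤ s * s := mul_le_mul_of_nonneg_left hδ2 hs0
  have hδs : 0.966 * s ≤ δ := by
    clear * - hs2 hδ1 hs0
    linarith
  have hW2 : 0 ≤ W ^ 2 := by positivity
  have hZ2 : 0 ≤ Z ^ 2 := by positivity
  have hG2 : G ^ 2 ≤ m / 13 := by linarith
  -- 825 = 15 · 55, from s ≤ 1/15 and sΛ ≤ 1/55.
  have hsY : (s * Y) ^ 2 ≤ m / 825 := by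
    have : s ^ 2 * Y ^ 2 ≤ s ^ 2 * (Λ * m) := mul_le_mul_of_nonneg_left hk2 (sq_nonneg s)
    have h2 : s * ((s * Λ) * m) ≤ s * ((1 / 55) * m) := by gcongr
    have h3 : s * ((1 / 55) * m) ≤ 1 / 15 * ((1 / 55) * m) := by gcongr
    clear * - this h2 h3
    linarith
  -- The ⟨Kz, u⟩ terms of flight and kick cancel to first order in s, leaving a coefficient of size
  -- s², which `hsY` absorbs.
  have X1 : (2 * δ - 2 * s * (1 - ν * δ)) * ku ≤ s * (0.0437 * m + 0.0435 * W ^ 2) := by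
    have hc : |2 * δ - 2 * s * (1 - ν * δ)| ≤ 2.5 * s ^ 2 := by
      rw [abs_le]; constructor <;> linarith
    have h1 := abs_mul_le_of_abs_le hc hku
    have h2 : 2.5 * ((s * Y) * W) ≤ 36 * (s * Y) ^ 2 + 0.0435 * W ^ 2 := by
      clear * -
      nlinarith [sq_nonneg (36 * (s * Y) - 1.25 * W)]
    have h3 : s * (2.5 * ((s * Y) * W)) ≤ s * (0.0437 * m + 0.0435 * W ^ 2) := by
      apply mul_le_mul_of_nonneg_left _ hs0
      linarith
    linarith
  have X2 : -(2 * δ * s) * (Y ^ 2 + kg) + (1 - ν * δ) * s ^ 2 * (Y ^ 2 + 2 * kg + G ^ 2)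
      ≤ s * (0.0056 * m) := by
    have hc : |2 * s ^ 2 * (1 - ν * δ) - 2 * δ * s| ≤ s ^ 2 / 6 := by
      rw [abs_le]; constructor <;> linarith
    have h1 := abs_mul_le_of_abs_le hc hkg
    have h2 : s ^ 2 * (Y * G) ≤ s ^ 2 * (Y ^ 2 + G ^ 2) / 2 := by
      clear * -
      nlinarith [mul_nonneg (sq_nonneg s) (sq_nonneg (Y - G))]
    have h3 : (s ^ 2 * (1 - ν * δ) - 2 * δ * s) * Y ^ 2 ≤ -(0.9 * s ^ 2) * Y ^ 2 := by
      apply mul_le_mul_of_nonneg_right _ (sq_nonneg Y)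
      linarith
    have h4 : s ^ 2 * (1 - ν * δ) * G ^ 2 ≤ s ^ 2 * G ^ 2 := by
      apply mul_le_mul_of_nonneg_right _ (sq_nonneg G)
      linarith
    have h5 : s ^ 2 * G ^ 2 ≤ s / 15 * (m / 13) := by
      apply mul_le_mul hs2 hG2 (by positivity) (by positivity)
    have h6 : 0 ≤ s ^ 2 * Y ^ 2 := by positivity
    have h7 : 0 ≤ s * m := by positivity
    linarith
  -- The 13 of the friction condition enters here: |g|² ≤ m/13 keeps this first-order term below the
  -- available dissipation.
  have X3 : -(2 * s * (1 - ν * δ)) * gu ≤ s * (2 / 13 * m + 1 / 2 * W ^ 2) := by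
    have hc : |-(2 * s * (1 - ν * δ))| ≤ 2 * s := by
      rw [abs_le]; constructor <;> linarith
    have h1 := abs_mul_le_of_abs_le hc hgu
    have h2 : s * (2 * (G * W)) ≤ s * (2 / 13 * m + 1 / 2 * W ^ 2) := by
      apply mul_le_mul_of_nonneg_left _ hs0
      clear * - hG2
      nlinarith [sq_nonneg (2 * G - W)]
    linarith
  have hτδ1 : τ * δ ≤ 1 / 120 := by
    have := hδ2.trans hs
    clear * - this hτ0 hτ8 hδ0
    nlinarith
  have hτδs : τ * δ ≤ τ / 15 := by
    have := mul_le_mul_of_nonneg_left (hδ2.trans hs) hτ0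
    linarith
  -- The only place where the lower bound on z·g is used; nonnegativity of the right side allows
  -- dropping the factor 1 - 2τδ.
  have X4 : -((1 - 2 * τ) * ((1 - 2 * τ * δ) * s * zg)) ≤
      (1 - 2 * τ) * (s * (τ * (m + 1 / 2 * Z ^ 2 + zu + W ^ 2))) := by
    have hQ : 0 ≤ 1 / 2 * Z ^ 2 + zu + W ^ 2 := by
      have h1 := (abs_le.1 hzu).1
      have h2 := sq_nonneg (Z - W)
      clear * - h1 h2 hZ2 hW2
      linarith
    have h1 : -zg ≤ τ * (m + 1 / 2 * Z ^ 2 + zu + W ^ 2) := by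
      have h0 := mul_le_mul_of_nonneg_left hm hτ0
      clear * - hzg h0
      linarith
    have h2 : (1 - 2 * τ * δ) * (-zg) ≤ τ * (m + 1 / 2 * Z ^ 2 + zu + W ^ 2) := by
      have h3 : (1 - 2 * τ * δ) * (-zg) ≤
          (1 - 2 * τ * δ) * (τ * (m + 1 / 2 * Z ^ 2 + zu + W ^ 2)) :=
        mul_le_mul_of_nonneg_left h1 (by linarith)
      have h4 : 0 ≤ τ * (m + 1 / 2 * Z ^ 2 + zu + W ^ 2) := by
        apply mul_nonneg hτ0; linarith
      have h5 := mul_nonneg (mul_nonneg hτ0 hδ0) h4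
      clear * - h3 h5
      linarith
    have h5 := mul_le_mul_of_nonneg_left h2 (mul_nonneg (by linarith : 0 ≤ 1 - 2 * τ) hs0)
    clear * - h5
    linarith
  -- Three contributions to z·u meet: s from `X4`, 7s/12 from the target rate and -2δ from the
  -- flight. They nearly cancel because δ is close to s.
  have X5 : (1 - 2 * τ) * τ * ((1 + 7 / 12) * s - 2 * δ) * zu ≤ τ * s * 0.21 * (Z ^ 2 + W ^ 2) := by
    have hc : |(1 - 2 * τ) * τ * ((1 + 7 / 12) * s - 2 * δ)| ≤ τ * (0.42 * s) := by
      have h0 : |(1 + 7 / 12) * s - 2 * δ| ≤ 0.42 * s := by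
        rw [abs_le]; constructor <;> linarith
      rw [abs_mul, abs_mul, abs_of_nonneg hτ0, abs_of_nonneg (by linarith : 0 ≤ 1 - 2 * τ)]
      have : (1 - 2 * τ) * τ ≤ τ := by clear * - hτ0; nlinarith
      exact mul_le_mul this h0 (abs_nonneg _) hτ0
    have h1 := abs_mul_le_of_abs_le hc hzu
    have h2 : τ * s * (2 * (Z * W)) ≤ τ * s * (Z ^ 2 + W ^ 2) := by
      apply mul_le_mul_of_nonneg_left _ (by positivity)
      have := sq_nonneg (Z - W)
      clear * - this
      linarith
    clear * - h1 h2
    linarith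
  have hτZ : τ * Z ^ 2 ≤ m / 4 := by
    have := mul_le_mul_of_nonneg_right hτκ hZ2
    clear * - this hm
    linarith
  have X6 : s * (τ * Z ^ 2) * ((1 - 2 * τ) * (1 / 2) + 7 / 24 * (1 - 2 * τ) ^ 2 + 0.21) ≤
      s * (m / 4) * 1.002 := by
    apply mul_le_mul
    · exact mul_le_mul_of_nonneg_left hτZ hs0
    · clear * - hτ0 hτ8
      nlinarith
    · clear * - hτ0 hτ8
      nlinarith
    · positivity
  -- Budget for |u|²: the demands of `X1`, `X3`, `X4`, the target rate and `X5` are covered by the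
  -- damping νδ.
  have X7 : s * W ^ 2 * (0.0435 + 1 / 2 + (1 - 2 * τ) * τ + 7 / 12 * τ + 0.21 * τ)
      - ν * δ * W ^ 2 ≤ 0 := by
    have h1 : (0.94 + 2 * τ) * (0.966 * s) ≤ ν * δ :=
      mul_le_mul hν1 hδs (by positivity) hν0
    have h2 : s * (0.0435 + 1 / 2 + (1 - 2 * τ) * τ + 7 / 12 * τ + 0.21 * τ) ≤ ν * δ := by
      refine le_trans ?_ h1
      have h3 := mul_nonneg hs0 hτ0
      have h4 := mul_nonneg hs0 (mul_nonneg hτ0 hτ0)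
      clear * - h3 h4 hs0
      linarith
    have h3 := mul_le_mul_of_nonneg_right h2 hW2
    clear * - h3
    linarith
  -- Budget for ⟨z, Kz⟩: all demands, including the |z|² terms converted by 4τ ≤ κ in `X6`, are
  -- covered by the term (1 - 2τ)(1 - 2τδ) that the kick produces.
  have X8 : s * m * (0.0437 + 0.0056 + 2 / 13 + (1 - 2 * τ) * τ + 7 / 12 * τ + 1.002 / 4
      - (1 - 2 * τ) * (1 - 2 * τ * δ)) ≤ 0 := by
    apply mul_nonpos_of_nonneg_of_nonpos (by positivity)
    have h1 := mul_nonneg hτ0 (mul_nonneg hτ0 hδ0)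
    have h2 := mul_nonneg hτ0 hτ0
    clear * - hτδs h1 h2 hτ8
    linarith
  clear * - X1 X2 X3 X4 X5 X6 X7 X8
  linarith

end TwistedForm

end KineticLangevin

/-! ### Growth of the twisted form over half flights, with and without a kick. -/

namespace KineticLangevin

section TwistedForm

variable {E : Type*} [NormedAddCommGroup E] [InnerProductSpace ℝ E]

/-- Weighted Young inequality: 0.6 · 0.4336 just exceeds 0.51², and Y/M is dominated by √m. The
weights are shares of the full form, so that the cross term costs at most M times part of it. -/
lemma mul_mul_norm_le_of_sq_le {M m Y W : ℝ} (hM : 0 < M) (hY : Y ^ 2 ≤ M ^ 2 * m) :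
    1.02 * (Y * W) ≤ M * (0.6 * m + 0.4336 * W ^ 2) := by
  have h1 : M * (1.02 * (Y * W)) ≤ M * (M * (0.6 * m + 0.4336 * W ^ 2)) := by
    nlinarith [sq_nonneg (0.6 * Y - 0.51 * (M * W)), sq_nonneg (M * W)]
  exact le_of_mul_le_mul_left h1 hM

/-- Completing the square leaves 0.07 t²Z² with t = 1 - 2τ ≥ 3/4. It recovers |z|² from the form, so
that z·g can be absorbed without any lower bound on it. -/
lemma twisted_lower_bound {τ Z W zu : ℝ} (hτ8 : τ ≤ 1 / 8)
    (hzu : |zu| ≤ Z * W) :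
    0.0385 * Z ^ 2 ≤ (1 / 2) * (1 - 2 * τ) ^ 2 * Z ^ 2 + (1 - 2 * τ) * zu + 0.76 * W ^ 2 := by
  have ht : 0.75 ≤ 1 - 2 * τ := by linarith
  set t := 1 - 2 * τ
  have h1 : -(t * (Z * W)) ≤ t * zu := by
    have := mul_le_mul_of_nonneg_left (abs_le.1 hzu).1 (by linarith : 0 ≤ t)
    linarith
  have h2 : 0.0385 * Z ^ 2 ≤ 0.07 * (t * Z) ^ 2 := by
    have : (0.75 : ℝ) ^ 2 ≤ t ^ 2 := by gcongr
    nlinarith [mul_le_mul_of_nonneg_right this (sq_nonneg Z)]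
  nlinarith [sq_nonneg (t * Z - 1.17 * W), sq_nonneg W, sq_nonneg (t * Z)]

/-- Growth of the form under a synchronous kick of size `s` followed by a flight of size `s / 2`. -/
lemma twistedForm_kick_half_step_le (τ δ s Λ κ M : ℝ) (K : E →L[ℝ] E)
    (hK : ∀ x y : E, inner ℝ (K x) y = inner ℝ x (K y))
    (hΛ : ∀ x : E, inner ℝ x (K x) ≤ Λ * ‖x‖ ^ 2)
    (hKΛ : ∀ x : E, ‖K x‖ ^ 2 ≤ Λ * inner ℝ x (K x))
    (hκ : ∀ x : E, κ * ‖x‖ ^ 2 ≤ inner ℝ x (K x))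
    (hτ0 : 0 ≤ τ) (hτ8 : τ ≤ 1 / 8) (hτκ : 4 * τ ≤ κ) (hΛ0 : 0 ≤ Λ)
    (hs0 : 0 ≤ s) (hs : s ≤ 1 / 15) (hsΛ : s * Λ ≤ 1 / 55)
    (hδ1 : s / 2 - s ^ 2 / 8 ≤ δ) (hδ2 : δ ≤ s / 2) (hM1 : 1 ≤ M) (hMΛ : Λ ≤ M) (z u g : E)
    (hg : ‖g‖ ^ 2 ≤ κ / 13 * ‖z‖ ^ 2) :
    twistedForm τ K (z + δ • (u - s • (K z + g))) ((1 - δ) • (u - s • (K z + g))) ≤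
      (1 + s * M) * twistedForm τ K z u := by
  refine (twistedForm_kick_step_le τ δ s Λ K hK hΛ z u g).trans ?_
  have hku := abs_real_inner_le_norm (K z) u
  have hkg := abs_real_inner_le_norm (K z) g
  have hgu := abs_real_inner_le_norm g u
  have hzu := abs_real_inner_le_norm z u
  have hzg := abs_real_inner_le_norm z g
  have hk2 := hKΛ z
  have hm := hκ z
  rw [twistedForm_eq]
  set m := inner ℝ z (K z)
  set ku := inner ℝ (K z) u
  set kg := inner ℝ (K z) g
  set gu := inner ℝ g u
  set zu := inner ℝ z u
  set zg := inner ℝ z g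
  set Z := ‖z‖
  set W := ‖u‖
  set Y := ‖K z‖
  set G := ‖g‖
  have hZ : 0 ≤ Z := norm_nonneg _
  have hW : 0 ≤ W := norm_nonneg _
  have hY : 0 ≤ Y := norm_nonneg _
  have hG : 0 ≤ G := norm_nonneg _
  have hκ0 : 0 ≤ κ := by linarith
  have hm0 : 0 ≤ m := le_trans (by positivity) hm
  have hδ0 : 0 ≤ δ := by
    clear * - hs0 hs hδ1
    nlinarith
  have hδΛ : δ * Λ ≤ 1 / 110 := by
    have := mul_le_mul_of_nonneg_right hδ2 hΛ0
    clear * - this hsΛ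
    linarith
  have hδΛ0 : 0 ≤ δ * Λ := by positivity
  have hτ2 : τ ^ 2 ≤ 1 / 64 := by
    clear * - hτ0 hτ8
    nlinarith
  have hτδ : 0 ≤ (1 / 2) * (1 + 4 * τ ^ 2) * δ := by positivity
  have hδ30 : δ ≤ 1 / 30 := by linarith
  have hτδ' : (1 / 2) * (1 + 4 * τ ^ 2) * δ ≤ 17 / 960 := by
    clear * - hτ2 hδ30 hδ0
    nlinarith [sq_nonneg τ]
  set ν := 1 + 2 * τ - (1 / 2) * (1 + 4 * τ ^ 2) * δ - δ * Λ with hν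
  have hν1 : 0.97 + 2 * τ ≤ ν := by rw [hν]; linarith
  have hν2 : ν ≤ 1.25 := by rw [hν]; linarith
  have hν0 : 0 ≤ ν := by linarith
  have hνδ0 : 0 ≤ ν * δ := by positivity
  have hνδ : ν * δ ≤ 1.25 * (s / 2) := mul_le_mul hν2 hδ2 hδ0 (by norm_num)
  have hs2 : s ^ 2 ≤ s / 15 := by
    clear * - hs0 hs
    nlinarith
  have hδs : 0.491 * s ≤ δ := by
    clear * - hs2 hδ1 hs0
    linarith
  have hνδ' : 0.475 * s ≤ ν * δ := by
    have h1 : 0.97 * (0.491 * s) ≤ ν * δ :=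
      mul_le_mul (by linarith) hδs (by positivity) hν0
    clear * - h1 hs0
    linarith
  have hsνδ0 : 0 ≤ s * (ν * δ) := by positivity
  have hsνδ : s * (ν * δ) ≤ s * (1.25 * (s / 2)) := mul_le_mul_of_nonneg_left hνδ hs0
  have hs3 : s * s ^ 2 ≤ 1 / 15 * s ^ 2 := mul_le_mul_of_nonneg_right hs (sq_nonneg s)
  have hs2νδ0 : s ^ 2 * (0.475 * s) ≤ s ^ 2 * (ν * δ) :=
    mul_le_mul_of_nonneg_left hνδ' (sq_nonneg s)
  have hs2νδ : s ^ 2 * (ν * δ) ≤ s ^ 2 * (1.25 * (s / 2)) :=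
    mul_le_mul_of_nonneg_left hνδ (sq_nonneg s)
  have hsδ1 : s * (s / 2 - s ^ 2 / 8) ≤ s * δ := mul_le_mul_of_nonneg_left hδ1 hs0
  have hsδ2 : s * δ ≤ s * (s / 2) := mul_le_mul_of_nonneg_left hδ2 hs0
  have hW2 : 0 ≤ W ^ 2 := by positivity
  have hZ2 : 0 ≤ Z ^ 2 := by positivity
  have hG2 : G ^ 2 ≤ m / 13 := by linarith
  have hsm : 0 ≤ s * m := by positivity
  have hsY : (s * Y) ^ 2 ≤ m / 825 := by
    have : s ^ 2 * Y ^ 2 ≤ s ^ 2 * (Λ * m) := mul_le_mul_of_nonneg_left hk2 (sq_nonneg s)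
    have h2 : s * ((s * Λ) * m) ≤ s * ((1 / 55) * m) := by gcongr
    have h3 : s * ((1 / 55) * m) ≤ 1 / 15 * ((1 / 55) * m) := by gcongr
    clear * - this h2 h3
    linarith
  have X1 : (2 * δ - 2 * s * (1 - ν * δ)) * ku ≤ s * (M * (0.6 * m + 0.4336 * W ^ 2)) := by
    have hc : |2 * δ - 2 * s * (1 - ν * δ)| ≤ 1.02 * s := by
      clear * - hδ1 hδ2 hsνδ0 hsνδ hs2 hs0
      rw [abs_le]; constructor <;> linarith
    have h1 := abs_mul_le_of_abs_le hc hku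
    have hYM : Y ^ 2 ≤ M ^ 2 * m := by
      refine hk2.trans (mul_le_mul_of_nonneg_right ?_ hm0)
      clear * - hM1 hMΛ
      nlinarith
    have h2 := mul_le_mul_of_nonneg_left
      (mul_mul_norm_le_of_sq_le (W := W) (by linarith : 0 < M) hYM) hs0
    clear * - h1 h2
    linarith
  have X2 : -(2 * δ * s) * (Y ^ 2 + kg) + (1 - ν * δ) * s ^ 2 * (Y ^ 2 + 2 * kg + G ^ 2)
      ≤ s * (0.016 * m) := by
    have hc : |2 * s ^ 2 * (1 - ν * δ) - 2 * δ * s| ≤ s * (1.02 * s) := by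
      clear * - hsδ1 hsδ2 hs2νδ0 hs2νδ hs3 hs2 hs0
      rw [abs_le]; constructor <;> nlinarith
    have h1 := abs_mul_le_of_abs_le hc hkg
    have h2 : 1.02 * (s * Y * G) ≤ 0.51 * (8 * (s * Y) ^ 2 + G ^ 2 / 8) := by
      clear * -
      nlinarith [sq_nonneg (8 * (s * Y) - G)]
    have h2' := mul_le_mul_of_nonneg_left h2 hs0
    have h2'' := mul_le_mul_of_nonneg_left hsY hs0
    have h2g := mul_le_mul_of_nonneg_left hG2 hs0
    have h3 : (s ^ 2 * (1 - ν * δ) - 2 * δ * s) * Y ^ 2 ≤ 0 := by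
      apply mul_nonpos_of_nonpos_of_nonneg _ (sq_nonneg Y)
      have h0 : 0 ≤ s ^ 2 * s := by positivity
      clear * - hsδ1 hs2νδ0 h0
      linarith
    have h4 : s ^ 2 * (1 - ν * δ) * G ^ 2 ≤ s ^ 2 * G ^ 2 := by
      apply mul_le_mul_of_nonneg_right _ (sq_nonneg G)
      have h0 : 0 ≤ s ^ 2 * s := by positivity
      clear * - hs2νδ0 h0
      linarith
    have h5 : s ^ 2 * G ^ 2 ≤ s / 15 * (m / 13) := by
      apply mul_le_mul hs2 hG2 (by positivity) (by positivity)
    clear * - h1 h2' h2'' h2g h3 h4 h5 hsm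
    linarith
  have X3 : -(2 * s * (1 - ν * δ)) * gu ≤ s * (4 / 13 * m + 1 / 4 * W ^ 2) := by
    have hc : |-(2 * s * (1 - ν * δ))| ≤ 2 * s := by
      have h0 : 0 ≤ s * s := by positivity
      clear * - hsνδ0 hsνδ hs2 hs0
      rw [abs_le]; constructor <;> linarith
    have h1 := abs_mul_le_of_abs_le hc hgu
    have h2 : s * (2 * (G * W)) ≤ s * (4 / 13 * m + 1 / 4 * W ^ 2) := by
      apply mul_le_mul_of_nonneg_left _ hs0
      clear * - hG2
      nlinarith [sq_nonneg (4 * G - W)]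
    clear * - h1 h2
    linarith
  have hτδs : τ * δ ≤ τ / 30 := by
    have := mul_le_mul_of_nonneg_left hδ30 hτ0
    linarith
  have hτδ00 : 0 ≤ τ * δ := by positivity
  -- No sign information on z·g is assumed here, so Cauchy–Schwarz and |g|² ≤ m/13 are used; 0.0385
  -- is just large enough, as 0.0385 · 0.5 · 13 > 1/4.
  have X4 : -((1 - 2 * τ) * ((1 - 2 * τ * δ) * s)) * zg ≤ s * (0.0385 * Z ^ 2 + 0.5 * m) := by
    have hc : |-((1 - 2 * τ) * ((1 - 2 * τ * δ) * s))| ≤ s := by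
      have h0 : 0 ≤ (1 - 2 * τ * δ) * s := mul_nonneg (by linarith) hs0
      rw [abs_neg, abs_of_nonneg (mul_nonneg (by linarith) h0)]
      have h1 : 0 ≤ τ * ((1 - 2 * τ * δ) * s) := mul_nonneg hτ0 h0
      have h2 : 0 ≤ τ * δ * s := by positivity
      clear * - h1 h2
      linarith
    have h1 := abs_mul_le_of_abs_le hc hzg
    have h2 : Z * G ≤ 0.0385 * Z ^ 2 + 0.5 * m := by
      clear * - hG2
      nlinarith [sq_nonneg (0.0385 * Z - 0.5 * G), sq_nonneg G]
    have h3 := mul_le_mul_of_nonneg_left h2 hs0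
    clear * - h1 h3
    linarith
  have hτZ : τ * Z ^ 2 ≤ m / 4 := by
    have := mul_le_mul_of_nonneg_right hτκ hZ2
    clear * - this hm
    linarith
  have X5 : -((1 - 2 * τ) * (2 * τ * δ)) * zu ≤ s * (m / 4 + W ^ 2 / 32) := by
    have hc : |-((1 - 2 * τ) * (2 * τ * δ))| ≤ s * τ := by
      have h0 : 0 ≤ 2 * τ * δ := by positivity
      rw [abs_neg, abs_of_nonneg (mul_nonneg (by linarith) h0)]
      have h1 : 0 ≤ τ * (2 * τ * δ) := mul_nonneg hτ0 h0
      have h2 := mul_le_mul_of_nonneg_left hδ2 hτ0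
      clear * - h1 h2
      linarith
    have h1 := abs_mul_le_of_abs_le hc hzu
    have h2 : τ * (Z * W) ≤ m / 4 + W ^ 2 / 32 := by
      have h3 : τ * (Z * W) ≤ τ * (Z ^ 2 + W ^ 2 / 4) := by
        apply mul_le_mul_of_nonneg_left _ hτ0
        clear * -
        nlinarith [sq_nonneg (2 * Z - W)]
      have h4 : τ * W ^ 2 ≤ 1 / 8 * W ^ 2 := mul_le_mul_of_nonneg_right hτ8 hW2
      clear * - h3 h4 hτZ
      linarith
    have h3 := mul_le_mul_of_nonneg_left h2 hs0
    clear * - h1 h3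
    linarith
  have X6 : 0.475 * s * W ^ 2 ≤ ν * δ * W ^ 2 := mul_le_mul_of_nonneg_right hνδ' hW2
  have X7 : s * (0.73 * m) ≤ (1 - 2 * τ) * ((1 - 2 * τ * δ) * s) * m := by
    have h0 : 0.73 ≤ (1 - 2 * τ) * (1 - 2 * τ * δ) := by
      have h1 : 0 ≤ τ * (τ * δ) := by positivity
      clear * - h1 hτδs hτ8
      linarith
    have := mul_le_mul_of_nonneg_right h0 hsm
    clear * - this
    linarith
  -- This needs 0.76|u|², while `X9` leaves 0.5664|u|². The damping remaining after `X3` and `X5`,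
  -- 0.475 - 1/4 - 1/32, covers the difference.
  have X8 := mul_le_mul_of_nonneg_left (twisted_lower_bound hτ8 hzu) hs0
  -- Complement of the share 0.6m + 0.4336W² that `X1` took of the form. It is nonnegative, so M ≥ 1
  -- lets the two shares add up to M times the whole form.
  have X9 : s * (0.4 * m + (1 / 2) * (1 - 2 * τ) ^ 2 * Z ^ 2 + (1 - 2 * τ) * zu + 0.5664 * W ^ 2)
      ≤ s * (M * (0.4 * m + (1 / 2) * (1 - 2 * τ) ^ 2 * Z ^ 2 + (1 - 2 * τ) * zu
          + 0.5664 * W ^ 2)) := by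
    apply mul_le_mul_of_nonneg_left _ hs0
    have h0 : 0 ≤ 0.4 * m + (1 / 2) * (1 - 2 * τ) ^ 2 * Z ^ 2 + (1 - 2 * τ) * zu
          + 0.5664 * W ^ 2 := by
      have h1 : (1 - 2 * τ) * (-(Z * W)) ≤ (1 - 2 * τ) * zu :=
        mul_le_mul_of_nonneg_left (abs_le.1 hzu).1 (by linarith)
      have h2 := sq_nonneg ((1 - 2 * τ) * Z - W)
      clear * - h1 h2 hm0 hW2
      nlinarith
    have := mul_le_mul_of_nonneg_right hM1 h0
    linarith
  have X10 : 0 ≤ s * W ^ 2 := by positivity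
  clear * - X1 X2 X3 X4 X5 X6 X7 X8 X9 X10 hsm
  linarith

/-- Growth of the form under a flight of size `s / 2`. -/
lemma twistedForm_half_flight_le (τ δ s Λ κ M : ℝ) (K : E →L[ℝ] E)
    (hK : ∀ x y : E, inner ℝ (K x) y = inner ℝ x (K y))
    (hΛ : ∀ x : E, inner ℝ x (K x) ≤ Λ * ‖x‖ ^ 2)
    (hKΛ : ∀ x : E, ‖K x‖ ^ 2 ≤ Λ * inner ℝ x (K x))
    (hκ : ∀ x : E, κ * ‖x‖ ^ 2 ≤ inner ℝ x (K x))
    (hτ0 : 0 ≤ τ) (hτ8 : τ ≤ 1 / 8) (hτκ : 4 * τ ≤ κ) (hΛ0 : 0 ≤ Λ)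
    (hs0 : 0 ≤ s) (hs : s ≤ 1 / 15) (hsΛ : s * Λ ≤ 1 / 55)
    (hδ0 : 0 ≤ δ) (hδ2 : δ ≤ s / 2) (hM1 : 1 ≤ M) (hMΛ : Λ ≤ M) (z u : E) :
    twistedForm τ K (z + δ • u) ((1 - δ) • u) ≤ (1 + s * M) * twistedForm τ K z u := by
  have hku := abs_real_inner_le_norm (K z) u
  have hzu := abs_real_inner_le_norm z u
  have hk2 := hKΛ z
  have hm := hκ z
  have hu := hΛ u
  rw [twistedForm_step τ δ K hK, twistedForm_eq]
  set m := inner ℝ z (K z)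
  set ku := inner ℝ (K z) u
  set zu := inner ℝ z u
  set μ := inner ℝ u (K u)
  set Z := ‖z‖
  set W := ‖u‖
  set Y := ‖K z‖
  have hZ : 0 ≤ Z := norm_nonneg _
  have hW : 0 ≤ W := norm_nonneg _
  have hY : 0 ≤ Y := norm_nonneg _
  have hκ0 : 0 ≤ κ := by linarith
  have hW2 : 0 ≤ W ^ 2 := by positivity
  have hZ2 : 0 ≤ Z ^ 2 := by positivity
  have hm0 : 0 ≤ m := le_trans (by positivity) hm
  have hδΛ : δ * Λ ≤ 1 / 110 := by
    have := mul_le_mul_of_nonneg_right hδ2 hΛ0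
    clear * - this hsΛ
    linarith
  have hτ2 : τ ^ 2 ≤ 1 / 64 := by
    clear * - hτ0 hτ8
    nlinarith
  have hδ30 : δ ≤ 1 / 30 := by linarith
  have X1 : 2 * δ * ku ≤ s * (M * (0.6 * m + 0.4336 * W ^ 2)) := by
    have hc : |2 * δ| ≤ 1.02 * s := by
      rw [abs_of_nonneg (by positivity)]
      linarith
    have h1 := abs_mul_le_of_abs_le hc hku
    have hYM : Y ^ 2 ≤ M ^ 2 * m := by
      refine hk2.trans (mul_le_mul_of_nonneg_right ?_ hm0)
      clear * - hM1 hMΛ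
      nlinarith
    have h2 := mul_le_mul_of_nonneg_left
      (mul_mul_norm_le_of_sq_le (W := W) (by linarith : 0 < M) hYM) hs0
    clear * - h1 h2
    linarith
  have X2 : δ ^ 2 * μ + (1 - (1 + 2 * τ) * δ + (1 / 2) * (1 + 4 * τ ^ 2) * δ ^ 2) * W ^ 2
      ≤ (1 - 0.9 * δ) * W ^ 2 := by
    have h1 : δ ^ 2 * μ ≤ δ ^ 2 * (Λ * W ^ 2) := mul_le_mul_of_nonneg_left hu (sq_nonneg δ)
    have h2 : δ * (δ * Λ) ≤ δ * (1 / 110) := mul_le_mul_of_nonneg_left hδΛ hδ0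
    have h3 : δ * δ ≤ δ * (1 / 30) := mul_le_mul_of_nonneg_left hδ30 hδ0
    have h4 : τ ^ 2 * (δ * δ) ≤ 1 / 64 * (δ * δ) := mul_le_mul_of_nonneg_right hτ2 (by positivity)
    have h5 : 0 ≤ τ * δ := by positivity
    have h6 : δ * (δ * Λ) + (1 - (1 + 2 * τ) * δ + (1 / 2) * (1 + 4 * τ ^ 2) * δ ^ 2)
        ≤ 1 - 0.9 * δ := by
      clear * - h2 h3 h4 h5 hδ0
      linarith
    have h7 := mul_le_mul_of_nonneg_right h6 hW2
    clear * - h1 h7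
    linarith
  have hτZ : τ * Z ^ 2 ≤ m / 4 := by
    have := mul_le_mul_of_nonneg_right hτκ hZ2
    clear * - this hm
    linarith
  have X5 : -((1 - 2 * τ) * (2 * τ * δ)) * zu ≤ s * (m / 4 + W ^ 2 / 32) := by
    have hc : |-((1 - 2 * τ) * (2 * τ * δ))| ≤ s * τ := by
      have h0 : 0 ≤ 2 * τ * δ := by positivity
      rw [abs_neg, abs_of_nonneg (mul_nonneg (by linarith) h0)]
      have h1 : 0 ≤ τ * (2 * τ * δ) := mul_nonneg hτ0 h0
      have h2 := mul_le_mul_of_nonneg_left hδ2 hτ0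
      clear * - h1 h2
      linarith
    have h1 := abs_mul_le_of_abs_le hc hzu
    have h2 : τ * (Z * W) ≤ m / 4 + W ^ 2 / 32 := by
      have h3 : τ * (Z * W) ≤ τ * (Z ^ 2 + W ^ 2 / 4) := by
        apply mul_le_mul_of_nonneg_left _ hτ0
        clear * -
        nlinarith [sq_nonneg (2 * Z - W)]
      have h4 : τ * W ^ 2 ≤ 1 / 8 * W ^ 2 := mul_le_mul_of_nonneg_right hτ8 hW2
      clear * - h3 h4 hτZ
      linarith
    have h3 := mul_le_mul_of_nonneg_left h2 hs0
    clear * - h1 h3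
    linarith
  have X9 : s * (0.4 * m + 0.0664 * W ^ 2)
      ≤ s * (M * (0.4 * m + (1 / 2) * (1 - 2 * τ) ^ 2 * Z ^ 2 + (1 - 2 * τ) * zu
          + 0.5664 * W ^ 2)) := by
    apply mul_le_mul_of_nonneg_left _ hs0
    have h0 : 0.4 * m + 0.0664 * W ^ 2 ≤ 0.4 * m + (1 / 2) * (1 - 2 * τ) ^ 2 * Z ^ 2
          + (1 - 2 * τ) * zu + 0.5664 * W ^ 2 := by
      have h1 : (1 - 2 * τ) * (-(Z * W)) ≤ (1 - 2 * τ) * zu :=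
        mul_le_mul_of_nonneg_left (abs_le.1 hzu).1 (by linarith)
      have h2 := sq_nonneg ((1 - 2 * τ) * Z - W)
      clear * - h1 h2
      nlinarith
    have h1 : 0 ≤ 0.4 * m + 0.0664 * W ^ 2 := by positivity
    have := mul_le_mul_of_nonneg_right hM1 (h1.trans h0)
    linarith
  have hsm : 0 ≤ s * m := by positivity
  have hsW : 0 ≤ s * W ^ 2 := by positivity
  have hδW : 0 ≤ δ * W ^ 2 := by positivity
  clear * - X1 X2 X5 X9 hsm hsW hδW
  linarith

end TwistedForm

end KineticLangevin

/-! ### The norm defined by the twisted form, its equivalence with |z| and |q|, and spectral bounds.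
-/

namespace KineticLangevin

section TwistedForm

variable {E : Type*} [NormedAddCommGroup E] [InnerProductSpace ℝ E]

lemma twistedForm_nonneg {τ : ℝ} {K : E →L[ℝ] E} (hpos : ∀ x : E, 0 ≤ inner ℝ x (K x)) (z u : E) :
    0 ≤ twistedForm τ K z u := by
  have := hpos z
  rw [twistedForm]
  positivity

lemma twistedForm_smul (τ : ℝ) (K : E →L[ℝ] E) (t : ℝ) (z u : E) :
    twistedForm τ K (t • z) (t • u) = t ^ 2 * twistedForm τ K z u := by
  have h : (1 - 2 * τ) • t • z + t • u = t • ((1 - 2 * τ) • z + u) := by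
    rw [smul_add, smul_comm]
  rw [twistedForm, twistedForm, h, norm_smul, norm_smul, mul_pow, mul_pow, Real.norm_eq_abs, sq_abs,
    map_smul, inner_smul_left, inner_smul_right, conj_trivial]
  ring

/-- Minkowski's inequality for the twisted form. -/
lemma sqrt_twistedForm_add_le {τ : ℝ} {K : E →L[ℝ] E}
    (hK : ∀ x y : E, inner ℝ (K x) y = inner ℝ x (K y))
    (hpos : ∀ x : E, 0 ≤ inner ℝ x (K x)) (z₁ z₂ u₁ u₂ : E) :
    √(twistedForm τ K (z₁ + z₂) (u₁ + u₂)) ≤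
      √(twistedForm τ K z₁ u₁) + √(twistedForm τ K z₂ u₂) := by
  set S := twistedForm τ K z₁ u₁ with hS
  set T := twistedForm τ K z₂ u₂ with hT
  set p₁ := (1 - 2 * τ) • z₁ + u₁
  set p₂ := (1 - 2 * τ) • z₂ + u₂
  have hS0 : 0 ≤ S := twistedForm_nonneg hpos _ _
  have hT0 : 0 ≤ T := twistedForm_nonneg hpos _ _
  set B := inner ℝ z₁ (K z₂) + (1 / 2) * inner ℝ p₁ p₂ + (1 / 2) * inner ℝ u₁ u₂ with hB
  have hquad : ∀ t : ℝ, twistedForm τ K (t • z₁ + z₂) (t • u₁ + u₂)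
      = S * (t * t) + 2 * B * t + T := by
    intro t
    have h1 : inner ℝ z₂ (K z₁) = inner ℝ z₁ (K z₂) := by
      rw [← hK z₂ z₁]; exact real_inner_comm _ _
    have h2 : (1 - 2 * τ) • (t • z₁ + z₂) + (t • u₁ + u₂) = t • p₁ + p₂ := by
      simp only [p₁, p₂, smul_add, smul_comm t]; abel
    have h3 : inner ℝ p₂ p₁ = inner ℝ p₁ p₂ := real_inner_comm _ _
    have h4 : inner ℝ u₂ u₁ = inner ℝ u₁ u₂ := real_inner_comm _ _
    rw [hS, hT, hB, twistedForm, twistedForm, twistedForm, h2]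
    rw [← real_inner_self_eq_norm_sq (t • p₁ + p₂), ← real_inner_self_eq_norm_sq (t • u₁ + u₂)]
    simp only [map_add, map_smul, inner_add_left, inner_add_right, inner_smul_left,
      inner_smul_right, conj_trivial, h1, h3, h4, real_inner_self_eq_norm_sq]
    ring
  -- Cauchy–Schwarz for the bilinear form belonging to `twistedForm`, as nonpositivity of the
  -- discriminant of a nonnegative quadratic.
  have hdisc := discrim_le_zero (a := S) (b := 2 * B) (c := T)
    (fun t => (hquad t) ▸ twistedForm_nonneg hpos _ _)
  have hBB : B ≤ √S * √T := by
    rw [← Real.sqrt_mul hS0]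
    apply Real.le_sqrt_of_sq_le
    rw [discrim] at hdisc
    nlinarith
  have h1 : twistedForm τ K (z₁ + z₂) (u₁ + u₂) = S + 2 * B + T := by
    simpa using hquad 1
  rw [h1]
  apply Real.sqrt_le_iff.2
  refine ⟨by positivity, ?_⟩
  nlinarith [Real.sq_sqrt hS0, Real.sq_sqrt hT0]

/-- With q = z + u the form reads ⟨z, Kz⟩ + (1/2 + 2τ²)|z|² - (1 + 2τ) z·q + |q|². The constant 3/4
works because τ ≤ 1/8 gives 1/2 + 2τ² ≤ 9/16 and 1 + 2τ ≤ 3/2. -/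
lemma sqrt_twistedForm_le {τ Λ : ℝ} {K : E →L[ℝ] E} (hΛ : ∀ x : E, inner ℝ x (K x) ≤ Λ * ‖x‖ ^ 2)
    (hΛ0 : 0 ≤ Λ) (hτ0 : 0 ≤ τ) (hτ8 : τ ≤ 1 / 8) (z u : E) :
    √(twistedForm τ K z u) ≤ (√Λ + 3 / 4) * ‖z‖ + ‖z + u‖ := by
  apply Real.sqrt_le_iff.2
  refine ⟨by positivity, ?_⟩
  obtain ⟨q, rfl⟩ : ∃ q, u = q - z := ⟨z + u, by abel⟩
  rw [add_sub_cancel]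
  have hz := hΛ z
  have hqz := (abs_le.1 (abs_real_inner_le_norm z q)).1
  have h2 : ‖q - z‖ ^ 2 = ‖q‖ ^ 2 - 2 * inner ℝ z q + ‖z‖ ^ 2 := by
    rw [norm_sub_sq_real, real_inner_comm]
  rw [twistedForm_eq, h2, inner_sub_right, real_inner_self_eq_norm_sq]
  set m := inner ℝ z (K z)
  set x := inner ℝ z q
  set Z := ‖z‖
  set Q := ‖q‖
  have hZ : 0 ≤ Z := norm_nonneg _
  have hQ : 0 ≤ Q := norm_nonneg _
  have hs := Real.sq_sqrt hΛ0
  have hs0 := Real.sqrt_nonneg Λ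
  set r := √Λ
  have h3 : 0 ≤ r * Z * (Z + Q) := by positivity
  have h4 : 0 ≤ τ * (Z * Q) := by positivity
  have h5 : τ ^ 2 * Z ^ 2 ≤ 1 / 64 * Z ^ 2 := by
    apply mul_le_mul_of_nonneg_right _ (sq_nonneg Z)
    nlinarith
  have h6 : -((1 + 2 * τ) * x) ≤ (1 + 2 * τ) * (Z * Q) := by
    nlinarith [mul_le_mul_of_nonneg_left hqz (by linarith : 0 ≤ 1 + 2 * τ)]
  have h7 : τ * (Z * Q) ≤ 1 / 8 * (Z * Q) := mul_le_mul_of_nonneg_right hτ8 (by positivity)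
  have h8 : 0 ≤ Z * Q := by positivity
  have h9 : r ^ 2 * Z ^ 2 = Λ * Z ^ 2 := by rw [hs]
  nlinarith

/-- In the variables z, q, completing the square of (q - (1 + 2τ)z)/√2 costs 2τ|z|², which 4τ ≤ κ
bounds by κ|z|²/2. Half of |q|² and enough of κ|z|² remain. -/
lemma le_sqrt_twistedForm {τ κ : ℝ} {K : E →L[ℝ] E}
    (hκ : ∀ x : E, κ * ‖x‖ ^ 2 ≤ inner ℝ x (K x)) (hτ0 : 0 ≤ τ) (hτκ : 4 * τ ≤ κ) (z u : E) :
    √κ / √8 * ‖z‖ + 1 / 2 * ‖z + u‖ ≤ √(twistedForm τ K z u) := by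
  apply Real.le_sqrt_of_sq_le
  obtain ⟨q, rfl⟩ : ∃ q, u = q - z := ⟨z + u, by abel⟩
  rw [add_sub_cancel]
  have hκ0 : 0 ≤ κ := by linarith
  have hz := hκ z
  have hqz := (abs_le.1 (abs_real_inner_le_norm z q)).2
  have h2 : ‖q - z‖ ^ 2 = ‖q‖ ^ 2 - 2 * inner ℝ z q + ‖z‖ ^ 2 := by
    rw [norm_sub_sq_real, real_inner_comm]
  rw [twistedForm_eq, h2, inner_sub_right, real_inner_self_eq_norm_sq]
  have hr : (√κ / √8) ^ 2 = κ / 8 := by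
    rw [div_pow, Real.sq_sqrt hκ0, Real.sq_sqrt (by norm_num)]
  set m := inner ℝ z (K z)
  set x := inner ℝ z q
  set Z := ‖z‖
  set Q := ‖q‖
  set r := √κ / √8
  have hZ : 0 ≤ Z := norm_nonneg _
  have hQ : 0 ≤ Q := norm_nonneg _
  have h3 : r ^ 2 * Z ^ 2 = κ / 8 * Z ^ 2 := by rw [hr]
  have h4 : (r * Z + 1 / 2 * Q) ^ 2 ≤ 2 * (r ^ 2 * Z ^ 2) + 1 / 2 * Q ^ 2 := by
    nlinarith [sq_nonneg (r * Z - 1 / 2 * Q)]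
  have h6 : (1 + 2 * τ) * x ≤ (1 + 2 * τ) * (Z * Q) :=
    mul_le_mul_of_nonneg_left hqz (by linarith)
  have h7 : τ * Z ^ 2 ≤ κ / 4 * Z ^ 2 :=
    mul_le_mul_of_nonneg_right (by linarith) (sq_nonneg Z)
  nlinarith [sq_nonneg (Q - (1 + 2 * τ) * Z), mul_nonneg hκ0 (sq_nonneg Z)]

/-- For a symmetric nonnegative `K` with `⟨x, K x⟩ ≤ Λ ‖x‖²` one has `‖K x‖² ≤ Λ ⟨x, K x⟩`. -/
lemma norm_sq_apply_le {Λ : ℝ} {K : E →L[ℝ] E}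
    (hK : ∀ x y : E, inner ℝ (K x) y = inner ℝ x (K y))
    (hpos : ∀ x : E, 0 ≤ inner ℝ x (K x)) (hΛ : ∀ x : E, inner ℝ x (K x) ≤ Λ * ‖x‖ ^ 2)
    (x : E) : ‖K x‖ ^ 2 ≤ Λ * inner ℝ x (K x) := by
  set m := inner ℝ x (K x) with hm
  set y := inner ℝ (K x) (K (K x)) with hy
  -- Cauchy–Schwarz for the semidefinite form ⟨·, K·⟩ between x and Kx, again through a
  -- discriminant.
  have hquad : ∀ t : ℝ, 0 ≤ m * (t * t) + (2 * ‖K x‖ ^ 2) * t + y := by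
    intro t
    have h := hpos (t • x + K x)
    have h1 : inner ℝ x (K (K x)) = ‖K x‖ ^ 2 := by
      rw [← hK, real_inner_self_eq_norm_sq]
    simp only [map_add, map_smul, inner_add_left, inner_add_right, inner_smul_left,
      inner_smul_right, conj_trivial, h1, real_inner_self_eq_norm_sq] at h
    rw [hm, hy]
    nlinarith
  have hd := discrim_le_zero hquad
  rw [discrim] at hd
  have hyΛ : y ≤ Λ * ‖K x‖ ^ 2 := hΛ (K x)
  rcases eq_or_ne (‖K x‖ ^ 2) 0 with h0 | h0
  · have hm0 : m = 0 := by
      have : K x = 0 := by simpa using h0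
      rw [hm, this, inner_zero_right]
    rw [h0, hm0]; simp
  · have h1 : 0 < ‖K x‖ ^ 2 := lt_of_le_of_ne (sq_nonneg _) h0.symm
    have h2 : ‖K x‖ ^ 2 * ‖K x‖ ^ 2 ≤ (Λ * m) * ‖K x‖ ^ 2 := by
      nlinarith [mul_le_mul_of_nonneg_left hyΛ (hpos x)]
    exact le_of_mul_le_mul_right h2 h1

end TwistedForm

/-- A symmetric operator is bounded below by its smallest eigenvalue. -/
lemma smallest_eigenvalue_le {d : ℕ} {K : Pos d →L[ℝ] Pos d} {κ : ℝ}
    (hK : ∀ x y : Pos d, inner ℝ (K x) y = inner ℝ x (K y))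
    (hκ : IsLeast {μ : ℝ | Module.End.HasEigenvalue (K : Pos d →ₗ[ℝ] Pos d) μ} κ) (x : Pos d) :
    κ * ‖x‖ ^ 2 ≤ inner ℝ x (K x) := by
  have hsym : (K : Pos d →ₗ[ℝ] Pos d).IsSymmetric := hK
  have hn : Module.finrank ℝ (Pos d) = d := by simp
  set b := hsym.eigenvectorBasis hn
  have h1 : inner ℝ x (K x) = ∑ i, hsym.eigenvalues hn i * (inner ℝ (b i) x) ^ 2 := by
    rw [← b.sum_inner_mul_inner x (K x)]
    refine Finset.sum_congr rfl fun i _ => ?_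
    have h2 : inner ℝ (b i) (K x) = hsym.eigenvalues hn i * inner ℝ (b i) x := by
      rw [← hK]
      have := hsym.apply_eigenvectorBasis hn i
      change inner ℝ ((K : Pos d →ₗ[ℝ] Pos d) (b i)) x = _
      rw [this, inner_smul_left]
      simp [b]
    rw [h2, real_inner_comm x (b i)]
    ring
  rw [h1, ← b.sum_sq_norm_inner_right x, Finset.mul_sum]
  refine Finset.sum_le_sum fun i _ => ?_
  rw [Real.norm_eq_abs, sq_abs]
  exact mul_le_mul_of_nonneg_right (hκ.2 (hsym.hasEigenvalue_eigenvalues hn i)) (sq_nonneg _)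

/-- The gradient of the remainder `G`. -/
lemma gradient_G {d : ℕ} {U : Pos d → ℝ} {p : Params d} (hU : Differentiable ℝ U)
    (hK : ∀ x y : Pos d, inner ℝ (p.K x) y = inner ℝ x (p.K y)) (x : Pos d) :
    gradient (p.G U) x = gradient U x - p.K x := by
  apply HasGradientAt.gradient
  rw [hasGradientAt_iff_hasFDerivAt, map_sub]
  have h1 : HasFDerivAt U (InnerProductSpace.toDual ℝ (Pos d) (gradient U x)) x :=
    (hU x).hasGradientAt.hasFDerivAt
  have h2 : HasFDerivAt (fun y : Pos d => inner ℝ y (p.K y))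
      ((2 : ℝ) • InnerProductSpace.toDual ℝ (Pos d) (p.K x)) x := by
    have h3 := (hasFDerivAt_id x).inner ℝ (p.K.hasFDerivAt (x := x))
    refine h3.congr_fderiv ?_
    ext y
    simp [fderivInnerCLM_apply, ← hK x y, real_inner_comm, two_mul]
  have h3 := h1.sub (h2.const_mul (1 / 2))
  refine h3.congr_fderiv ?_
  rw [smul_smul]
  norm_num

end KineticLangevin

/-! ### Rescaled parameters, comparison of r_s with r_l, and the constants built from them. -/

namespace KineticLangevin

namespace Params

variable {d : ℕ} (p : Params d)

/-- `γ⁻² K`. -/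
noncomputable def Ks : Pos d →L[ℝ] Pos d := (p.γ ^ 2)⁻¹ • p.K

/-- `γ⁻² κ`. -/
noncomputable def kap : ℝ := p.κ / p.γ ^ 2

/-- `γ⁻² L_K`. -/
noncomputable def lam : ℝ := p.LK / p.γ ^ 2

lemma rl_eq (a b : Phase d) :
    p.rl a b = √(twistedForm p.τ p.Ks (a.1 - b.1) (p.γ⁻¹ • (a.2 - b.2))) := by
  rw [rl, twistedForm, Ks]
  congr 1
  rw [norm_smul (p.γ⁻¹) (a.2 - b.2), mul_pow, Real.norm_eq_abs, sq_abs,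
    smul_apply, inner_smul_right, inv_pow]
  ring

lemma rl_nonneg (a b : Phase d) : 0 ≤ p.rl a b := Real.sqrt_nonneg _

lemma ε_le_half : p.ε ≤ 1 / 2 := by
  have : min 1 (min (2 * p.α / (3 * (√p.LK * p.γ⁻¹))) p.α) ≤ 1 := min_le_left _ _
  rw [ε]
  linarith

lemma ε_le_half_α : p.ε ≤ 1 / 2 * p.α := by
  rw [ε]
  exact mul_le_mul_of_nonneg_left ((min_le_right _ _).trans (min_le_right _ _)) (by norm_num)

/-- Both r_s and r_l depend only on the difference of the pair and are homogeneous in it; comparing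
t(a - b) with 0 lets a pair be scaled to any prescribed value of Δ. -/
lemma rs_smul {t : ℝ} (ht : 0 ≤ t) (a b : Phase d) :
    p.rs (t • (a - b)) 0 = t * p.rs a b := by
  simp only [rs, q, Prod.smul_fst, Prod.smul_snd, Prod.fst_sub, Prod.snd_sub, Prod.fst_zero,
    Prod.snd_zero, sub_zero]
  rw [smul_comm p.γ⁻¹ t, ← smul_add, norm_smul, norm_smul, Real.norm_of_nonneg ht]
  ring

lemma rl_smul {t : ℝ} (ht : 0 ≤ t) (a b : Phase d) :
    p.rl (t • (a - b)) 0 = t * p.rl a b := by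
  rw [rl_eq, rl_eq]
  simp only [Prod.smul_fst, Prod.smul_snd, Prod.fst_sub, Prod.snd_sub, Prod.fst_zero,
    Prod.snd_zero, sub_zero]
  rw [smul_comm p.γ⁻¹ t, twistedForm_smul, Real.sqrt_mul (sq_nonneg t), Real.sqrt_sq ht]

lemma Δ_smul {t : ℝ} (ht : 0 ≤ t) (a b : Phase d) :
    p.Δ (t • (a - b)) 0 = t * p.Δ a b := by
  rw [Δ, Δ, p.rs_smul ht, p.rl_smul ht]
  ring

end Params

namespace PotentialAssumption

variable {d : ℕ} {U : Pos d → ℝ} {p : Params d}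

/-- The existence of an eigenvalue rules out dimension zero, so vectors of every length are
available for testing the assumptions. -/
lemma exists_norm_eq (hU : PotentialAssumption U p) {t : ℝ} (ht : 0 ≤ t) :
    ∃ x : Pos d, ‖x‖ = t := by
  obtain ⟨x, hx⟩ := hU.κ_smallest_eigenvalue.1.exists_hasEigenvector
  have : Nontrivial (Pos d) := ⟨x, 0, hx.2⟩
  exact _root_.exists_norm_eq (Pos d) ht

lemma LG_nonneg (hU : PotentialAssumption U p) : 0 ≤ p.LG := by
  obtain ⟨x, hx⟩ := hU.exists_norm_eq zero_le_one
  have := hU.lipschitz_G x 0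
  rw [sub_zero, hx, mul_one] at this
  exact (norm_nonneg _).trans this

/-- At distance R + 1 both the convexity bound and the Lipschitz bound apply, which forces κ ≤ L. -/
lemma L_pos (hU : PotentialAssumption U p) : 0 < p.L := by
  have hR := hU.R_nonneg
  obtain ⟨x, hx⟩ := hU.exists_norm_eq (by linarith : 0 ≤ p.R + 1)
  have h1 := hU.strongly_convex_outside x 0 (by rw [sub_zero, hx]; linarith)
  have h2 := hU.lipschitz_gradient x 0
  have h3 := real_inner_le_norm (gradient U x - gradient U 0) (x - 0)
  rw [sub_zero, hx] at h1 h2 h3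
  have h4 : p.κ * (p.R + 1) ^ 2 ≤ p.L * (p.R + 1) * (p.R + 1) :=
    (h1.trans h3).trans (mul_le_mul_of_nonneg_right h2 (by linarith))
  have h5 : p.κ * (p.R + 1) ^ 2 ≤ p.L * (p.R + 1) ^ 2 := by linarith
  exact hU.κ_pos.trans_le (le_of_mul_le_mul_right h5 (by positivity))

lemma le_inner_K (hU : PotentialAssumption U p) (x : Pos d) :
    p.κ * ‖x‖ ^ 2 ≤ inner ℝ x (p.K x) :=
  smallest_eigenvalue_le hU.K_symmetric hU.κ_smallest_eigenvalue x

lemma inner_K_le (hU : PotentialAssumption U p) (x : Pos d) :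
    inner ℝ x (p.K x) ≤ p.LK * ‖x‖ ^ 2 := by
  have h := hU.lipschitz_K x 0
  rw [map_zero, sub_zero, sub_zero] at h
  have h2 := real_inner_le_norm x (p.K x)
  nlinarith [mul_le_mul_of_nonneg_left h (norm_nonneg x)]

lemma LK_pos (hU : PotentialAssumption U p) : 0 < p.LK := by
  obtain ⟨x, hx⟩ := hU.exists_norm_eq zero_le_one
  have h := (hU.le_inner_K x).trans (hU.inner_K_le x)
  rw [hx] at h
  have := hU.κ_pos
  linarith

lemma Ks_symm (hU : PotentialAssumption U p) (x y : Pos d) :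
    inner ℝ (p.Ks x) y = inner ℝ x (p.Ks y) := by
  simp [Params.Ks, inner_smul_left, inner_smul_right, hU.K_symmetric]

lemma le_inner_Ks (hU : PotentialAssumption U p) (x : Pos d) :
    p.kap * ‖x‖ ^ 2 ≤ inner ℝ x (p.Ks x) := by
  rw [Params.kap, Params.Ks, smul_apply, inner_smul_right, div_eq_inv_mul,
    mul_assoc]
  exact mul_le_mul_of_nonneg_left (hU.le_inner_K x) (by positivity)

lemma inner_Ks_le (hU : PotentialAssumption U p) (x : Pos d) :
    inner ℝ x (p.Ks x) ≤ p.lam * ‖x‖ ^ 2 := by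
  rw [Params.lam, Params.Ks, smul_apply, inner_smul_right, div_eq_inv_mul,
    mul_assoc]
  exact mul_le_mul_of_nonneg_left (hU.inner_K_le x) (by positivity)

lemma kap_pos (hU : PotentialAssumption U p) (hγ : 0 < p.γ) : 0 < p.kap :=
  div_pos hU.κ_pos (by positivity)

lemma kap_nonneg (hU : PotentialAssumption U p) : 0 ≤ p.kap :=
  div_nonneg hU.κ_pos.le (by positivity)

lemma lam_nonneg (hU : PotentialAssumption U p) : 0 ≤ p.lam :=
  div_nonneg hU.LK_pos.le (by positivity)

lemma inner_Ks_nonneg (hU : PotentialAssumption U p) (x : Pos d) :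
    0 ≤ inner ℝ x (p.Ks x) :=
  (mul_nonneg hU.kap_nonneg (sq_nonneg _)).trans (hU.le_inner_Ks x)

lemma norm_Ks_sq_le (hU : PotentialAssumption U p) (x : Pos d) :
    ‖p.Ks x‖ ^ 2 ≤ p.lam * inner ℝ x (p.Ks x) :=
  norm_sq_apply_le hU.Ks_symm hU.inner_Ks_nonneg hU.inner_Ks_le x

lemma τ_pos (hU : PotentialAssumption U p) (hγ : 0 < p.γ) : 0 < p.τ :=
  lt_min (by norm_num) (div_pos (hU.kap_pos hγ) (by norm_num))

lemma four_τ_le (p : Params d) : 4 * p.τ ≤ p.kap := by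
  have : p.τ ≤ p.κ / p.γ ^ 2 / 4 := min_le_right _ _
  rw [Params.kap]
  linarith

lemma α_pos (hU : PotentialAssumption U p) (hγ : 0 < p.γ) : 0 < p.α := by
  have := hU.L_pos
  rw [Params.α]
  positivity

lemma ε_pos (hU : PotentialAssumption U p) (hγ : 0 < p.γ) : 0 < p.ε := by
  have h1 := hU.α_pos hγ
  have h2 := Real.sqrt_pos.2 hU.LK_pos
  rw [Params.ε]
  have : 0 < 2 * p.α / (3 * (√p.LK * p.γ⁻¹)) := by positivity
  have := lt_min zero_lt_one (lt_min this h1)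
  linarith

/-- This is the purpose of the middle entry in the definition of ε: it controls the part of r_l that
comes from K. -/
lemma ε_mul_sqrt_lam_le (hU : PotentialAssumption U p) (hγ : 0 < p.γ) :
    p.ε * √p.lam ≤ p.α / 3 := by
  have h2 := Real.sqrt_pos.2 hU.LK_pos
  have h3 : √p.lam = √p.LK * p.γ⁻¹ := by
    rw [Params.lam, Real.sqrt_div hU.LK_pos.le, Real.sqrt_sq hγ.le, div_eq_mul_inv]
  have h4 : p.ε ≤ 1 / 2 * (2 * p.α / (3 * (√p.LK * p.γ⁻¹))) := by
    rw [Params.ε]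
    exact mul_le_mul_of_nonneg_left ((min_le_right _ _).trans (min_le_left _ _)) (by norm_num)
  rw [h3]
  have h5 : 0 < √p.LK * p.γ⁻¹ := by positivity
  calc p.ε * (√p.LK * p.γ⁻¹)
      ≤ 1 / 2 * (2 * p.α / (3 * (√p.LK * p.γ⁻¹))) * (√p.LK * p.γ⁻¹) :=
        mul_le_mul_of_nonneg_right h4 h5.le
    _ = p.α / 3 := by field_simp

/-- Each entry of ε handles one term of `sqrt_twistedForm_le`. The |z| terms add up to α/3 +
(3/4)(α/2) = 17α/24 ≤ 3α/4, the |q| term to 1/2. Hence Δ is comparable to r_s. -/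
lemma ε_rl_le (hU : PotentialAssumption U p) (hγ : 0 < p.γ) (a b : Phase d) :
    p.ε * p.rl a b ≤ 3 / 4 * p.rs a b := by
  have h1 := sqrt_twistedForm_le hU.inner_Ks_le hU.lam_nonneg (hU.τ_pos hγ).le (min_le_left _ _)
    (a.1 - b.1) (p.γ⁻¹ • (a.2 - b.2))
  have h2 := hU.ε_mul_sqrt_lam_le hγ
  have h0 := (hU.ε_pos hγ).le
  have h3 := p.ε_le_half
  have h4 := p.ε_le_half_α
  have h5 := hU.α_pos hγ
  rw [Params.rl_eq, Params.rs, Params.q]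
  set Z := ‖a.1 - b.1‖
  set Q := ‖a.1 - b.1 + p.γ⁻¹ • (a.2 - b.2)‖
  have hZ : 0 ≤ Z := norm_nonneg _
  have hQ : 0 ≤ Q := norm_nonneg _
  refine (mul_le_mul_of_nonneg_left h1 h0).trans ?_
  have h6 : p.ε * √p.lam * Z ≤ p.α / 3 * Z := mul_le_mul_of_nonneg_right h2 hZ
  have h7 : p.ε * Z ≤ 1 / 2 * p.α * Z := mul_le_mul_of_nonneg_right h4 hZ
  have h8 : p.ε * Q ≤ 1 / 2 * Q := mul_le_mul_of_nonneg_right h3 hQ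
  have h9 : 0 ≤ p.α * Z := by positivity
  linarith

lemma rs_nonneg (hU : PotentialAssumption U p) (hγ : 0 < p.γ) (a b : Phase d) :
    0 ≤ p.rs a b := by
  have := hU.α_pos hγ
  rw [Params.rs]
  positivity

lemma rs_le_Δ (hU : PotentialAssumption U p) (hγ : 0 < p.γ) (a b : Phase d) :
    1 / 4 * p.rs a b ≤ p.Δ a b := by
  have := hU.ε_rl_le hγ a b
  rw [Params.Δ]
  linarith

/-- The two entries of `calE` are the ratios of the coefficients of |z| and of |q| in
`le_sqrt_twistedForm` to those in r_s. -/
lemma calE_rs_le_rl (hU : PotentialAssumption U p) (hγ : 0 < p.γ) (a b : Phase d) :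
    p.calE * p.rs a b ≤ p.rl a b := by
  have h1 := le_sqrt_twistedForm hU.le_inner_Ks (hU.τ_pos hγ).le (four_τ_le p)
    (a.1 - b.1) (p.γ⁻¹ • (a.2 - b.2))
  have hα := hU.α_pos hγ
  have h3 : √p.kap = √p.κ * p.γ⁻¹ := by
    rw [Params.kap, Real.sqrt_div hU.κ_pos.le, Real.sqrt_sq hγ.le, div_eq_mul_inv]
  rw [Params.rl_eq]
  refine le_trans ?_ h1
  rw [Params.rs, Params.q, mul_add, h3]
  have h4 : p.calE ≤ √p.κ * p.γ⁻¹ / (√8 * p.α) := min_le_left _ _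
  have h5 : p.calE ≤ 1 / 2 := min_le_right _ _
  have h6 : p.calE * p.α ≤ √p.κ * p.γ⁻¹ / √8 := by
    calc p.calE * p.α ≤ √p.κ * p.γ⁻¹ / (√8 * p.α) * p.α := mul_le_mul_of_nonneg_right h4 hα.le
      _ = √p.κ * p.γ⁻¹ / √8 := by field_simp
  rw [← mul_assoc]
  exact add_le_add (mul_le_mul_of_nonneg_right h6 (norm_nonneg _))
    (mul_le_mul_of_nonneg_right h5 (norm_nonneg _))

/-! ### The constants `D_K` and `R₁` -/

/-- Bounds r_s, hence Δ, on the compact set, so that the supremum defining D_K is a genuine one. -/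
lemma norm_le_of_mem_compactSet (hU : PotentialAssumption U p) (hγ : 0 < p.γ) {a b : Phase d}
    (h : (a.1 - b.1, a.2 - b.2) ∈ p.compactSet) :
    p.rs a b ≤ p.α * √(p.calR / p.kap) + √(2 * p.calR) := by
  have hk := hU.kap_pos hγ
  have hα := hU.α_pos hγ
  simp only [Params.compactSet, mem_ofPred_eq] at h
  rw [Params.rs, Params.q]
  have h1 : ‖a.1 - b.1‖ ≤ √(p.calR / p.kap) := by
    apply Real.le_sqrt_of_sq_le
    rw [le_div_iff₀ hk, Params.kap]
    nlinarith [sq_nonneg ‖a.1 - b.1 + p.γ⁻¹ • (a.2 - b.2)‖, sq_nonneg ‖p.γ⁻¹ • (a.2 - b.2)‖]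
  have h2 : ‖a.1 - b.1 + p.γ⁻¹ • (a.2 - b.2)‖ ≤ √(2 * p.calR) := by
    apply Real.le_sqrt_of_sq_le
    have : 0 ≤ p.κ / p.γ ^ 2 * ‖a.1 - b.1‖ ^ 2 := mul_nonneg hk.le (sq_nonneg _)
    nlinarith [sq_nonneg ‖p.γ⁻¹ • (a.2 - b.2)‖]
  gcongr

lemma Δ_le_rs (hU : PotentialAssumption U p) (hγ : 0 < p.γ) (a b : Phase d) :
    p.Δ a b ≤ p.rs a b := by
  rw [Params.Δ]
  have := mul_nonneg (hU.ε_pos hγ).le (p.rl_nonneg a b)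
  linarith

lemma Δ_le_DK (hU : PotentialAssumption U p) (hγ : 0 < p.γ) {a b : Phase d}
    (h : (a.1 - b.1, a.2 - b.2) ∈ p.compactSet) : p.Δ a b ≤ p.DK := by
  refine le_csSup ?_ (show p.Δ a b ∈ {t | ∃ a b : Phase d, _ ∧ t = p.Δ a b} from ⟨a, b, h, rfl⟩)
  refine ⟨p.α * √(p.calR / p.kap) + √(2 * p.calR), ?_⟩
  rintro t ⟨a, b, hab, rfl⟩
  exact (hU.Δ_le_rs hγ a b).trans (hU.norm_le_of_mem_compactSet hγ hab)

lemma calR_nonneg (hU : PotentialAssumption U p) (hγ : 0 < p.γ) : 0 ≤ p.calR := by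
  have := hU.LG_nonneg
  have := hU.τ_pos hγ
  rw [Params.calR]
  positivity

lemma DK_nonneg (hU : PotentialAssumption U p) (hγ : 0 < p.γ) : 0 ≤ p.DK := by
  have h : (((0 : Phase d).1 - (0 : Phase d).1, (0 : Phase d).2 - (0 : Phase d).2) : Phase d)
      ∈ p.compactSet := by
    simp [Params.compactSet, hU.calR_nonneg hγ]
  refine le_trans ?_ (hU.Δ_le_DK hγ h)
  have := hU.rs_le_Δ hγ 0 0
  have := hU.rs_nonneg hγ 0 0
  linarith

lemma rs_le_R₁ (hU : PotentialAssumption U p) (hγ : 0 < p.γ) {a b : Phase d}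
    (h : p.Δ a b ≤ p.DK) : p.rs a b ≤ p.R₁ := by
  refine le_csSup ?_ (show p.rs a b ∈ {t | ∃ a b : Phase d, _ ∧ t = p.rs a b} from ⟨a, b, h, rfl⟩)
  -- The set defining R₁ is bounded because r_s ≤ 4Δ.
  refine ⟨4 * p.DK, ?_⟩
  rintro t ⟨a, b, hab, rfl⟩
  have := hU.rs_le_Δ hγ a b
  linarith

lemma R₁_nonneg (hU : PotentialAssumption U p) (hγ : 0 < p.γ) : 0 ≤ p.R₁ := by
  have h : p.Δ 0 0 ≤ p.DK := by
    refine le_trans ?_ (hU.DK_nonneg hγ)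
    simp [Params.Δ, Params.rs, Params.rl, Params.q]
  exact (hU.rs_nonneg hγ 0 0).trans (hU.rs_le_R₁ hγ h)

/-- By homogeneity the pair can be scaled until Δ = D_K, where r_s ≤ R₁; scaling back gives the
inequality. It later shows that D_K + ε r_l ≤ R₁ whenever r_s ≤ R₁. -/
lemma DK_mul_rs_le (hU : PotentialAssumption U p) (hγ : 0 < p.γ) (a b : Phase d) :
    p.DK * p.rs a b ≤ p.R₁ * p.Δ a b := by
  have hrs := hU.rs_nonneg hγ a b
  have hΔ := hU.rs_le_Δ hγ a b
  have hD := hU.DK_nonneg hγ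
  rcases hrs.eq_or_lt with h0 | h0
  · rw [← h0, mul_zero]
    exact mul_nonneg (hU.R₁_nonneg hγ) (by linarith)
  have hΔ0 : 0 < p.Δ a b := by linarith
  set t := p.DK / p.Δ a b
  have ht : 0 ≤ t := by positivity
  have h1 : p.Δ (t • (a - b)) 0 = p.DK := by
    rw [p.Δ_smul ht]
    exact div_mul_cancel₀ _ hΔ0.ne'
  have h2 := hU.rs_le_R₁ hγ h1.le
  rw [p.rs_smul ht] at h2
  calc p.DK * p.rs a b = t * p.rs a b * p.Δ a b := by
        rw [mul_right_comm, div_mul_cancel₀ _ hΔ0.ne']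
    _ ≤ p.R₁ * p.Δ a b := mul_le_mul_of_nonneg_right h2 hΔ0.le

/-- Where `Δ ≥ D_K`, the quadratic form defining the compact set is at least `calR`. -/
lemma calR_le_of_DK_le (hU : PotentialAssumption U p) (hγ : 0 < p.γ) {a b : Phase d}
    (h : p.DK ≤ p.Δ a b) :
    p.calR ≤ p.kap * ‖a.1 - b.1‖ ^ 2 + (1 / 2) * ‖(a.1 - b.1) + p.γ⁻¹ • (a.2 - b.2)‖ ^ 2
      + (1 / 2) * ‖p.γ⁻¹ • (a.2 - b.2)‖ ^ 2 := by
  by_contra! hlt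
  have hk := hU.kap_pos hγ
  set P := p.kap * ‖a.1 - b.1‖ ^ 2 + (1 / 2) * ‖(a.1 - b.1) + p.γ⁻¹ • (a.2 - b.2)‖ ^ 2
      + (1 / 2) * ‖p.γ⁻¹ • (a.2 - b.2)‖ ^ 2 with hP
  have hP0 : 0 ≤ P := by positivity
  have hR : 0 < p.calR := hP0.trans_lt hlt
  have hscale : ∀ (t : ℝ) (a b : Phase d), 0 ≤ t →
      t ^ 2 * (p.kap * ‖a.1 - b.1‖ ^ 2 + (1 / 2) * ‖(a.1 - b.1) + p.γ⁻¹ • (a.2 - b.2)‖ ^ 2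
        + (1 / 2) * ‖p.γ⁻¹ • (a.2 - b.2)‖ ^ 2) ≤ p.calR → t * p.Δ a b ≤ p.DK := by
    intro t a b ht hle
    rw [← p.Δ_smul ht]
    apply hU.Δ_le_DK hγ
    simp only [Params.compactSet, mem_ofPred_eq, Prod.smul_fst, Prod.smul_snd, Prod.fst_sub,
      Prod.snd_sub, Prod.fst_zero, Prod.snd_zero, sub_zero]
    rw [smul_comm p.γ⁻¹ t, ← smul_add, norm_smul, norm_smul, norm_smul, mul_pow, mul_pow, mul_pow,
      Real.norm_eq_abs, sq_abs]
    rw [Params.kap] at hle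
    linarith
  -- A nonzero displacement placed on the boundary of the compact set has positive Δ.
  have hD : 0 < p.DK := by
    obtain ⟨x, hx⟩ := hU.exists_norm_eq zero_le_one
    set S := p.kap + 1 / 2
    have hS : 0 < S := by positivity
    have hSR : 0 < p.calR / S := by positivity
    have h1 := hscale (√(p.calR / S)) (x, 0) 0 (Real.sqrt_nonneg _) (by
      simp only [Prod.fst_zero, Prod.snd_zero, sub_zero, smul_zero, add_zero, hx, norm_zero]
      rw [Real.sq_sqrt hSR.le]
      apply le_of_eq
      have : p.kap * 1 ^ 2 + 1 / 2 * 1 ^ 2 + 1 / 2 * 0 ^ 2 = S := by ring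
      rw [this, div_mul_cancel₀ _ hS.ne'])
    refine lt_of_lt_of_le ?_ h1
    have h2 := hU.rs_le_Δ hγ ((x, 0) : Phase d) 0
    have hα := hU.α_pos hγ
    have h3 : p.α ≤ p.rs ((x, 0) : Phase d) 0 := by
      simp [Params.rs, hx]
    exact mul_pos (Real.sqrt_pos.2 hSR) (by linarith)
  -- A point strictly inside can be stretched by a factor larger than 1 without leaving the set.
  -- This stretches Δ beyond D_K, a contradiction. The factor √(1 + (calR - P)/calR) is used because
  -- P may vanish, which excludes √(calR/P).
  have hx : 0 < (p.calR - P) / p.calR := div_pos (by linarith) hR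
  have h1 := hscale (√(1 + (p.calR - P) / p.calR)) a b (Real.sqrt_nonneg _) (by
    rw [Real.sq_sqrt (by linarith), ← hP]
    have : (p.calR - P) / p.calR * P ≤ (p.calR - P) / p.calR * p.calR :=
      mul_le_mul_of_nonneg_left hlt.le hx.le
    rw [div_mul_cancel₀ _ hR.ne'] at this
    linarith)
  have h2 : 1 < √(1 + (p.calR - P) / p.calR) := by
    apply Real.lt_sqrt_of_sq_lt
    linarith
  nlinarith

end PotentialAssumption

end KineticLangevin

/-! ### The concave function f: monotonicity, tangents, and quantitative decay of f'. -/

namespace KineticLangevin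

namespace Params

variable {d : ℕ} (p : Params d)

/-- The derivative `φ ψ` of `f`. -/
noncomputable def fd (s : ℝ) : ℝ := p.φ s * p.ψ s

lemma φ_pos (s : ℝ) : 0 < p.φ s := Real.exp_pos _

lemma continuous_φ : Continuous p.φ := by
  unfold φ
  fun_prop

lemma continuous_Φ : Continuous p.Φ :=
  intervalIntegral.continuous_primitive (fun _ _ => p.continuous_φ.intervalIntegrable _ _) 0

lemma continuous_Φ_div_φ : Continuous (fun s => p.Φ s * (p.φ s)⁻¹) :=
  p.continuous_Φ.mul (p.continuous_φ.inv₀ fun s => (p.φ_pos s).ne')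

lemma continuous_ψ : Continuous p.ψ := by
  have h : Continuous fun s : ℝ => ∫ x in (0 : ℝ)..s, p.Φ x * (p.φ x)⁻¹ :=
    intervalIntegral.continuous_primitive
      (fun _ _ => p.continuous_Φ_div_φ.intervalIntegrable _ _) 0
  have h2 : Continuous fun s : ℝ => min s p.R₁ := by fun_prop
  exact continuous_const.sub (continuous_const.mul (h.comp h2))

lemma continuous_fd : Continuous p.fd := p.continuous_φ.mul p.continuous_ψ

lemma hasDerivAt_f (r : ℝ) : HasDerivAt p.f (p.fd r) r :=
  intervalIntegral.integral_hasDerivAt_right (p.continuous_fd.intervalIntegrable _ _)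
    (p.continuous_fd.stronglyMeasurableAtFilter _ _) p.continuous_fd.continuousAt

lemma deriv_f (r : ℝ) : deriv p.f r = p.fd r := (p.hasDerivAt_f r).deriv

lemma continuous_f : Continuous p.f :=
  continuous_iff_continuousAt.2 fun r => (p.hasDerivAt_f r).continuousAt

lemma f_zero : p.f 0 = 0 := by simp [f]

lemma f_sub_f (x y : ℝ) : p.f y - p.f x = ∫ s in x..y, p.fd s := by
  exact intervalIntegral.integral_interval_sub_left (p.continuous_fd.intervalIntegrable _ _)
    (p.continuous_fd.intervalIntegrable _ _)

lemma Φ_nonneg {s : ℝ} (hs : 0 ≤ s) : 0 ≤ p.Φ s :=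
  intervalIntegral.integral_nonneg hs fun x _ => (p.φ_pos x).le

lemma integral_Φ_div_φ_mono {x y : ℝ} (hx : 0 ≤ x) (hxy : x ≤ y) :
    ∫ s in (0 : ℝ)..x, p.Φ s * (p.φ s)⁻¹ ≤ ∫ s in (0 : ℝ)..y, p.Φ s * (p.φ s)⁻¹ := by
  have h := intervalIntegral.integral_add_adjacent_intervals
    (p.continuous_Φ_div_φ.intervalIntegrable (μ := volume) 0 x)
    (p.continuous_Φ_div_φ.intervalIntegrable (μ := volume) x y)
  have h2 : 0 ≤ ∫ s in x..y, p.Φ s * (p.φ s)⁻¹ :=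
    intervalIntegral.integral_nonneg hxy fun s hs =>
      mul_nonneg (p.Φ_nonneg (hx.trans hs.1)) (inv_nonneg.2 (p.φ_pos s).le)
  linarith

end Params

namespace PotentialAssumption

variable {d : ℕ} {U : Pos d → ℝ} {p : Params d}

lemma cHat_nonneg (hU : PotentialAssumption U p) (hγ : 0 < p.γ) : 0 ≤ p.cHat := by
  have h := p.integral_Φ_div_φ_mono le_rfl (hU.R₁_nonneg hγ)
  rw [intervalIntegral.integral_same] at h
  rw [Params.cHat]
  positivity

lemma ψ_antitone (hU : PotentialAssumption U p) (hγ : 0 < p.γ) {x y : ℝ} (hx : 0 ≤ x)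
    (hxy : x ≤ y) : p.ψ y ≤ p.ψ x := by
  have hc := hU.cHat_nonneg hγ
  have h := p.integral_Φ_div_φ_mono (le_min hx (hU.R₁_nonneg hγ)) (min_le_min_right p.R₁ hxy)
  rw [Params.ψ, Params.ψ]
  have := mul_le_mul_of_nonneg_left h (by positivity : 0 ≤ p.cHat / 2 * p.γ)
  linarith

lemma ψ_zero (hU : PotentialAssumption U p) (hγ : 0 < p.γ) : p.ψ 0 = 1 := by
  simp [Params.ψ, min_eq_left (hU.R₁_nonneg hγ)]

/-- The normalisation ĉ is chosen so that ψ loses at most 1/2 up to R₁. The bound used, t⁻¹t ≤ 1,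
also covers a vanishing integral. -/
lemma half_le_ψ (hU : PotentialAssumption U p) (hγ : 0 < p.γ) {x : ℝ} (hx : 0 ≤ x) :
    1 / 2 ≤ p.ψ x := by
  have hc := hU.cHat_nonneg hγ
  have h := p.integral_Φ_div_φ_mono (le_min hx (hU.R₁_nonneg hγ)) (min_le_right x p.R₁)
  have h2 := mul_le_mul_of_nonneg_left h (by positivity : 0 ≤ p.cHat / 2 * p.γ)
  have h3 : p.cHat * (p.γ * ∫ s in (0 : ℝ)..p.R₁, p.Φ s * (p.φ s)⁻¹) ≤ 1 := by
    rw [Params.cHat]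
    rw [one_div]
    exact inv_mul_le_one
  rw [Params.ψ]
  linarith

lemma fd_pos (hU : PotentialAssumption U p) (hγ : 0 < p.γ) {x : ℝ} (hx : 0 ≤ x) :
    0 < p.fd x :=
  mul_pos (p.φ_pos x) (by linarith [hU.half_le_ψ hγ hx])

/-- The source of all curvature gains: the Gaussian factor φ alone makes f' drop exponentially, and
ψ contributes only monotonicity. Beyond R₁ the exponent stops growing. -/
lemma fd_le_mul_exp (hU : PotentialAssumption U p) (hγ : 0 < p.γ) {x y : ℝ} (hx : 0 ≤ x)
    (hxy : x ≤ y) :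
    p.fd y ≤ p.fd x * Real.exp (-(64 * p.α * p.γ ^ 2 * (min y p.R₁ ^ 2 - min x p.R₁ ^ 2))) := by
  have h1 := hU.ψ_antitone hγ hx hxy
  have h2 : p.φ y = p.φ x *
      Real.exp (-(64 * p.α * p.γ ^ 2 * (min y p.R₁ ^ 2 - min x p.R₁ ^ 2))) := by
    rw [Params.φ, Params.φ, ← Real.exp_add]
    ring_nf
  calc p.fd y = p.φ y * p.ψ y := rfl
    _ ≤ p.φ y * p.ψ x := mul_le_mul_of_nonneg_left h1 (p.φ_pos y).le
    _ = _ := by rw [h2, Params.fd]; ring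

lemma fd_antitone (hU : PotentialAssumption U p) (hγ : 0 < p.γ) {x y : ℝ} (hx : 0 ≤ x)
    (hxy : x ≤ y) : p.fd y ≤ p.fd x := by
  refine (hU.fd_le_mul_exp hγ hx hxy).trans ?_
  have hα := hU.α_pos hγ
  have h1 : min x p.R₁ ^ 2 ≤ min y p.R₁ ^ 2 :=
    pow_le_pow_left₀ (le_min hx (hU.R₁_nonneg hγ)) (min_le_min_right _ hxy) 2
  apply mul_le_of_le_one_right (hU.fd_pos hγ hx).le
  rw [Real.exp_le_one_iff]
  have : 0 ≤ 64 * p.α * p.γ ^ 2 * (min y p.R₁ ^ 2 - min x p.R₁ ^ 2) :=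
    mul_nonneg (by positivity) (by linarith)
  linarith

lemma fd_le_one (hU : PotentialAssumption U p) (hγ : 0 < p.γ) {x : ℝ} (hx : 0 ≤ x) :
    p.fd x ≤ 1 := by
  refine (hU.fd_antitone hγ le_rfl hx).trans ?_
  rw [Params.fd, hU.ψ_zero hγ, mul_one, Params.φ, min_eq_left (hU.R₁_nonneg hγ)]
  simp

/-- f' decreases up to R₁ and is constant afterwards, so f'(R₁) is its minimum on the half-line. -/
lemma fd_R₁_le (hU : PotentialAssumption U p) (hγ : 0 < p.γ) {x : ℝ} (hx : 0 ≤ x) :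
    p.fd p.R₁ ≤ p.fd x := by
  rcases le_total x p.R₁ with h | h
  · exact hU.fd_antitone hγ hx h
  · rw [Params.fd, Params.fd, Params.φ, Params.φ, Params.ψ, Params.ψ, min_eq_right h, min_self]

/-- `f` lies below its tangents. -/
lemma f_le_tangent (hU : PotentialAssumption U p) (hγ : 0 < p.γ) {x y : ℝ} (hx : 0 ≤ x)
    (hy : 0 ≤ y) : p.f y ≤ p.f x + p.fd x * (y - x) := by
  rcases le_total x y with h | h
  · have h1 : ∫ s in x..y, p.fd s ≤ ∫ _s in x..y, p.fd x :=
      intervalIntegral.integral_mono_on h (p.continuous_fd.intervalIntegrable _ _)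
        intervalIntegrable_const fun s hs => hU.fd_antitone hγ hx hs.1
    rw [intervalIntegral.integral_const, smul_eq_mul, ← p.f_sub_f] at h1
    linarith
  · have h1 : ∫ _s in y..x, p.fd x ≤ ∫ s in y..x, p.fd s :=
      intervalIntegral.integral_mono_on h intervalIntegrable_const
        (p.continuous_fd.intervalIntegrable _ _)
        fun s hs => hU.fd_antitone hγ (hy.trans hs.1) hs.2
    rw [intervalIntegral.integral_const, smul_eq_mul, ← p.f_sub_f] at h1
    linarith

lemma f_mono (hU : PotentialAssumption U p) (hγ : 0 < p.γ) {x y : ℝ} (hx : 0 ≤ x)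
    (hxy : x ≤ y) : p.f x ≤ p.f y := by
  have h1 := hU.f_le_tangent hγ (hx.trans hxy) hx
  have h2 := mul_nonneg (hU.fd_pos hγ (hx.trans hxy)).le (sub_nonneg.2 hxy)
  linarith

lemma f_nonneg (hU : PotentialAssumption U p) (hγ : 0 < p.γ) {x : ℝ} (hx : 0 ≤ x) :
    0 ≤ p.f x := by
  rw [← p.f_zero]
  exact hU.f_mono hγ le_rfl hx

lemma f_le_self (hU : PotentialAssumption U p) (hγ : 0 < p.γ) {x : ℝ} (hx : 0 ≤ x) :
    p.f x ≤ x := by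
  have h1 := hU.f_le_tangent hγ le_rfl hx
  rw [p.f_zero, sub_zero, zero_add] at h1
  exact h1.trans (mul_le_of_le_one_left hx (hU.fd_le_one hγ le_rfl))

/-- The tangent at x, evaluated at 0 where f vanishes, gives x f'(x) ≤ f(x); the tangent at x
evaluated at Cx then gives the claim. -/
lemma f_mul_le (hU : PotentialAssumption U p) (hγ : 0 < p.γ) {C x : ℝ} (hC : 1 ≤ C)
    (hx : 0 ≤ x) : p.f (C * x) ≤ C * p.f x := by
  have h1 := hU.f_le_tangent hγ hx (by positivity : 0 ≤ C * x)
  have h2 := hU.f_le_tangent hγ hx le_rfl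
  rw [p.f_zero] at h2
  nlinarith

/-! ### The distance `ρ` in terms of `min r_s (D_K + ε r_l)` -/

lemma ρ_eq (p : Params d) (a b : Phase d) : p.ρ a b = p.f (min (p.rs a b) (p.DK + p.ε * p.rl a b)) := by
  rw [Params.ρ, Params.Δ, ← min_add_add_right, sub_add_cancel]

lemma min_nonneg' (hU : PotentialAssumption U p) (hγ : 0 < p.γ) (a b : Phase d) :
    0 ≤ min (p.rs a b) (p.DK + p.ε * p.rl a b) :=
  le_min (hU.rs_nonneg hγ a b)
    (add_nonneg (hU.DK_nonneg hγ) (mul_nonneg (hU.ε_pos hγ).le (p.rl_nonneg a b)))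

lemma ρ_nonneg (hU : PotentialAssumption U p) (hγ : 0 < p.γ) (a b : Phase d) :
    0 ≤ p.ρ a b := by
  rw [ρ_eq]
  exact hU.f_nonneg hγ (hU.min_nonneg' hγ a b)

/-- If `r_s` and `r_l` grow at most by the factor `C`, so does `ρ`. -/
lemma ρ_le_mul (hU : PotentialAssumption U p) (hγ : 0 < p.γ) {C : ℝ} (hC : 1 ≤ C)
    {a b a' b' : Phase d} (hs : p.rs a' b' ≤ C * p.rs a b) (hl : p.rl a' b' ≤ C * p.rl a b) :
    p.ρ a' b' ≤ C * p.ρ a b := by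
  rw [ρ_eq, ρ_eq]
  refine le_trans (hU.f_mono hγ (hU.min_nonneg' hγ a' b') ?_)
    (hU.f_mul_le hγ hC (hU.min_nonneg' hγ a b))
  rw [mul_min_of_nonneg _ _ (by linarith)]
  refine min_le_min hs ?_
  have h1 := mul_le_mul_of_nonneg_left hl (hU.ε_pos hγ).le
  have h2 := mul_le_mul_of_nonneg_right hC (hU.DK_nonneg hγ)
  linarith

end PotentialAssumption

end KineticLangevin

namespace KineticLangevin

/-! ### The one-dimensional coupling preserves the normal law -/

lemma lintegral_unif_ite {r : ℝ} (hr : 0 ≤ r) (A B : ENNReal) :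
    ∫⁻ u, (if u ≤ r then A else B) ∂unif =
      A * ENNReal.ofReal (min 1 r) + B * ENNReal.ofReal (1 - min 1 r) := by
  have h : (fun u : ℝ => if u ≤ r then A else B) =
      (fun u => (Iic r).indicator (fun _ => A) u + (Ioi r).indicator (fun _ => B) u) := by
    ext u
    by_cases hu : u ≤ r
    · simp [hu]
    · simp [hu, not_le.1 hu]
  rw [h, lintegral_add_left (measurable_const.indicator measurableSet_Iic),
    lintegral_indicator_const measurableSet_Iic, lintegral_indicator_const measurableSet_Ioi,
    unif, Measure.restrict_apply measurableSet_Iic, Measure.restrict_apply measurableSet_Ioi]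
  have h1 : Iic r ∩ Icc (0 : ℝ) 1 = Icc 0 (min 1 r) := by
    ext u; simp only [mem_inter_iff, mem_Iic, mem_Icc, le_min_iff]; tauto
  have h2 : volume (Ioi r ∩ Icc (0 : ℝ) 1) = ENNReal.ofReal (1 - min 1 r) := by
    rcases le_total r 1 with h | h
    · rw [min_eq_right h]
      have : Ioi r ∩ Icc (0 : ℝ) 1 = Ioc r 1 := by
        ext u; simp only [mem_inter_iff, mem_Ioi, mem_Icc, mem_Ioc]
        exact ⟨fun h => ⟨h.1, h.2.2⟩, fun h => ⟨h.1, hr.trans h.1.le, h.2⟩⟩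
      rw [this, Real.volume_Ioc]
    · rw [min_eq_left h]
      have : Ioi r ∩ Icc (0 : ℝ) 1 = ∅ := by
        ext u; simp only [mem_inter_iff, mem_Ioi, mem_Icc, mem_empty_iff_false, iff_false]
        rintro ⟨h1, h2⟩; linarith [h2.2]
      simp [this]
  rw [h1, h2, Real.volume_Icc, sub_zero]

/-- The one-dimensional maximal/reflection coupling of `N(0,1)` and `N(b,1)`. -/
noncomputable def reflCoupling (b x u : ℝ) : ℝ :=
  if u ≤ gaussianPDFReal 0 1 (x + b) / gaussianPDFReal 0 1 x then x + b else -x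

lemma measurable_reflCoupling (b : ℝ) :
    Measurable fun y : ℝ × ℝ => reflCoupling b y.1 y.2 := by
  unfold reflCoupling
  refine Measurable.ite ?_ (by fun_prop) (by fun_prop)
  apply measurableSet_le measurable_snd
  have := measurable_gaussianPDFReal 0 1
  fun_prop

lemma gaussianPDFReal_neg (x : ℝ) : gaussianPDFReal 0 1 (-x) = gaussianPDFReal 0 1 x := by
  simp [gaussianPDFReal]

/-- With P the normal density, the accepted mass min(P(x), P(x+b)) is shifted by b and arrives with
density min(P(x-b), P(x)). The rejected mass is reflected and, P being even, arrives with density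
P(x) - min(P(x-b), P(x)). The two add up to P. -/
lemma lintegral_reflCoupling (b : ℝ) {g : ℝ → ENNReal} (hg : Measurable g) :
    ∫⁻ x, ∫⁻ u, g (reflCoupling b x u) ∂unif ∂(gaussianReal 0 1) = ∫⁻ x, g x ∂(gaussianReal 0 1) := by
  set P := gaussianPDFReal 0 1 with hP
  have hPm : Measurable P := measurable_gaussianPDFReal 0 1
  have hP0 : ∀ x, 0 < P x := fun x => gaussianPDFReal_pos 0 1 x one_ne_zero
  have hin : ∀ x, ∫⁻ u, g (reflCoupling b x u) ∂unif =
      g (x + b) * ENNReal.ofReal (min 1 (P (x + b) / P x))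
        + g (-x) * ENNReal.ofReal (1 - min 1 (P (x + b) / P x)) := by
    intro x
    rw [← lintegral_unif_ite (div_nonneg (hP0 _).le (hP0 _).le)]
    refine lintegral_congr fun u => ?_
    rw [reflCoupling, apply_ite g]
  simp_rw [hin]
  have hmin : ∀ x, P x * min 1 (P (x + b) / P x) = min (P x) (P (x + b)) := by
    intro x
    rw [mul_min_of_nonneg _ _ (hP0 x).le, mul_one, mul_div_cancel₀ _ (hP0 x).ne']
  rw [gaussianReal_of_var_ne_zero 0 one_ne_zero,
    lintegral_withDensity_eq_lintegral_mul _ (measurable_gaussianPDF 0 1) (by fun_prop),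
    lintegral_withDensity_eq_lintegral_mul _ (measurable_gaussianPDF 0 1) hg]
  have h1 : ∀ x, (gaussianPDF 0 1 * fun x => g (x + b) * ENNReal.ofReal (min 1 (P (x + b) / P x))
        + g (-x) * ENNReal.ofReal (1 - min 1 (P (x + b) / P x))) x
      = g (x + b) * ENNReal.ofReal (min (P x) (P (x + b)))
        + g (-x) * ENNReal.ofReal (P x - min (P x) (P (x + b))) := by
    intro x
    simp only [Pi.mul_apply, gaussianPDF, ← hP]
    rw [← hmin, mul_add, mul_left_comm, mul_left_comm _ (g (-x)), ← ENNReal.ofReal_mul (hP0 x).le,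
      ← ENNReal.ofReal_mul (hP0 x).le, mul_sub, mul_one]
  simp_rw [h1]
  rw [lintegral_add_left (by fun_prop)]
  have h2 : ∫⁻ x, g (x + b) * ENNReal.ofReal (min (P x) (P (x + b))) =
      ∫⁻ x, g x * ENNReal.ofReal (min (P (x - b)) (P x)) := by
    rw [← lintegral_add_right_eq_self (fun x => g x * ENNReal.ofReal (min (P (x - b)) (P x))) b]
    simp
  have h3 : ∫⁻ x, g (-x) * ENNReal.ofReal (P x - min (P x) (P (x + b))) =
      ∫⁻ x, g x * ENNReal.ofReal (P x - min (P (x - b)) (P x)) := by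
    rw [← lintegral_neg_eq_self (fun x => g x * ENNReal.ofReal (P x - min (P (x - b)) (P x)))]
    refine lintegral_congr fun x => ?_
    rw [show -x - b = -(x + b) by ring, hP, gaussianPDFReal_neg, gaussianPDFReal_neg, min_comm]
  rw [h2, h3, ← lintegral_add_left (by fun_prop)]
  refine lintegral_congr fun x => ?_
  rw [← mul_add, ← ENNReal.ofReal_add (le_min (hP0 _).le (hP0 _).le)
    (sub_nonneg.2 (min_le_right _ _)), add_sub_cancel, Pi.mul_apply, mul_comm, gaussianPDF]

/-! ### Splitting off one coordinate of a standard Gaussian vector -/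

section Split

variable {d : ℕ}

/-- Replaces the `e`-component of `ζ` by `x`. -/
noncomputable def replaceComp (e : Pos d) (x : ℝ) (ζ : Pos d) : Pos d := x • e + (ζ - (inner ℝ e ζ : ℝ) • e)

lemma measurable_replaceComp (e : Pos d) :
    Measurable fun y : ℝ × Pos d => replaceComp e y.1 y.2 := by
  unfold replaceComp
  fun_prop

lemma inner_replaceComp {e : Pos d} (he : ‖e‖ = 1) (x : ℝ) (ζ : Pos d) :
    inner ℝ e (replaceComp e x ζ) = x := by
  simp [replaceComp, inner_add_right, inner_sub_right, inner_smul_right, he]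

/-- The component along e and the orthogonal remainder of a standard Gaussian are independent. In
characteristic functions this is Pythagoras: |t - (e·t)e|² = |t|² - (e·t)². -/
lemma map_replaceComp {e : Pos d} (he : ‖e‖ = 1) :
    ((gaussianReal 0 1).prod (stdGaussian (Pos d))).map (fun y => replaceComp e y.1 y.2) =
      stdGaussian (Pos d) := by
  have : IsProbabilityMeasure (((gaussianReal 0 1).prod (stdGaussian (Pos d))).map
      (fun y => replaceComp e y.1 y.2)) :=
    Measure.isProbabilityMeasure_map (measurable_replaceComp e).aemeasurable
  apply Measure.ext_of_charFun
  ext t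
  rw [charFun_stdGaussian, charFun_apply,
    integral_map (measurable_replaceComp e).aemeasurable (by fun_prop)]
  have h1 : ∀ y : ℝ × Pos d, Complex.exp ((inner ℝ (replaceComp e y.1 y.2) t : ℝ) * Complex.I) =
      Complex.exp (inner ℝ e t * y.1 * Complex.I) *
        Complex.exp ((inner ℝ y.2 (t - (inner ℝ e t : ℝ) • e) : ℝ) * Complex.I) := by
    intro y
    rw [← Complex.exp_add, ← add_mul]
    congr 2
    simp only [replaceComp, inner_add_left, inner_sub_left, inner_smul_left, inner_sub_right,
      inner_smul_right, conj_trivial]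
    rw [real_inner_comm y.2 e]
    push_cast
    ring
  simp_rw [h1]
  rw [integral_prod_mul (fun x : ℝ => Complex.exp (inner ℝ e t * x * Complex.I))
    (fun ζ : Pos d => Complex.exp ((inner ℝ ζ (t - (inner ℝ e t : ℝ) • e) : ℝ) * Complex.I)),
    ← charFun_apply_real, ← charFun_apply, charFun_stdGaussian, charFun_gaussianReal,
    ← Complex.exp_add]
  congr 1
  have h2 : ‖t - (inner ℝ e t : ℝ) • e‖ ^ 2 = ‖t‖ ^ 2 - (inner ℝ e t : ℝ) ^ 2 := by
    rw [norm_sub_sq_real, inner_smul_right, norm_smul, he, real_inner_comm e t, mul_one,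
      Real.norm_eq_abs, sq_abs]
    ring
  have h3 : ((‖t - (inner ℝ e t : ℝ) • e‖ : ℝ) : ℂ) ^ 2
      = (‖t‖ : ℂ) ^ 2 - ((inner ℝ e t : ℝ) : ℂ) ^ 2 := by
    exact_mod_cast h2
  rw [h3]
  push_cast
  simp
  ring

lemma lintegral_stdGaussian_split {e : Pos d} (he : ‖e‖ = 1) {g : Pos d → ENNReal}
    (hg : Measurable g) :
    ∫⁻ ξ, g ξ ∂(stdGaussian (Pos d)) =
      ∫⁻ ζ, ∫⁻ x, g (replaceComp e x ζ) ∂(gaussianReal 0 1) ∂(stdGaussian (Pos d)) := by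
  conv_lhs => rw [← map_replaceComp he]
  have hm := measurable_replaceComp e
  have hgm : Measurable fun y : ℝ × Pos d => g (replaceComp e y.1 y.2) := hg.comp hm
  rw [lintegral_map hg hm, lintegral_prod_symm' _ hgm]

/-- Applying the one-dimensional coupling in direction `e` preserves the standard Gaussian. -/
lemma lintegral_replaceComp_reflCoupling {e : Pos d} (he : ‖e‖ = 1) (b : ℝ) {g : Pos d → ENNReal}
    (hg : Measurable g) :
    ∫⁻ ξ, ∫⁻ u, g (replaceComp e (reflCoupling b (inner ℝ e ξ) u) ξ) ∂unif
      ∂(stdGaussian (Pos d)) = ∫⁻ ξ, g ξ ∂(stdGaussian (Pos d)) := by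
  have hm := measurable_replaceComp e
  have hm2 := measurable_reflCoupling b
  have hin : Measurable fun ξ : Pos d => inner ℝ e ξ := by fun_prop
  have hmeas : Measurable fun y : Pos d × ℝ =>
      g (replaceComp e (reflCoupling b (inner ℝ e y.1) y.2) y.1) := by
    refine hg.comp (hm.comp (Measurable.prodMk (hm2.comp (Measurable.prodMk ?_ measurable_snd))
      measurable_fst))
    exact hin.comp measurable_fst
  rw [lintegral_stdGaussian_split he hmeas.lintegral_prod_right', lintegral_stdGaussian_split he hg]
  refine lintegral_congr fun ζ => ?_
  have hgζ : Measurable fun x : ℝ => g (replaceComp e x ζ) :=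
    hg.comp (hm.comp (Measurable.prodMk measurable_id measurable_const))
  rw [← lintegral_reflCoupling b hgζ]
  refine lintegral_congr fun x => lintegral_congr fun u => ?_
  simp only [inner_replaceComp he]
  congr 1
  rw [replaceComp, inner_replaceComp he]
  simp [replaceComp]

/-- The law of `e · ξ`. -/
lemma map_inner_stdGaussian {e : Pos d} (he : ‖e‖ = 1) :
    (stdGaussian (Pos d)).map (fun ξ => inner ℝ e ξ) = gaussianReal 0 1 := by
  have hin : Measurable fun ξ : Pos d => inner ℝ e ξ := by fun_prop
  apply Measure.ext_of_lintegral
  intro g hg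
  have hgi : Measurable fun ξ : Pos d => g (inner ℝ e ξ) := hg.comp hin
  rw [lintegral_map hg hin, lintegral_stdGaussian_split he hgi]
  simp [inner_replaceComp he]

end Split

end KineticLangevin

namespace KineticLangevin

/-! ### Kernels driven by noise -/

section NoisyStep

variable {S T N : Type} [MeasurableSpace S] [MeasurableSpace T] [MeasurableSpace N]

lemma noisyStep_apply {ν : Measure N} [SFinite ν] {F : S → N → T}
    (hF : Measurable fun y : S × N => F y.1 y.2) (z : S) :
    noisyStep ν F z = ν.map (F z) := by
  rw [noisyStep, Kernel.map_apply _ hF, Kernel.prod_apply, Kernel.id_apply, Kernel.const_apply,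
    Measure.dirac_prod, Measure.map_map hF (by fun_prop)]
  rfl

lemma lintegral_noisyStep {ν : Measure N} [SFinite ν] {F : S → N → T}
    (hF : Measurable fun y : S × N => F y.1 y.2) (z : S) {g : T → ENNReal} (hg : Measurable g) :
    ∫⁻ t, g t ∂(noisyStep ν F z) = ∫⁻ n, g (F z n) ∂ν := by
  rw [noisyStep_apply hF, lintegral_map hg (by fun_prop)]

lemma kernel_ext_of_lintegral {P Q : Kernel S T}
    (h : ∀ (z : S) (g : T → ENNReal), Measurable g → ∫⁻ t, g t ∂(P z) = ∫⁻ t, g t ∂(Q z)) :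
    P = Q := by
  ext1 z
  exact Measure.ext_of_lintegral _ fun g hg => h z g hg

/-- Used with D a coordinate projection: if one coupled step projects to one step of the chain, so
do k of them. -/
lemma iterKernel_intertwine {D : Kernel S T} {Q : Kernel S S} {P : Kernel T T}
    (h : D ∘ₖ Q = P ∘ₖ D) (k : ℕ) : D ∘ₖ iterKernel Q k = iterKernel P k ∘ₖ D := by
  induction k with
  | zero => rw [iterKernel, iterKernel, Kernel.comp_id, Kernel.id_comp]
  | succ k ih =>
    rw [iterKernel, iterKernel, ← Kernel.comp_assoc, h, Kernel.comp_assoc, ih, Kernel.comp_assoc]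

/-- `(A B)^{k+1} = A (B A)^k B` for kernels. -/
lemma iterKernel_comp_succ (A : Kernel S T) (B : Kernel T S) (k : ℕ) :
    iterKernel (B ∘ₖ A) (k + 1) = B ∘ₖ (iterKernel (A ∘ₖ B) k ∘ₖ A) := by
  induction k with
  | zero => rw [iterKernel, iterKernel, iterKernel, Kernel.comp_id, Kernel.id_comp]
  | succ k ih =>
    rw [iterKernel, ih, iterKernel]
    simp only [Kernel.comp_assoc]

end NoisyStep

/-! ### The exact Ornstein–Uhlenbeck part is a semigroup -/

section Semigroup

variable {d : ℕ}

/-- The linear map `ξ ↦ (c₁ ξ₁ + c₂ ξ₂, d₁ ξ₁ + d₂ ξ₂)`. -/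
noncomputable def noiseMap (c₁ c₂ d₁ d₂ : ℝ) : Pos d × Pos d →L[ℝ] Phase d :=
  ContinuousLinearMap.prod
    (c₁ • ContinuousLinearMap.fst ℝ (Pos d) (Pos d) + c₂ • ContinuousLinearMap.snd ℝ (Pos d) (Pos d))
    (d₁ • ContinuousLinearMap.fst ℝ (Pos d) (Pos d) + d₂ • ContinuousLinearMap.snd ℝ (Pos d) (Pos d))

lemma noiseMap_apply (c₁ c₂ d₁ d₂ : ℝ) (ξ : Pos d × Pos d) :
    noiseMap c₁ c₂ d₁ d₂ ξ = (c₁ • ξ.1 + c₂ • ξ.2, d₁ • ξ.1 + d₂ • ξ.2) := rfl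

/-- The law is a centred Gaussian whose characteristic function involves the four coefficients only
through the position variance, the covariance and the velocity variance. -/
lemma charFunDual_map_noiseMap (c₁ c₂ d₁ d₂ : ℝ) (L : StrongDual ℝ (Phase d)) :
    charFunDual ((noise₂ d).map (noiseMap c₁ c₂ d₁ d₂)) L =
      Complex.exp (-((c₁ ^ 2 + c₂ ^ 2) * ‖L.comp (.inl ℝ (Pos d) (Pos d))‖ ^ 2
        + 2 * (c₁ * d₁ + c₂ * d₂) *
          inner ℝ ((InnerProductSpace.toDual ℝ (Pos d)).symm (L.comp (.inl ℝ (Pos d) (Pos d))))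
            ((InnerProductSpace.toDual ℝ (Pos d)).symm (L.comp (.inr ℝ (Pos d) (Pos d))))
        + (d₁ ^ 2 + d₂ ^ 2) * ‖L.comp (.inr ℝ (Pos d) (Pos d))‖ ^ 2 : ℝ) / 2) := by
  set T := InnerProductSpace.toDual ℝ (Pos d)
  obtain ⟨x, hx⟩ := T.surjective (L.comp (.inl ℝ (Pos d) (Pos d)))
  obtain ⟨y, hy⟩ := T.surjective (L.comp (.inr ℝ (Pos d) (Pos d)))
  have h1 : (L.comp (noiseMap c₁ c₂ d₁ d₂)).comp (.inl ℝ (Pos d) (Pos d)) = T (c₁ • x + d₁ • y) := by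
    ext v
    have e1 : L (v, 0) = T x v := by rw [hx]; rfl
    have e2 : L (0, v) = T y v := by rw [hy]; rfl
    have e3 : (c₁ • v, d₁ • v) = c₁ • ((v, 0) : Phase d) + d₁ • ((0, v) : Phase d) := by simp
    simp only [ContinuousLinearMap.comp_apply, ContinuousLinearMap.inl_apply, noiseMap_apply,
      smul_zero, add_zero]
    rw [e3, map_add, map_smul, map_smul, e1, e2, map_add, map_smul, map_smul]
    rfl
  have h2 : (L.comp (noiseMap c₁ c₂ d₁ d₂)).comp (.inr ℝ (Pos d) (Pos d)) = T (c₂ • x + d₂ • y) := by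
    ext v
    have e1 : L (v, 0) = T x v := by rw [hx]; rfl
    have e2 : L (0, v) = T y v := by rw [hy]; rfl
    have e3 : (c₂ • v, d₂ • v) = c₂ • ((v, 0) : Phase d) + d₂ • ((0, v) : Phase d) := by simp
    simp only [ContinuousLinearMap.comp_apply, ContinuousLinearMap.inr_apply, noiseMap_apply,
      smul_zero, zero_add]
    rw [e3, map_add, map_smul, map_smul, e1, e2, map_add, map_smul, map_smul]
    rfl
  rw [charFunDual_map, noise₂, charFunDual_prod, charFunDual_stdGaussian, charFunDual_stdGaussian,
    h1, h2, ← hx, ← hy, T.norm_map, T.norm_map, T.norm_map, T.norm_map, T.symm_apply_apply,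
    T.symm_apply_apply, ← Complex.exp_add]
  congr 1
  have h3 : ∀ a b : ℝ, ‖a • x + b • y‖ ^ 2 = a ^ 2 * ‖x‖ ^ 2 + 2 * (a * b) * inner ℝ x y
      + b ^ 2 * ‖y‖ ^ 2 := by
    intro a b
    rw [norm_add_sq_real, norm_smul, norm_smul, inner_smul_left, inner_smul_right, mul_pow, mul_pow,
      Real.norm_eq_abs, Real.norm_eq_abs, sq_abs, sq_abs, conj_trivial]
    ring
  have h4 := h3 c₁ d₁
  have h5 := h3 c₂ d₂
  rw [← Complex.ofReal_pow, ← Complex.ofReal_pow, h4, h5]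
  push_cast
  ring

/-- Independent centred Gaussians add their covariances, and three numbers determine the law, so
matching these three numbers suffices. -/
lemma map_noiseMap_add (c₁ c₂ d₁ d₂ c₁' c₂' d₁' d₂' e₁ e₂ f₁ f₂ : ℝ)
    (h1 : c₁ ^ 2 + c₂ ^ 2 + (c₁' ^ 2 + c₂' ^ 2) = e₁ ^ 2 + e₂ ^ 2)
    (h2 : c₁ * d₁ + c₂ * d₂ + (c₁' * d₁' + c₂' * d₂') = e₁ * f₁ + e₂ * f₂)
    (h3 : d₁ ^ 2 + d₂ ^ 2 + (d₁' ^ 2 + d₂' ^ 2) = f₁ ^ 2 + f₂ ^ 2) :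
    ((noise₂ d).prod (noise₂ d)).map
        (fun y => noiseMap c₁ c₂ d₁ d₂ y.1 + noiseMap c₁' c₂' d₁' d₂' y.2) =
      (noise₂ d).map (noiseMap e₁ e₂ f₁ f₂) := by
  have hm : ∀ a b c e : ℝ, Measurable (noiseMap (d := d) a b c e) := fun a b c e => by fun_prop
  have hp : ∀ a b c e : ℝ, IsProbabilityMeasure ((noise₂ d).map (noiseMap a b c e)) := fun a b c e =>
    Measure.isProbabilityMeasure_map (hm a b c e).aemeasurable
  have h0 : ((noise₂ d).prod (noise₂ d)).map
        (fun y => noiseMap c₁ c₂ d₁ d₂ y.1 + noiseMap c₁' c₂' d₁' d₂' y.2) =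
      ((noise₂ d).map (noiseMap c₁ c₂ d₁ d₂)).conv ((noise₂ d).map (noiseMap c₁' c₂' d₁' d₂')) := by
    rw [Measure.conv, Measure.map_prod_map _ _ (hm _ _ _ _) (hm _ _ _ _),
      Measure.map_map (by fun_prop) (by fun_prop)]
    rfl
  rw [h0]
  apply Measure.ext_of_charFunDual
  ext L
  rw [charFunDual_conv, charFunDual_map_noiseMap, charFunDual_map_noiseMap,
    charFunDual_map_noiseMap, ← Complex.exp_add, ← h1, ← h2, ← h3]
  congr 1
  push_cast
  ring

/-- The coefficients of the noise in `stepU`. -/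
noncomputable def corrCoeff (γ h : ℝ) : ℝ :=
  (1 - Real.exp (-γ * h)) / (1 + Real.exp (-γ * h)) * (2 / (γ * h))

/-- This is tanh(x/2) ≤ x/2. It keeps the number under the last square root in `Z₂` nonnegative. -/
lemma one_sub_exp_div_le {x : ℝ} (hx : 0 ≤ x) :
    (1 - Real.exp (-x)) / (1 + Real.exp (-x)) ≤ x / 2 := by
  have he := Real.exp_pos (-x)
  rw [div_le_div_iff₀ (by linarith) (by norm_num)]
  have hmono : Monotone fun x : ℝ => x * (1 + Real.exp (-x)) - (1 - Real.exp (-x)) * 2 := by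
    have hd : ∀ x : ℝ, HasDerivAt (fun x : ℝ => x * (1 + Real.exp (-x)) - (1 - Real.exp (-x)) * 2)
        (1 - (1 + x) * Real.exp (-x)) x := by
      intro x
      have h1 : HasDerivAt (fun x : ℝ => Real.exp (-x)) (Real.exp (-x) * (-1)) x :=
        (hasDerivAt_neg x).exp
      have h2 := ((hasDerivAt_id x).mul (h1.const_add 1)).sub ((h1.const_sub 1).mul_const 2)
      refine h2.congr_deriv ?_
      simp only [id]
      ring
    apply monotone_of_deriv_nonneg (fun x => (hd x).differentiableAt)
    intro x
    rw [(hd x).deriv]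
    have h1 := Real.add_one_le_exp x
    have h2 : Real.exp x * Real.exp (-x) = 1 := by rw [← Real.exp_add]; simp
    have h3 := mul_le_mul_of_nonneg_right h1 (Real.exp_pos (-x)).le
    linarith
  have := hmono hx
  simp only [neg_zero, Real.exp_zero, sub_self, zero_mul] at this
  linarith

lemma corrCoeff_le_one {γ h : ℝ} (hγ : 0 < γ) (hh : 0 < h) : corrCoeff γ h ≤ 1 := by
  have hx : 0 < γ * h := by positivity
  have := one_sub_exp_div_le hx.le
  rw [corrCoeff, neg_mul]
  calc _ ≤ γ * h / 2 * (2 / (γ * h)) := mul_le_mul_of_nonneg_right this (by positivity)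
    _ = 1 := by field_simp

lemma corrCoeff_nonneg {γ h : ℝ} (hγ : 0 < γ) (hh : 0 < h) : 0 ≤ corrCoeff γ h := by
  have h1 : Real.exp (-γ * h) ≤ 1 := by
    rw [Real.exp_le_one_iff, neg_mul]
    exact neg_nonpos.2 (by positivity)
  have h2 := Real.exp_pos (-γ * h)
  rw [corrCoeff]
  exact mul_nonneg (div_nonneg (by linarith) (by linarith)) (by positivity)

/-- Standard deviation of the velocity part, without the factor `√(2γ)`. -/
noncomputable def sdCoeff (γ h : ℝ) : ℝ := √((1 - Real.exp (-γ * h) ^ 2) / (2 * γ))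

lemma exp_neg_mul_le_one {γ h : ℝ} (hγ : 0 < γ) (hh : 0 < h) : Real.exp (-γ * h) ≤ 1 := by
  rw [Real.exp_le_one_iff, neg_mul]
  exact neg_nonpos.2 (by positivity)

lemma sdCoeff_sq {γ h : ℝ} (hγ : 0 < γ) (hh : 0 < h) :
    sdCoeff γ h ^ 2 = (1 - Real.exp (-γ * h) ^ 2) / (2 * γ) := by
  have h1 := exp_neg_mul_le_one hγ hh
  have h2 := Real.exp_pos (-γ * h)
  exact Real.sq_sqrt (div_nonneg (by nlinarith) (by positivity))

/-- The left side is the covariance per coordinate of the two Gaussian integrals in a U step; the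
correlation between them is chosen to produce exactly this value. -/
lemma sqrt_mul_sdCoeff_mul {γ h : ℝ} (hγ : 0 < γ) (hh : 0 < h) :
    √h * (sdCoeff γ h * √(corrCoeff γ h)) = (1 - Real.exp (-γ * h)) / γ := by
  have h1 := exp_neg_mul_le_one hγ hh
  have h2 := Real.exp_pos (-γ * h)
  have h3 : 0 ≤ (1 - Real.exp (-γ * h) ^ 2) / (2 * γ) := div_nonneg (by nlinarith) (by positivity)
  rw [sdCoeff, ← Real.sqrt_mul h3, ← Real.sqrt_mul hh.le, corrCoeff]
  have h4 : h * ((1 - Real.exp (-γ * h) ^ 2) / (2 * γ) *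
      ((1 - Real.exp (-γ * h)) / (1 + Real.exp (-γ * h)) * (2 / (γ * h)))) =
      ((1 - Real.exp (-γ * h)) / γ) ^ 2 := by
    have : (1 + Real.exp (-γ * h)) ≠ 0 := by positivity
    field_simp
    ring
  rw [h4, Real.sqrt_sq (div_nonneg (by linarith) hγ.le)]

lemma stepU_eq (γ h : ℝ) (a : Phase d) (ξ : Pos d × Pos d) :
    stepU γ h a ξ = (a.1 + ((1 - Real.exp (-γ * h)) / γ) • a.2, Real.exp (-γ * h) • a.2) +
      noiseMap (√(2 / γ) * (√h - sdCoeff γ h * √(corrCoeff γ h)))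
        (-(√(2 / γ) * (sdCoeff γ h * √(1 - corrCoeff γ h))))
        (√(2 * γ) * (sdCoeff γ h * √(corrCoeff γ h)))
        (√(2 * γ) * (sdCoeff γ h * √(1 - corrCoeff γ h))) ξ := by
  rw [noiseMap_apply]
  ext1
  · simp only [stepU, Z₁, Z₂, Prod.fst_add, sdCoeff, corrCoeff]
    module
  · simp only [stepU, Z₂, Prod.snd_add, sdCoeff, corrCoeff]
    module

lemma measurable_stepU (γ h : ℝ) :
    Measurable fun y : Phase d × (Pos d × Pos d) => stepU γ h y.1 y.2 := by
  simp only [stepU_eq]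
  fun_prop

/-- Two half steps of the exact part have the law of one full step. -/
lemma map_stepU_stepU {γ h : ℝ} (hγ : 0 < γ) (hh : 0 < h) (a : Phase d) :
    ((noise₂ d).prod (noise₂ d)).map
        (fun y => stepU γ (h / 2) (stepU γ (h / 2) a y.1) y.2) =
      (noise₂ d).map (stepU γ h a) := by
  have hh2 : 0 < h / 2 := by positivity
  have hζ : Real.exp (-γ * h) = Real.exp (-γ * (h / 2)) ^ 2 := by
    rw [← Real.exp_nat_mul]; congr 1; push_cast; ring
  have e1 := sdCoeff_sq hγ hh
  have e2 := sqrt_mul_sdCoeff_mul hγ hh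
  have e3 := sdCoeff_sq hγ hh2
  have e4 := sqrt_mul_sdCoeff_mul hγ hh2
  have e5 := Real.sq_sqrt (corrCoeff_nonneg hγ hh)
  have e6 := Real.sq_sqrt (sub_nonneg.2 (corrCoeff_le_one hγ hh))
  have e7 := Real.sq_sqrt (corrCoeff_nonneg hγ hh2)
  have e8 := Real.sq_sqrt (sub_nonneg.2 (corrCoeff_le_one hγ hh2))
  have e9 := Real.sq_sqrt (by positivity : 0 ≤ 2 / γ)
  have e10 := Real.sq_sqrt (by positivity : 0 ≤ 2 * γ)
  have e11 : √(2 / γ) * √(2 * γ) = 2 := by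
    rw [← Real.sqrt_mul (by positivity), show 2 / γ * (2 * γ) = 2 ^ 2 by field_simp]
    exact Real.sqrt_sq (by norm_num)
  have e12 := Real.sq_sqrt hh.le
  have e13 := Real.sq_sqrt hh2.le
  rw [show stepU γ h a = fun ξ => _ from funext (stepU_eq γ h a)]
  rw [hζ] at e1 e2 ⊢
  set ζ := Real.exp (-γ * (h / 2))
  set A := sdCoeff γ h
  set B := √(corrCoeff γ h)
  set C := √(1 - corrCoeff γ h)
  set A' := sdCoeff γ (h / 2) with hA'
  set B' := √(corrCoeff γ (h / 2)) with hB'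
  set C' := √(1 - corrCoeff γ (h / 2)) with hC'
  set P := √(2 / γ)
  set V := √(2 * γ)
  set H := √h
  set H' := √(h / 2) with hH'
  have hBC : B ^ 2 + C ^ 2 = 1 := by rw [e5, e6]; ring
  have hBC' : B' ^ 2 + C' ^ 2 = 1 := by rw [e7, e8]; ring
  -- The letters p, v stand for position and velocity: these are the variances and covariances of
  -- the noise of a full step, and the primed ones those of a half step.
  have pp : (P * (H - A * B)) ^ 2 + (-(P * (A * C))) ^ 2
      = 2 / γ * (h - 2 * ((1 - ζ ^ 2) / γ) + (1 - (ζ ^ 2) ^ 2) / (2 * γ)) := by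
    linear_combination (H ^ 2 - 2 * (H * (A * B)) + A ^ 2) * e9 + P ^ 2 * A ^ 2 * hBC
      + 2 / γ * e12 - 4 / γ * e2 + 2 / γ * e1
  have pp' : (P * (H' - A' * B')) ^ 2 + (-(P * (A' * C'))) ^ 2
      = 2 / γ * (h / 2 - 2 * ((1 - ζ) / γ) + (1 - ζ ^ 2) / (2 * γ)) := by
    linear_combination (H' ^ 2 - 2 * (H' * (A' * B')) + A' ^ 2) * e9 + P ^ 2 * A' ^ 2 * hBC'
      + 2 / γ * e13 - 4 / γ * e4 + 2 / γ * e3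
  have pv : P * (H - A * B) * (V * (A * B)) + -(P * (A * C)) * (V * (A * C))
      = 2 * ((1 - ζ ^ 2) / γ - (1 - (ζ ^ 2) ^ 2) / (2 * γ)) := by
    linear_combination (H * (A * B) - A ^ 2 * (B ^ 2 + C ^ 2)) * e11 + 2 * e2 - 2 * e1
      - 2 * A ^ 2 * hBC
  have pv' : P * (H' - A' * B') * (V * (A' * B')) + -(P * (A' * C')) * (V * (A' * C'))
      = 2 * ((1 - ζ) / γ - (1 - ζ ^ 2) / (2 * γ)) := by
    linear_combination (H' * (A' * B') - A' ^ 2 * (B' ^ 2 + C' ^ 2)) * e11 + 2 * e4 - 2 * e3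
      - 2 * A' ^ 2 * hBC'
  have vv : (V * (A * B)) ^ 2 + (V * (A * C)) ^ 2 = 2 * γ * ((1 - (ζ ^ 2) ^ 2) / (2 * γ)) := by
    linear_combination (A ^ 2 * (B ^ 2 + C ^ 2)) * e10 + 2 * γ * e1 + 2 * γ * A ^ 2 * hBC
  have vv' : (V * (A' * B')) ^ 2 + (V * (A' * C')) ^ 2 = 2 * γ * ((1 - ζ ^ 2) / (2 * γ)) := by
    linear_combination (A' ^ 2 * (B' ^ 2 + C' ^ 2)) * e10 + 2 * γ * e3 + 2 * γ * A' ^ 2 * hBC'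
  set t := (1 - ζ) / γ with ht
  -- The noise of the first half step is transported by the second flight: its position part gains t
  -- = (1 - ζ)/γ times the velocity noise, and its velocity part is damped by ζ.
  have hmain := map_noiseMap_add (d := d)
    (P * (H' - A' * B') + t * (V * (A' * B'))) (-(P * (A' * C')) + t * (V * (A' * C')))
    (ζ * (V * (A' * B'))) (ζ * (V * (A' * C')))
    (P * (H' - A' * B')) (-(P * (A' * C'))) (V * (A' * B')) (V * (A' * C'))
    (P * (H - A * B)) (-(P * (A * C))) (V * (A * B)) (V * (A * C))
    (by
      have h1 : 2 * (2 / γ * (h / 2 - 2 * ((1 - ζ) / γ) + (1 - ζ ^ 2) / (2 * γ)))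
        + 2 * t * (2 * ((1 - ζ) / γ - (1 - ζ ^ 2) / (2 * γ)))
        + t ^ 2 * (2 * γ * ((1 - ζ ^ 2) / (2 * γ))) =
        2 / γ * (h - 2 * ((1 - ζ ^ 2) / γ) + (1 - (ζ ^ 2) ^ 2) / (2 * γ)) := by
        rw [ht]; field_simp; ring
      linear_combination h1 + 2 * pp' + 2 * t * pv' + t ^ 2 * vv' - pp)
    (by
      have h1 : (1 + ζ) * (2 * ((1 - ζ) / γ - (1 - ζ ^ 2) / (2 * γ)))
        + t * ζ * (2 * γ * ((1 - ζ ^ 2) / (2 * γ))) =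
        2 * ((1 - ζ ^ 2) / γ - (1 - (ζ ^ 2) ^ 2) / (2 * γ)) := by
        rw [ht]; field_simp; ring
      linear_combination h1 + (1 + ζ) * pv' + t * ζ * vv' - pv)
    (by
      have h1 : (1 + ζ ^ 2) * (2 * γ * ((1 - ζ ^ 2) / (2 * γ))) =
          2 * γ * ((1 - (ζ ^ 2) ^ 2) / (2 * γ)) := by
        field_simp; ring
      linear_combination h1 + (1 + ζ ^ 2) * vv' - vv)
  have hL : (fun y : (Pos d × Pos d) × (Pos d × Pos d) =>
        stepU γ (h / 2) (stepU γ (h / 2) a y.1) y.2) =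
      (fun w => (a.1 + ((1 - ζ ^ 2) / γ) • a.2, ζ ^ 2 • a.2) + w) ∘ (fun y =>
        noiseMap (P * (H' - A' * B') + t * (V * (A' * B')))
          (-(P * (A' * C')) + t * (V * (A' * C')))
          (ζ * (V * (A' * B'))) (ζ * (V * (A' * C'))) y.1 +
        noiseMap (P * (H' - A' * B')) (-(P * (A' * C'))) (V * (A' * B')) (V * (A' * C')) y.2) := by
    funext y
    simp only [stepU_eq γ (h / 2), Function.comp, noiseMap_apply, ← hA', ← hB', ← hC', ← hH']
    have ht2 : (1 - ζ ^ 2) / γ = t + t * ζ := by rw [ht]; field_simp; ring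
    rw [ht2]
    ext1
    · simp only [Prod.fst_add, Prod.snd_add]
      change _ + t • (_) + _ = _
      module
    · simp only [Prod.snd_add]
      module
  have hR : (fun ξ => (a.1 + ((1 - ζ ^ 2) / γ) • a.2, ζ ^ 2 • a.2) +
      noiseMap (P * (H - A * B)) (-(P * (A * C))) (V * (A * B)) (V * (A * C)) ξ) =
      (fun w => (a.1 + ((1 - ζ ^ 2) / γ) • a.2, ζ ^ 2 • a.2) + w) ∘
        (noiseMap (d := d) (P * (H - A * B)) (-(P * (A * C))) (V * (A * B)) (V * (A * C))) := rfl
  rw [hL, hR, ← Measure.map_map (by fun_prop) (by fun_prop), hmain,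
    Measure.map_map (by fun_prop) (by fun_prop)]

end Semigroup

end KineticLangevin

namespace KineticLangevin

variable {d : ℕ} {U : Pos d → ℝ} {p : Params d}

/-! ### Measurability -/

lemma PotentialAssumption.continuous_gradient (hU : PotentialAssumption U p) :
    Continuous (gradient U) := by
  have h : LipschitzWith (Real.toNNReal p.L) (gradient U) := by
    apply LipschitzWith.of_dist_le_mul
    intro x y
    rw [dist_eq_norm, dist_eq_norm, Real.coe_toNNReal _ hU.L_pos.le]
    exact hU.lipschitz_gradient x y
  exact h.continuous

lemma PotentialAssumption.measurable_stepB (hU : PotentialAssumption U p) (h : ℝ) :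
    Measurable (stepB U h) := by
  have := hU.continuous_gradient.measurable
  unfold stepB
  fun_prop

namespace Params

lemma continuous_q (p : Params d) : Continuous fun z : Phase d × Phase d => p.q z.1 z.2 := by
  unfold q
  fun_prop

lemma continuous_rs (p : Params d) : Continuous fun z : Phase d × Phase d => p.rs z.1 z.2 := by
  have := p.continuous_q
  unfold rs
  fun_prop

lemma continuous_rl (p : Params d) : Continuous fun z : Phase d × Phase d => p.rl z.1 z.2 := by
  unfold rl
  fun_prop

lemma continuous_ρ (p : Params d) : Continuous fun z : Phase d × Phase d => p.ρ z.1 z.2 := by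
  have h1 := p.continuous_rs
  have h2 := p.continuous_rl
  have h3 := p.continuous_f
  unfold ρ Δ
  fun_prop

lemma measurable_coupledNoise (p : Params d) (h : ℝ) :
    Measurable fun y : (Phase d × Phase d) × (Pos d × ℝ) =>
      p.coupledNoise h y.1.1 y.1.2 y.2.1 y.2.2 := by
  have h1 := p.continuous_q.measurable
  have h2 := p.continuous_rs.measurable
  have h3 := p.continuous_rl.measurable
  have h4 := measurable_gaussianPDFReal 0 1
  unfold coupledNoise
  refine Measurable.ite ?_ (by fun_prop) (Measurable.ite ?_ (by fun_prop) (by fun_prop))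
  · exact measurableSet_le (by fun_prop) (by fun_prop)
  · exact measurableSet_le (by fun_prop) (by fun_prop)

end Params

lemma measurable_stepU_comp {S : Type*} [MeasurableSpace S] {γ h : ℝ} {A : S → Phase d}
    {X : S → Pos d × Pos d} (hA : Measurable A) (hX : Measurable X) :
    Measurable fun s => stepU γ h (A s) (X s) :=
  (measurable_stepU γ h).comp (hA.prodMk hX)

namespace PotentialAssumption

lemma measurable_coupledStepBU (hU : PotentialAssumption U p) (h : ℝ) :
    Measurable fun y : (Phase d × Phase d) × ((Pos d × Pos d) × ℝ) =>
      p.coupledStepBU U h y.1 y.2 := by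
  have h1 := hU.measurable_stepB h
  have h2 : Measurable fun y : (Phase d × Phase d) × ((Pos d × Pos d) × ℝ) =>
      p.coupledNoise h y.1.1 y.1.2 y.2.1.1 y.2.2 :=
    (p.measurable_coupledNoise h).comp
      (f := fun y : (Phase d × Phase d) × ((Pos d × Pos d) × ℝ) => (y.1, (y.2.1.1, y.2.2)))
      (by fun_prop)
  unfold Params.coupledStepBU
  exact (measurable_stepU_comp (by fun_prop) (by fun_prop)).prodMk
    (measurable_stepU_comp (by fun_prop) (by fun_prop))

lemma measurable_stepUBU (hU : PotentialAssumption U p) (γ h : ℝ) :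
    Measurable fun y : Phase d × ((Pos d × Pos d) × (Pos d × Pos d)) => stepUBU U γ h y.1 y.2 := by
  have h1 := hU.measurable_stepB h
  have h2 : Measurable fun y : Phase d × ((Pos d × Pos d) × (Pos d × Pos d)) =>
      stepU γ (h / 2) y.1 y.2.1 :=
    measurable_stepU_comp measurable_fst (measurable_fst.comp measurable_snd)
  exact measurable_stepU_comp (h1.comp h2) (measurable_snd.comp measurable_snd)

end PotentialAssumption

lemma measurable_syncHalfU (p : Params d) (h : ℝ) :
    Measurable fun y : (Phase d × Phase d) × (Pos d × Pos d) => p.syncHalfU h y.1 y.2 := by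
  unfold Params.syncHalfU
  exact (measurable_stepU_comp (by fun_prop) (by fun_prop)).prodMk
    (measurable_stepU_comp (by fun_prop) (by fun_prop))

lemma PotentialAssumption.measurable_syncBHalfU (hU : PotentialAssumption U p) (h : ℝ) :
    Measurable fun y : (Phase d × Phase d) × (Pos d × Pos d) => p.syncBHalfU U h y.1 y.2 := by
  have h1 := hU.measurable_stepB h
  have h2 := measurable_syncHalfU p h
  unfold Params.syncBHalfU
  exact h2.comp (f := fun y : (Phase d × Phase d) × (Pos d × Pos d) =>
    ((stepB U h y.1.1, stepB U h y.1.2), y.2)) (by fun_prop)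

/-! ### The noise of the second copy is standard normal -/

/-- Only the component of the noise along q is coupled nontrivially, by the one-dimensional coupling
with separation β|q|; the orthogonal components are shared. -/
lemma coupledNoise_of_near {h : ℝ} {a b : Phase d} (hnear : p.rs a b < p.DK + p.ε * p.rl a b)
    (hq : p.q a b ≠ 0) (ξ : Pos d) (u : ℝ) :
    p.coupledNoise h a b ξ u =
      replaceComp (‖p.q a b‖⁻¹ • p.q a b)
        (reflCoupling (1 / √(2 * p.γ⁻¹ * h) * ‖p.q a b‖)
          (inner ℝ (‖p.q a b‖⁻¹ • p.q a b) ξ) u) ξ := by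
  simp only [Params.coupledNoise, if_neg (not_le.2 hnear), reflCoupling]
  have hn : ‖p.q a b‖ ≠ 0 := norm_ne_zero_iff.2 hq
  have hqe : ∀ β : ℝ, β • p.q a b = (β * ‖p.q a b‖) • (‖p.q a b‖⁻¹ • p.q a b) := by
    intro β
    rw [smul_smul, mul_assoc, mul_inv_cancel₀ hn, mul_one]
  generalize ‖p.q a b‖⁻¹ • p.q a b = e at hqe ⊢
  rw [hqe]
  split_ifs
  · rw [replaceComp]
    module
  · rw [replaceComp]
    module

/-- At q = 0 the density ratio is 1, so every u ≤ 1 is accepted and the shift is zero. The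
restriction on u is harmless because it holds almost surely. -/
lemma coupledNoise_of_q_eq_zero {h : ℝ} {a b : Phase d} (hq : p.q a b = 0) (ξ : Pos d) {u : ℝ}
    (hu : u ≤ 1) : p.coupledNoise h a b ξ u = ξ := by
  have : (1 : ℝ) = gaussianPDFReal 0 1 0 / gaussianPDFReal 0 1 0 :=
    (div_self (gaussianPDFReal_pos 0 1 0 one_ne_zero).ne').symm
  simp [Params.coupledNoise, hq, ← this, hu]

lemma coupledNoise_cases (p : Params d) (h : ℝ) (a b : Phase d) :
    (∀ ξ u, u ≤ 1 → p.coupledNoise h a b ξ u = ξ) ∨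
      (p.rs a b < p.DK + p.ε * p.rl a b ∧ p.q a b ≠ 0) := by
  by_cases hfar : p.DK + p.ε * p.rl a b ≤ p.rs a b
  · left
    intro ξ u _
    simp only [Params.coupledNoise, if_pos hfar]
  by_cases hq : p.q a b = 0
  · exact Or.inl fun ξ u hu => coupledNoise_of_q_eq_zero hq ξ hu
  · exact Or.inr ⟨not_le.1 hfar, hq⟩

lemma norm_inv_norm_smul {q : Pos d} (hq : q ≠ 0) : ‖‖q‖⁻¹ • q‖ = 1 := by
  rw [norm_smul, norm_inv, norm_norm, inv_mul_cancel₀ (norm_ne_zero_iff.2 hq)]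

lemma unif_ae_mem : ∀ᵐ u ∂unif, u ∈ Icc (0 : ℝ) 1 := by
  rw [unif]
  exact ae_restrict_mem measurableSet_Icc

lemma lintegral_coupledNoise (p : Params d) (h : ℝ) (a b : Phase d) {g : Pos d → ENNReal}
    (hg : Measurable g) :
    ∫⁻ ξ, ∫⁻ u, g (p.coupledNoise h a b ξ u) ∂unif ∂(stdGaussian (Pos d)) =
      ∫⁻ ξ, g ξ ∂(stdGaussian (Pos d)) := by
  rcases coupledNoise_cases p h a b with H | ⟨hnear, hq⟩
  · refine lintegral_congr fun ξ => ?_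
    have : ∫⁻ u, g (p.coupledNoise h a b ξ u) ∂unif = ∫⁻ _u, g ξ ∂unif := by
      apply lintegral_congr_ae
      filter_upwards [unif_ae_mem] with u hu
      rw [H ξ u hu.2]
    rw [this, lintegral_const, measure_univ, mul_one]
  · simp_rw [coupledNoise_of_near hnear hq]
    exact lintegral_replaceComp_reflCoupling (norm_inv_norm_smul hq) _ hg

/-- Jointly with the second normal vector. -/
lemma lintegral_coupledNoise_prod (p : Params d) (h : ℝ) (a b : Phase d)
    {g : Pos d × Pos d → ENNReal} (hg : Measurable g) :
    ∫⁻ n, g (p.coupledNoise h a b n.1.1 n.2, n.1.2) ∂((noise₂ d).prod unif) =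
      ∫⁻ ξ, g ξ ∂(noise₂ d) := by
  have hc : Measurable fun y : Pos d × ℝ => p.coupledNoise h a b y.1 y.2 :=
    (p.measurable_coupledNoise h).comp (f := fun y : Pos d × ℝ => ((a, b), y)) (by fun_prop)
  have hm : Measurable fun n : (Pos d × Pos d) × ℝ =>
      g (p.coupledNoise h a b n.1.1 n.2, n.1.2) :=
    hg.comp ((hc.comp (f := fun n : (Pos d × Pos d) × ℝ => (n.1.1, n.2)) (by fun_prop)).prodMk
      (by fun_prop))
  rw [lintegral_prod _ hm.aemeasurable, noise₂,
    lintegral_prod_symm' _ hm.lintegral_prod_right', lintegral_prod_symm' _ hg]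
  refine lintegral_congr fun ξ₂ => ?_
  exact lintegral_coupledNoise p h a b (g := fun ξ => g (ξ, ξ₂)) (by fun_prop)

/-! ### The coupling has the right marginals -/

/-- The kernel of a `U` step. -/
noncomputable def kernelU (d : ℕ) (γ h : ℝ) : Kernel (Phase d) (Phase d) :=
  noisyStep (noise₂ d) (stepU γ h)

lemma kernelU_comp_half {γ h : ℝ} (hγ : 0 < γ) (hh : 0 < h) :
    kernelU d γ (h / 2) ∘ₖ kernelU d γ (h / 2) = kernelU d γ h := by
  refine kernel_ext_of_lintegral fun a g hg => ?_
  have hm := measurable_stepU (d := d) γ (h / 2)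
  have hgm : Measurable fun y : Phase d × (Pos d × Pos d) => g (stepU γ (h / 2) y.1 y.2) :=
    hg.comp hm
  have hg2 : Measurable fun y : (Pos d × Pos d) × (Pos d × Pos d) =>
      stepU γ (h / 2) (stepU γ (h / 2) a y.1) y.2 :=
    measurable_stepU_comp (measurable_stepU_comp (by fun_prop) (by fun_prop)) (by fun_prop)
  have hg4 : Measurable fun y : (Pos d × Pos d) × (Pos d × Pos d) =>
      g (stepU γ (h / 2) (stepU γ (h / 2) a y.1) y.2) := hg.comp hg2
  have hg3 : Measurable (stepU γ h a) := measurable_stepU_comp measurable_const measurable_id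
  rw [Kernel.lintegral_comp _ _ _ hg, kernelU, kernelU]
  simp_rw [lintegral_noisyStep hm _ hg]
  rw [lintegral_noisyStep hm _ hgm.lintegral_prod_right',
    lintegral_noisyStep (measurable_stepU γ h) _ hg,
    ← lintegral_map hg hg3,
    ← map_stepU_stepU hγ hh, lintegral_map hg hg2,
    lintegral_prod _ hg4.aemeasurable]

namespace PotentialAssumption

lemma noisyStep_stepUBU (hU : PotentialAssumption U p) (γ h : ℝ) :
    noisyStep ((noise₂ d).prod (noise₂ d)) (stepUBU U γ h) =
      (kernelU d γ (h / 2) ∘ₖ Kernel.deterministic (stepB U h) (hU.measurable_stepB h)) ∘ₖ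
        kernelU d γ (h / 2) := by
  refine kernel_ext_of_lintegral fun a g hg => ?_
  have hm := measurable_stepU (d := d) γ (h / 2)
  have hB := hU.measurable_stepB h
  have hgm : Measurable fun y : Phase d × (Pos d × Pos d) =>
      g (stepU γ (h / 2) (stepB U h y.1) y.2) :=
    hg.comp (measurable_stepU_comp (by fun_prop) (by fun_prop))
  rw [Kernel.lintegral_comp _ _ _ hg, Kernel.comp_deterministic_eq_comap,
    lintegral_noisyStep (hU.measurable_stepUBU γ h) _ hg]
  simp_rw [Kernel.comap_apply, kernelU, lintegral_noisyStep hm _ hg]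
  rw [lintegral_noisyStep hm _ hgm.lintegral_prod_right', lintegral_prod]
  · rfl
  · exact (hg.comp ((hU.measurable_stepUBU γ h).comp measurable_prodMk_left)).aemeasurable

lemma fst_coupledStepBU (hU : PotentialAssumption U p) (h : ℝ) :
    Kernel.deterministic Prod.fst measurable_fst ∘ₖ
        noisyStep ((noise₂ d).prod unif) (p.coupledStepBU U h) =
      (kernelU d p.γ h ∘ₖ Kernel.deterministic (stepB U h) (hU.measurable_stepB h)) ∘ₖ
        Kernel.deterministic Prod.fst measurable_fst := by
  refine kernel_ext_of_lintegral fun z g hg => ?_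
  have hg1 : Measurable fun z : Phase d × Phase d => g z.1 := hg.comp measurable_fst
  rw [Kernel.deterministic_comp_eq_map, Kernel.lintegral_map _ measurable_fst _ hg,
    lintegral_noisyStep (hU.measurable_coupledStepBU h) _ hg1,
    Kernel.comp_deterministic_eq_comap, Kernel.comp_deterministic_eq_comap, Kernel.comap_apply,
    Kernel.comap_apply, kernelU, lintegral_noisyStep (measurable_stepU p.γ h) _ hg]
  have hgm : Measurable fun ξ : Pos d × Pos d => g (stepU p.γ h (stepB U h z.1) ξ) :=
    hg.comp (measurable_stepU_comp measurable_const measurable_id)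
  change ∫⁻ n, g (stepU p.γ h (stepB U h z.1) n.1) ∂((noise₂ d).prod unif) = _
  have hgm1 : Measurable fun n : (Pos d × Pos d) × ℝ => g (stepU p.γ h (stepB U h z.1) n.1) :=
    hgm.comp measurable_fst
  rw [lintegral_prod _ hgm1.aemeasurable]
  simp

lemma snd_coupledStepBU (hU : PotentialAssumption U p) (h : ℝ) :
    Kernel.deterministic Prod.snd measurable_snd ∘ₖ
        noisyStep ((noise₂ d).prod unif) (p.coupledStepBU U h) =
      (kernelU d p.γ h ∘ₖ Kernel.deterministic (stepB U h) (hU.measurable_stepB h)) ∘ₖ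
        Kernel.deterministic Prod.snd measurable_snd := by
  refine kernel_ext_of_lintegral fun z g hg => ?_
  have hg1 : Measurable fun z : Phase d × Phase d => g z.2 := hg.comp measurable_snd
  rw [Kernel.deterministic_comp_eq_map, Kernel.lintegral_map _ measurable_snd _ hg,
    lintegral_noisyStep (hU.measurable_coupledStepBU h) _ hg1,
    Kernel.comp_deterministic_eq_comap, Kernel.comp_deterministic_eq_comap, Kernel.comap_apply,
    Kernel.comap_apply, kernelU, lintegral_noisyStep (measurable_stepU p.γ h) _ hg]
  have hgm : Measurable fun ξ : Pos d × Pos d => g (stepU p.γ h (stepB U h z.2) ξ) :=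
    hg.comp (measurable_stepU_comp measurable_const measurable_id)
  exact lintegral_coupledNoise_prod p h z.1 z.2 hgm

lemma fst_syncBHalfU (hU : PotentialAssumption U p) (h : ℝ) :
    Kernel.deterministic Prod.fst measurable_fst ∘ₖ noisyStep (noise₂ d) (p.syncBHalfU U h) =
      (kernelU d p.γ (h / 2) ∘ₖ Kernel.deterministic (stepB U h) (hU.measurable_stepB h)) ∘ₖ
        Kernel.deterministic Prod.fst measurable_fst := by
  refine kernel_ext_of_lintegral fun z g hg => ?_
  have hg1 : Measurable fun z : Phase d × Phase d => g z.1 := hg.comp measurable_fst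
  rw [Kernel.deterministic_comp_eq_map, Kernel.lintegral_map _ measurable_fst _ hg,
    lintegral_noisyStep (hU.measurable_syncBHalfU h) _ hg1,
    Kernel.comp_deterministic_eq_comap, Kernel.comp_deterministic_eq_comap, Kernel.comap_apply,
    Kernel.comap_apply, kernelU, lintegral_noisyStep (measurable_stepU p.γ (h / 2)) _ hg]
  rfl

lemma snd_syncBHalfU (hU : PotentialAssumption U p) (h : ℝ) :
    Kernel.deterministic Prod.snd measurable_snd ∘ₖ noisyStep (noise₂ d) (p.syncBHalfU U h) =
      (kernelU d p.γ (h / 2) ∘ₖ Kernel.deterministic (stepB U h) (hU.measurable_stepB h)) ∘ₖ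
        Kernel.deterministic Prod.snd measurable_snd := by
  refine kernel_ext_of_lintegral fun z g hg => ?_
  have hg1 : Measurable fun z : Phase d × Phase d => g z.2 := hg.comp measurable_snd
  rw [Kernel.deterministic_comp_eq_map, Kernel.lintegral_map _ measurable_snd _ hg,
    lintegral_noisyStep (hU.measurable_syncBHalfU h) _ hg1,
    Kernel.comp_deterministic_eq_comap, Kernel.comp_deterministic_eq_comap, Kernel.comap_apply,
    Kernel.comap_apply, kernelU, lintegral_noisyStep (measurable_stepU p.γ (h / 2)) _ hg]
  rfl

end PotentialAssumption

lemma fst_syncHalfU (p : Params d) (h : ℝ) :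
    Kernel.deterministic Prod.fst measurable_fst ∘ₖ noisyStep (noise₂ d) (p.syncHalfU h) =
      kernelU d p.γ (h / 2) ∘ₖ Kernel.deterministic Prod.fst measurable_fst := by
  refine kernel_ext_of_lintegral fun z g hg => ?_
  have hg1 : Measurable fun z : Phase d × Phase d => g z.1 := hg.comp measurable_fst
  rw [Kernel.deterministic_comp_eq_map, Kernel.lintegral_map _ measurable_fst _ hg,
    lintegral_noisyStep (measurable_syncHalfU p h) _ hg1,
    Kernel.comp_deterministic_eq_comap, Kernel.comap_apply, kernelU,
    lintegral_noisyStep (measurable_stepU p.γ (h / 2)) _ hg]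
  rfl

lemma snd_syncHalfU (p : Params d) (h : ℝ) :
    Kernel.deterministic Prod.snd measurable_snd ∘ₖ noisyStep (noise₂ d) (p.syncHalfU h) =
      kernelU d p.γ (h / 2) ∘ₖ Kernel.deterministic Prod.snd measurable_snd := by
  refine kernel_ext_of_lintegral fun z g hg => ?_
  have hg1 : Measurable fun z : Phase d × Phase d => g z.2 := hg.comp measurable_snd
  rw [Kernel.deterministic_comp_eq_map, Kernel.lintegral_map _ measurable_snd _ hg,
    lintegral_noisyStep (measurable_syncHalfU p h) _ hg1,
    Kernel.comp_deterministic_eq_comap, Kernel.comap_apply, kernelU,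
    lintegral_noisyStep (measurable_stepU p.γ (h / 2)) _ hg]
  rfl

namespace PotentialAssumption

/-- `(U_{1/2} B U_{1/2})^{k+1} = U_{1/2} (B U)^k B U_{1/2}` in law. -/
lemma ubu_succ (hU : PotentialAssumption U p) {γ h : ℝ} (hγ : 0 < γ) (hh : 0 < h) (k : ℕ) :
    ubu U γ h (k + 1) =
      (kernelU d γ (h / 2) ∘ₖ Kernel.deterministic (stepB U h) (hU.measurable_stepB h)) ∘ₖ
        (iterKernel (kernelU d γ h ∘ₖ Kernel.deterministic (stepB U h) (hU.measurable_stepB h)) k ∘ₖ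
          kernelU d γ (h / 2)) := by
  rw [ubu, hU.noisyStep_stepUBU, iterKernel_comp_succ, ← Kernel.comp_assoc (kernelU d γ (h / 2)),
    kernelU_comp_half hγ hh]

/-- D stands for either coordinate projection, so that both marginals follow from a single argument.
-/
lemma intertwine_ubuCoupling (hU : PotentialAssumption U p) {h : ℝ} (hγ : 0 < p.γ) (hh : 0 < h)
    {D : Kernel (Phase d × Phase d) (Phase d)}
    (h1 : D ∘ₖ noisyStep (noise₂ d) (p.syncHalfU h) = kernelU d p.γ (h / 2) ∘ₖ D)
    (h2 : D ∘ₖ noisyStep ((noise₂ d).prod unif) (p.coupledStepBU U h) =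
      (kernelU d p.γ h ∘ₖ Kernel.deterministic (stepB U h) (hU.measurable_stepB h)) ∘ₖ D)
    (h3 : D ∘ₖ noisyStep (noise₂ d) (p.syncBHalfU U h) =
      (kernelU d p.γ (h / 2) ∘ₖ Kernel.deterministic (stepB U h) (hU.measurable_stepB h)) ∘ₖ D)
    (k : ℕ) : D ∘ₖ p.ubuCoupling U h k = ubu U p.γ h k ∘ₖ D := by
  cases k with
  | zero => rw [Params.ubuCoupling, ubu, iterKernel, Kernel.comp_id, Kernel.id_comp]
  | succ k =>
    rw [hU.ubu_succ hγ hh, Params.ubuCoupling, ← Kernel.comp_assoc, h3, Kernel.comp_assoc,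
      ← Kernel.comp_assoc D, iterKernel_intertwine h2]
    simp only [Kernel.comp_assoc]
    rw [h1]

lemma map_fst_ubuCoupling (hU : PotentialAssumption U p) {h : ℝ} (hγ : 0 < p.γ) (hh : 0 < h)
    (k : ℕ) (a b : Phase d) :
    (p.ubuCoupling U h k (a, b)).map Prod.fst = ubu U p.γ h k a := by
  have := hU.intertwine_ubuCoupling hγ hh (fst_syncHalfU p h) (hU.fst_coupledStepBU h)
    (hU.fst_syncBHalfU h) k
  have h2 := DFunLike.congr_fun this (a, b)
  rwa [Kernel.deterministic_comp_eq_map, Kernel.map_apply _ measurable_fst,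
    Kernel.comp_deterministic_eq_comap, Kernel.comap_apply] at h2

lemma map_snd_ubuCoupling (hU : PotentialAssumption U p) {h : ℝ} (hγ : 0 < p.γ) (hh : 0 < h)
    (k : ℕ) (a b : Phase d) :
    (p.ubuCoupling U h k (a, b)).map Prod.snd = ubu U p.γ h k b := by
  have := hU.intertwine_ubuCoupling hγ hh (snd_syncHalfU p h) (hU.snd_coupledStepBU h)
    (hU.snd_syncBHalfU h) k
  have h2 := DFunLike.congr_fun this (a, b)
  rwa [Kernel.deterministic_comp_eq_map, Kernel.map_apply _ measurable_snd,
    Kernel.comp_deterministic_eq_comap, Kernel.comap_apply] at h2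

end PotentialAssumption

end KineticLangevin

namespace KineticLangevin

variable {d : ℕ} {U : Pos d → ℝ} {p : Params d} {h : ℝ}

/-! ### Differences of two copies -/

lemma sub_sq_div_two_le_one_sub_exp {s : ℝ} (hs : 0 ≤ s) : s - s ^ 2 / 2 ≤ 1 - Real.exp (-s) := by
  have h1 := Real.quadratic_le_exp_of_nonneg hs
  have h2 : Real.exp (-s) * Real.exp s = 1 := by rw [← Real.exp_add]; simp
  have h3 := Real.exp_pos (-s)
  have h4 : Real.exp (-s) * (1 + s + s ^ 2 / 2) ≤ 1 := by
    exact (mul_le_mul_of_nonneg_left h1 h3.le).trans h2.le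
  -- The product equals 1 + s⁴/4.
  have h5 : 1 ≤ (1 - s + s ^ 2 / 2) * (1 + s + s ^ 2 / 2) := by nlinarith [sq_nonneg (s ^ 2)]
  have h6 : Real.exp (-s) ≤ 1 - s + s ^ 2 / 2 :=
    le_of_mul_le_mul_right (h4.trans h5) (by positivity)
  linarith

lemma one_sub_exp_neg_le (s : ℝ) : 1 - Real.exp (-s) ≤ s := by
  have := Real.add_one_le_exp (-s)
  linarith

/-- Difference of two `U` steps that share the second normal vector. -/
lemma stepU_sub {γ : ℝ} (hγ : 0 < γ) (hh : 0 < h) (a b : Phase d) (ξ ξ' ζ : Pos d) :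
    (stepU γ h a (ξ, ζ)).1 - (stepU γ h b (ξ', ζ)).1 =
        (a.1 - b.1) + (1 - Real.exp (-γ * h)) • (γ⁻¹ • (a.2 - b.2)) +
          (√(2 * γ⁻¹ * h) * (1 - (1 - Real.exp (-γ * h)) / (γ * h))) • (ξ - ξ') ∧
      γ⁻¹ • ((stepU γ h a (ξ, ζ)).2 - (stepU γ h b (ξ', ζ)).2) =
        (1 - (1 - Real.exp (-γ * h))) • (γ⁻¹ • (a.2 - b.2)) +
          (√(2 * γ⁻¹ * h) * ((1 - Real.exp (-γ * h)) / (γ * h))) • (ξ - ξ') := by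
  have e1 := sqrt_mul_sdCoeff_mul hγ hh
  have hsh : 0 < √h := Real.sqrt_pos.2 hh
  have hsq : √h * √h = h := Real.mul_self_sqrt hh.le
  have e2 : sdCoeff γ h * √(corrCoeff γ h) = √h * ((1 - Real.exp (-γ * h)) / (γ * h)) := by
    apply mul_left_cancel₀ hsh.ne'
    rw [e1, ← mul_assoc, hsq]
    field_simp
  have e3 : √(2 * γ⁻¹ * h) = √(2 / γ) * √h := by
    rw [← div_eq_mul_inv, Real.sqrt_mul (by positivity)]
  have e4 : γ⁻¹ * √(2 * γ) = √(2 / γ) := by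
    have : (2 : ℝ) / γ = (2 * γ) / γ ^ 2 := by field_simp
    rw [this, Real.sqrt_div (by positivity), Real.sqrt_sq hγ.le]
    field_simp
  simp only [stepU_eq, noiseMap_apply, Prod.fst_add, Prod.snd_add]
  rw [e2, e3]
  constructor
  · rw [div_eq_mul_inv (1 - Real.exp (-γ * h)) γ]
    module
  · rw [← e4]
    module

namespace PotentialAssumption

/-- The `B` step acts on differences as `u ↦ u - s (γ⁻² K z + g)` with `u = γ⁻¹ w` and `s = γ h`. -/
lemma exists_kick (hU : PotentialAssumption U p) (hγ : 0 < p.γ) (hfric : p.FrictionCondition)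
    (hh : 0 ≤ h) (a b : Phase d) :
    ∃ g : Pos d, p.γ⁻¹ • ((stepB U h a).2 - (stepB U h b).2) =
        p.γ⁻¹ • (a.2 - b.2) - (p.γ * h) • (p.Ks (a.1 - b.1) + g) ∧
      ‖g‖ ^ 2 ≤ p.kap / 13 * ‖a.1 - b.1‖ ^ 2 ∧
      -(p.τ * p.calR) ≤ inner ℝ (a.1 - b.1) g ∧
      ‖(p.γ * h) • (p.Ks (a.1 - b.1) + g)‖ ≤ p.α * (p.γ * h) / 2 * ‖a.1 - b.1‖ := by
  have hgr := fun x => gradient_G hU.differentiable hU.K_symmetric x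
  have hLG := hU.lipschitz_G a.1 b.1
  have hLG0 := hU.LG_nonneg
  have hκ := hU.κ_pos
  set D := gradient (p.G U) a.1 - gradient (p.G U) b.1 with hD
  have hDU : p.Ks (a.1 - b.1) + (p.γ ^ 2)⁻¹ • D =
      (p.γ ^ 2)⁻¹ • (gradient U a.1 - gradient U b.1) := by
    rw [hD, hgr, hgr, Params.Ks, smul_apply, map_sub]
    module
  have hsD : (p.γ * h) • ((p.γ ^ 2)⁻¹ • (gradient U a.1 - gradient U b.1)) =
      (p.γ⁻¹ * h) • (gradient U a.1 - gradient U b.1) := by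
    rw [smul_smul]
    congr 1
    field_simp
  refine ⟨(p.γ ^ 2)⁻¹ • D, ?_, ?_, ?_, ?_⟩
  · rw [hDU, hsD]
    simp only [stepB]
    module
  -- The friction condition says 13 L_G² ≤ κγ², which turns the Lipschitz bound on ∇G into the bound
  -- on g required by the twisted form.
  · have h1 : 13 * p.LG ^ 2 / p.κ ≤ p.γ ^ 2 := by
      have := (Real.sqrt_le_left hγ.le).1 hfric
      exact this
    have h2 : 13 * p.LG ^ 2 ≤ p.γ ^ 2 * p.κ := (div_le_iff₀ hκ).1 h1
    have h3 : ‖D‖ ^ 2 ≤ p.LG ^ 2 * ‖a.1 - b.1‖ ^ 2 := by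
      rw [← mul_pow]
      exact pow_le_pow_left₀ (norm_nonneg _) hLG 2
    rw [norm_smul, mul_pow, Real.norm_eq_abs, sq_abs, Params.kap]
    have h4 : ((p.γ ^ 2)⁻¹) ^ 2 * (p.LG ^ 2) ≤ p.κ / p.γ ^ 2 / 13 := by
      have h5 : ((p.γ ^ 2)⁻¹) ^ 2 * p.LG ^ 2 = p.LG ^ 2 / (p.γ ^ 2 * p.γ ^ 2) := by field_simp
      rw [h5, div_le_iff₀ (by positivity)]
      have h6 : p.κ / p.γ ^ 2 / 13 * (p.γ ^ 2 * p.γ ^ 2) = p.γ ^ 2 * p.κ / 13 := by field_simp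
      rw [h6]
      linarith
    calc ((p.γ ^ 2)⁻¹) ^ 2 * ‖D‖ ^ 2 ≤ ((p.γ ^ 2)⁻¹) ^ 2 * (p.LG ^ 2 * ‖a.1 - b.1‖ ^ 2) :=
          mul_le_mul_of_nonneg_left h3 (by positivity)
      _ = ((p.γ ^ 2)⁻¹) ^ 2 * p.LG ^ 2 * ‖a.1 - b.1‖ ^ 2 := by ring
      _ ≤ _ := mul_le_mul_of_nonneg_right h4 (by positivity)
  · have h1 : p.τ * p.calR = (p.γ ^ 2)⁻¹ * (p.LG * p.R ^ 2) := by
      have := (hU.τ_pos hγ).ne'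
      rw [Params.calR]
      field_simp
    rw [h1, inner_smul_right, ← mul_neg]
    apply mul_le_mul_of_nonneg_left _ (by positivity)
    rw [real_inner_comm]
    -- Outside the ball convexity of G gives a nonnegative inner product; inside, Cauchy–Schwarz
    -- costs at most L_G R². The constant `calR` was defined so that τ·calR is this cost divided by
    -- γ².
    rcases lt_or_ge p.R ‖a.1 - b.1‖ with hR | hR
    · have := hU.G_convex_outside a.1 b.1 hR
      have h2 : 0 ≤ p.LG * p.R ^ 2 := by positivity
      linarith
    · have h2 := (abs_le.1 (abs_real_inner_le_norm D (a.1 - b.1))).1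
      have hR0 := hU.R_nonneg
      have h3 : ‖D‖ * ‖a.1 - b.1‖ ≤ p.LG * p.R ^ 2 := by
        calc ‖D‖ * ‖a.1 - b.1‖ ≤ p.LG * ‖a.1 - b.1‖ * ‖a.1 - b.1‖ := by gcongr
          _ ≤ p.LG * p.R * p.R := by gcongr
          _ = _ := by ring
      linarith
  · rw [hDU, hsD, norm_smul, Real.norm_of_nonneg (by positivity)]
    have h1 : p.α * (p.γ * h) / 2 = p.γ⁻¹ * h * p.L := by
      rw [Params.α]
      field_simp
    rw [h1, mul_assoc (p.γ⁻¹ * h)]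
    exact mul_le_mul_of_nonneg_left (hU.lipschitz_gradient _ _) (by positivity)

end PotentialAssumption

/-! ### Consequences of the step size condition -/

namespace Params.StepCondition

lemma mul_le (hU : PotentialAssumption U p) (hγ : 0 < p.γ) (hs : p.StepCondition h) :
    p.γ * h ≤ 1 / 15 := by
  have h1 := hs.2.2.1
  have hL := hU.L_pos
  have h2 : p.L * p.γ⁻¹ * h = p.L / p.γ ^ 2 * (p.γ * h) := by field_simp
  have h3 : p.L / p.γ ^ 2 / 15 = p.L / p.γ ^ 2 * (1 / 15) := by ring
  rw [h2, h3] at h1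
  exact le_of_mul_le_mul_left h1 (by positivity)

/-- Here Lγ⁻¹h = αs/2, which turns 1/(256 · 75) into 1/9600. -/
lemma α_mul_le (hU : PotentialAssumption U p) (hγ : 0 < p.γ) (hs : p.StepCondition h) :
    p.α * (p.γ * h) * (p.α + 1) ≤ 1 / 9600 := by
  have h1 := hs.2.1
  have hα := hU.α_pos hγ
  have h2 : p.L * p.γ⁻¹ * h = p.α * (p.γ * h) / 2 := by
    rw [Params.α]; field_simp
  have h3 : 2 * p.L / p.γ ^ 2 = p.α := rfl
  rw [h2, h3, le_div_iff₀ (by positivity)] at h1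
  linarith

lemma mul_lam_le (hU : PotentialAssumption U p) (hγ : 0 < p.γ) (hs : p.StepCondition h) :
    p.γ * h * p.lam ≤ 1 / 55 := by
  have h1 := hs.2.2.2
  have hL := hU.L_pos
  have hK := hU.LK_pos
  rw [le_div_iff₀ (by positivity)] at h1
  have h2 : p.L * p.γ⁻¹ * h * (55 * p.LK) = p.L * (55 * (p.γ * h * p.lam)) := by
    rw [Params.lam]; field_simp
  have h3 : p.L * (55 * (p.γ * h * p.lam)) ≤ p.L * 1 := by linarith
  have := le_of_mul_le_mul_left h3 hL
  linarith

/-- Up to distance R₁ the outward drift αs·r in one step is at most half the noise scale σ =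
√(2γ⁻¹h), so it cannot mask an approach by 2σ. -/
lemma mul_R₁_le (hU : PotentialAssumption U p) (hγ : 0 < p.γ) (hh : 0 < h)
    (hs : p.StepCondition h) : p.α * (p.γ * h) * p.R₁ ≤ √(2 * p.γ⁻¹ * h) / 2 := by
  rcases eq_or_ne p.R₁ 0 with h0 | h0
  · rw [h0, mul_zero]; positivity
  have h1 := hs.1 h0
  have hL := hU.L_pos
  have hR := hU.R₁_nonneg hγ
  rw [le_div_iff₀ (by positivity)] at h1
  have h2 : √(2 * p.γ⁻¹ * h) / 2 = √(2 * p.γ⁻¹ * h / 4) := by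
    rw [Real.sqrt_div (by positivity)]
    congr 1
    rw [show (4 : ℝ) = 2 ^ 2 by norm_num, Real.sqrt_sq (by norm_num)]
  rw [h2]
  apply Real.le_sqrt_of_sq_le
  have h3 : (p.α * (p.γ * h) * p.R₁) ^ 2 =
      (p.γ⁻¹ * h / 2) * (p.L * p.γ⁻¹ * h * (8 * p.L * p.R₁ ^ 2)) := by
    rw [Params.α]; field_simp; ring
  rw [h3]
  calc _ ≤ (p.γ⁻¹ * h / 2) * 1 := mul_le_mul_of_nonneg_left h1 (by positivity)
    _ = _ := by ring

end Params.StepCondition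

/-! ### The rate -/

namespace PotentialAssumption

/-- The entries with ĉ can only lower the rate; contraction is established at the level of
`rateMain`. -/
lemma rate_le_rateMain (p : Params d) (h : ℝ) : p.rate h ≤ p.rateMain h := by
  rw [Params.rate]
  split_ifs
  · exact le_rfl
  · exact min_le_left _ _

lemma calE_nonneg (hU : PotentialAssumption U p) (hγ : 0 < p.γ) : 0 ≤ p.calE := by
  have := hU.α_pos hγ
  exact le_min (by positivity) (by norm_num)

/-- The rate in the regime of large distances. -/
lemma rate_mul_le_far (hU : PotentialAssumption U p) (hγ : 0 < p.γ) (hh : 0 < h) :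
    p.rate h * h ≤ p.fd p.R₁ * (p.ε * p.calE) * (7 / 24 * p.τ * (p.γ * h)) := by
  have hε := (hU.ε_pos hγ).le
  have hE := hU.calE_nonneg hγ
  have hf := (hU.fd_pos hγ (hU.R₁_nonneg hγ)).le
  have h0 := rate_le_rateMain p h
  have h1 : p.rate h ≤ _ := h0.trans (min_le_left _ _)
  have h2 : p.rate h ≤ _ := h0.trans ((min_le_right _ _).trans (min_le_left _ _))
  rw [p.deriv_f] at h1 h2
  have hC : 0 ≤ p.fd p.R₁ * (p.ε * p.calE) * (p.γ * h) := by positivity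
  -- The first two entries of the rate match the two values of τ: κ/(4γ²) gives 7/96 exactly, and
  -- 1/8 gives 7/192, which exceeds the required 7/256.
  rcases min_choice (1 / 8 : ℝ) (p.κ / p.γ ^ 2 / 4) with ht | ht
  · rw [Params.τ, ht]
    have := mul_le_mul_of_nonneg_right h2 hh.le
    refine this.trans ?_
    nlinarith
  · rw [Params.τ, ht]
    have := mul_le_mul_of_nonneg_right h1 hh.le
    refine this.trans (le_of_eq ?_)
    field_simp
    ring

/-- The rate in the regime of small distances. -/
lemma rate_mul_le_near (hU : PotentialAssumption U p) (hγ : 0 < p.γ) (hh : 0 < h) :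
    p.rate h * h ≤ p.fd p.R₁ * (p.γ * h) * (1 / 16) ∧
      p.rate h * h ≤ p.fd p.R₁ * (p.γ * h) * (p.α / 4) := by
  have hα := hU.α_pos hγ
  have hf := (hU.fd_pos hγ (hU.R₁_nonneg hγ)).le
  have h0 := rate_le_rateMain p h
  have h1 : p.rate h ≤ _ := h0.trans ((min_le_right _ _).trans ((min_le_right _ _).trans
    (min_le_left _ _)))
  have h2 : p.rate h ≤ _ := h0.trans ((min_le_right _ _).trans ((min_le_right _ _).trans
    (min_le_right _ _)))
  rw [p.deriv_f] at h1 h2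
  have he := exp_neg_mul_le_one hγ hh
  have hfe : p.fd p.R₁ * Real.exp (-p.γ * h) ≤ p.fd p.R₁ := mul_le_of_le_one_right hf he
  constructor
  · have h3 : p.rate h ≤ p.fd p.R₁ * (p.γ / 16) :=
      h1.trans (mul_le_mul_of_nonneg_right hfe (by positivity))
    have := mul_le_mul_of_nonneg_right h3 hh.le
    linarith
  · have h3 : p.rate h ≤ p.fd p.R₁ * (p.γ * p.α / 4) :=
      h2.trans (mul_le_mul_of_nonneg_right hfe (by positivity))
    have := mul_le_mul_of_nonneg_right h3 hh.le
    linarith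

/-! ### Large distances -/

/-- The noise is shared, so r_l contracts for every realisation; taking the square root halves the
rate 7τ/12 of the form. The tangent of f at D_K + ε r_l converts this to f, and the decrease is
compared with ρ through r_l ≥ E r_s ≥ E(D_K + ε r_l) ≥ E f(D_K + ε r_l). -/
lemma ρ_coupledStepBU_le_far (hU : PotentialAssumption U p) (hγ : 0 < p.γ) (hh : 0 < h)
    (hfric : p.FrictionCondition) (hstep : p.StepCondition h) {a b : Phase d}
    (hfar : p.DK + p.ε * p.rl a b ≤ p.rs a b) (n : (Pos d × Pos d) × ℝ) :
    p.ρ (p.coupledStepBU U h (a, b) n).1 (p.coupledStepBU U h (a, b) n).2 ≤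
      (1 - p.rate h * h) * p.ρ a b := by
  obtain ⟨g, hg1, hg2, hg3, -⟩ := hU.exists_kick hγ hfric hh.le a b
  have hs0 : 0 ≤ p.γ * h := by positivity
  have hsn : p.coupledNoise h a b n.1.1 n.2 = n.1.1 := by
    simp only [Params.coupledNoise, if_pos hfar]
  have hτ := hU.τ_pos hγ
  have hτ8 : p.τ ≤ 1 / 8 := min_le_left _ _
  have hτR := hU.calR_le_of_DK_le hγ (a := a) (b := b) (by rw [Params.Δ]; linarith)
  have hstepl : p.rl (p.coupledStepBU U h (a, b) n).1 (p.coupledStepBU U h (a, b) n).2 ≤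
      (1 - 7 / 24 * p.τ * (p.γ * h)) * p.rl a b := by
    obtain ⟨e1, e2⟩ := stepU_sub hγ hh (stepB U h a) (stepB U h b) n.1.1 n.1.1 n.1.2
    rw [sub_self, smul_zero, add_zero, hg1] at e1 e2
    have hc := twistedForm_kick_step_contraction p.τ (1 - Real.exp (-p.γ * h)) (p.γ * h) p.lam p.kap
      p.Ks hU.Ks_symm hU.inner_Ks_le hU.norm_Ks_sq_le hU.le_inner_Ks hτ.le hτ8 (four_τ_le p)
      hU.lam_nonneg hs0 (hstep.mul_le hU hγ) (hstep.mul_lam_le hU hγ)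
      (by rw [neg_mul]; exact sub_sq_div_two_le_one_sub_exp hs0)
      (by rw [neg_mul]; exact one_sub_exp_neg_le _)
      (a.1 - b.1) (p.γ⁻¹ • (a.2 - b.2)) g hg2
      ((neg_le_neg (mul_le_mul_of_nonneg_left hτR hτ.le)).trans hg3)
    have hs15 := hstep.mul_le hU hγ
    have hts : p.τ * (p.γ * h) ≤ 1 / 8 * (1 / 15) := by gcongr
    rw [Params.rl_eq, Params.rl_eq]
    simp only [Params.coupledStepBU, hsn]
    rw [e1, e2]
    apply Real.sqrt_le_iff.2
    refine ⟨mul_nonneg (by linarith) (Real.sqrt_nonneg _), ?_⟩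
    have hT : 0 ≤ twistedForm p.τ p.Ks (a.1 - b.1) (p.γ⁻¹ • (a.2 - b.2)) :=
      twistedForm_nonneg hU.inner_Ks_nonneg _ _
    rw [mul_pow, Real.sq_sqrt hT]
    refine hc.trans (mul_le_mul_of_nonneg_right ?_ hT)
    nlinarith [sq_nonneg (p.τ * (p.γ * h))]
  rw [ρ_eq, ρ_eq, min_eq_right hfar]
  have hε := hU.ε_pos hγ
  have hDK := hU.DK_nonneg hγ
  have hl := p.rl_nonneg a b
  have hl' := p.rl_nonneg (p.coupledStepBU U h (a, b) n).1 (p.coupledStepBU U h (a, b) n).2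
  set l := p.rl a b
  set l' := p.rl (p.coupledStepBU U h (a, b) n).1 (p.coupledStepBU U h (a, b) n).2
  have hx0 : 0 ≤ p.DK + p.ε * l := by positivity
  have hy0 : 0 ≤ p.DK + p.ε * l' := by positivity
  refine (hU.f_mono hγ (hU.min_nonneg' hγ _ _) (min_le_right _ _)).trans ?_
  have htan := hU.f_le_tangent hγ hx0 hy0
  have hfd := hU.fd_R₁_le hγ hx0
  have hself := hU.f_le_self hγ hx0
  have hf0 := hU.f_nonneg hγ hx0
  have hE := hU.calE_rs_le_rl hγ a b
  have hrate := hU.rate_mul_le_far hγ hh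
  have hE0 := hU.calE_nonneg hγ
  have hR := (hU.fd_pos hγ (hU.R₁_nonneg hγ)).le
  have k1 : p.fd (p.DK + p.ε * l) * (p.DK + p.ε * l' - (p.DK + p.ε * l)) ≤
      -(p.fd p.R₁ * p.ε * (7 / 24 * p.τ * (p.γ * h)) * l) := by
    have k2 : p.ε * l' - p.ε * l ≤ -(p.ε * (7 / 24 * p.τ * (p.γ * h)) * l) := by
      have := mul_le_mul_of_nonneg_left hstepl hε.le
      linarith
    have k3 : 0 ≤ p.ε * (7 / 24 * p.τ * (p.γ * h)) * l := by positivity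
    calc _ = p.fd (p.DK + p.ε * l) * (p.ε * l' - p.ε * l) := by ring
      _ ≤ p.fd (p.DK + p.ε * l) * (-(p.ε * (7 / 24 * p.τ * (p.γ * h)) * l)) :=
        mul_le_mul_of_nonneg_left k2 (hR.trans hfd)
      _ ≤ _ := by
        have := mul_le_mul_of_nonneg_right hfd k3
        linarith
  have k4 : p.rate h * h * p.f (p.DK + p.ε * l) ≤
      p.fd p.R₁ * p.ε * (7 / 24 * p.τ * (p.γ * h)) * l := by
    have hB : 0 ≤ p.fd p.R₁ * p.ε * (7 / 24 * p.τ * (p.γ * h)) := by positivity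
    calc _ ≤ p.fd p.R₁ * (p.ε * p.calE) * (7 / 24 * p.τ * (p.γ * h)) * p.f (p.DK + p.ε * l) :=
          mul_le_mul_of_nonneg_right hrate hf0
      _ ≤ p.fd p.R₁ * (p.ε * p.calE) * (7 / 24 * p.τ * (p.γ * h)) * p.rs a b :=
          mul_le_mul_of_nonneg_left (hself.trans hfar) (by positivity)
      _ = p.fd p.R₁ * p.ε * (7 / 24 * p.τ * (p.γ * h)) * (p.calE * p.rs a b) := by ring
      _ ≤ _ := mul_le_mul_of_nonneg_left hE hB
  linarith

end PotentialAssumption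

end KineticLangevin

namespace KineticLangevin

/-! ### The one-dimensional coupling -/

lemma gaussianPDFReal_div (x b : ℝ) :
    gaussianPDFReal 0 1 (x + b) / gaussianPDFReal 0 1 x = Real.exp (-(b * x + b ^ 2 / 2)) := by
  have h : (√(2 * Real.pi))⁻¹ ≠ 0 := by positivity
  simp only [gaussianPDFReal, NNReal.coe_one, mul_one, sub_zero]
  rw [mul_div_mul_left _ _ h, ← Real.exp_sub]
  congr 1
  ring

lemma reflCoupling_cases (b x u : ℝ) :
    reflCoupling b x u = x + b ∨
      (Real.exp (-(b * x + b ^ 2 / 2)) < u ∧ reflCoupling b x u = -x) := by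
  rw [reflCoupling, gaussianPDFReal_div]
  split_ifs with h
  · exact Or.inl rfl
  · exact Or.inr ⟨not_le.1 h, rfl⟩

lemma reflCoupling_of_lt {b x u : ℝ} (h : Real.exp (-(b * x + b ^ 2 / 2)) < u) :
    reflCoupling b x u = -x := by
  rw [reflCoupling, gaussianPDFReal_div, if_neg (not_le.2 h)]

/-- Reflection happens only if the density ratio is below 1, which for b > 0 means x > -b/2. The new
signed separation, b or a positive multiple of x + b/2 apart from the merged case 0, therefore never
becomes negative. -/
lemma reflCoupling_le {b x u : ℝ} (hb : 0 ≤ b) (hu : u ≤ 1) : 0 ≤ b + (x - reflCoupling b x u) := by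
  rcases reflCoupling_cases b x u with h | ⟨h1, h2⟩
  · rw [h]; linarith
  · rw [h2]
    have h3 := h1.trans_le hu
    rw [Real.exp_lt_one_iff] at h3
    have h4 : 0 < b * (x + b / 2) := by nlinarith
    have h5 : 0 < x + b / 2 := pos_of_mul_pos_right h4 hb
    linarith

lemma map_reflCoupling (b : ℝ) :
    ((gaussianReal 0 1).prod unif).map (fun y => reflCoupling b y.1 y.2) = gaussianReal 0 1 := by
  apply Measure.ext_of_lintegral
  intro g hg
  have hm := measurable_reflCoupling b
  have hgm : Measurable fun y : ℝ × ℝ => g (reflCoupling b y.1 y.2) := hg.comp hm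
  rw [lintegral_map hg hm, lintegral_prod _ hgm.aemeasurable]
  exact lintegral_reflCoupling b hg

lemma integrable_id_gaussianReal : Integrable (fun x : ℝ => x) (gaussianReal 0 1) :=
  memLp_one_iff_integrable.1 (memLp_id_gaussianReal 1)

lemma integrable_sub_reflCoupling (b : ℝ) :
    Integrable (fun y : ℝ × ℝ => y.1 - reflCoupling b y.1 y.2) ((gaussianReal 0 1).prod unif) := by
  refine integrable_id_gaussianReal.comp_fst unif |>.sub ?_
  have h := integrable_id_gaussianReal
  rw [← map_reflCoupling b] at h
  exact h.comp_measurable (measurable_reflCoupling b)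

/-- Both copies of the noise are standard normal, so their difference has mean zero whatever the
coupling. -/
lemma integral_sub_reflCoupling (b : ℝ) :
    ∫ y, (y.1 - reflCoupling b y.1 y.2) ∂((gaussianReal 0 1).prod unif) = 0 := by
  have hm := measurable_reflCoupling b
  have h := integrable_id_gaussianReal
  have h2 : Integrable (fun y : ℝ × ℝ => reflCoupling b y.1 y.2) ((gaussianReal 0 1).prod unif) := by
    rw [← map_reflCoupling b] at h
    exact h.comp_measurable (measurable_reflCoupling b)
  rw [integral_sub (h.comp_fst unif) h2]
  have h3 : ∫ y, reflCoupling b y.1 y.2 ∂((gaussianReal 0 1).prod unif) = 0 := by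
    have := integral_map (μ := (gaussianReal 0 1).prod unif) hm.aemeasurable
      (f := fun x : ℝ => x) (by fun_prop)
    rw [map_reflCoupling, integral_id_gaussianReal] at this
    exact this.symm
  have h4 : ∫ y : ℝ × ℝ, y.1 ∂((gaussianReal 0 1).prod unif) = 0 := by
    have := integral_fun_fst (μ := gaussianReal 0 1) (ν := unif) (f := fun x : ℝ => x)
    rw [this, integral_id_gaussianReal]
    simp
  rw [h3, h4, sub_zero]

lemma gaussianPDFReal_two_le : (1 / 20 : ℝ) ≤ gaussianPDFReal 0 1 2 := by
  have hpi : √(2 * Real.pi) ≤ 2.51 := by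
    apply Real.sqrt_le_iff.2
    have := Real.pi_lt_d2
    constructor
    · norm_num
    · linarith
  have he : Real.exp 2 ≤ 7.39 := by
    have h1 := Real.exp_one_lt_d9
    have h2 : Real.exp 2 = Real.exp 1 * Real.exp 1 := by rw [← Real.exp_add]; norm_num
    rw [h2]
    nlinarith [Real.exp_pos 1]
  have h0 : 0 < √(2 * Real.pi) := by positivity
  have h1 : gaussianPDFReal 0 1 2 = 1 / (√(2 * Real.pi) * Real.exp 2) := by
    simp only [gaussianPDFReal, NNReal.coe_one, mul_one, sub_zero]
    rw [show (-2 ^ 2 / 2 : ℝ) = -2 by norm_num, Real.exp_neg, one_div, mul_inv]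
  rw [h1]
  apply one_div_le_one_div_of_le (by positivity)
  calc √(2 * Real.pi) * Real.exp 2 ≤ 2.51 * 7.39 := by gcongr
    _ ≤ 20 := by norm_num

lemma gaussianPDFReal_two_le_of_abs_le {x : ℝ} (hx : |x| ≤ 2) :
    gaussianPDFReal 0 1 2 ≤ gaussianPDFReal 0 1 x := by
  simp only [gaussianPDFReal, NNReal.coe_one, mul_one, sub_zero]
  apply mul_le_mul_of_nonneg_left _ (by positivity)
  apply Real.exp_le_exp.2
  have := sq_le_sq' (by linarith [abs_le.1 hx]) (abs_le.1 hx).2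
  linarith

/-- Write the density as its value at 2 times exp((4 - x²)/2) and bound the exponential by its
tangent. The resulting cubic satisfies x(1 + (4 - x²)/2) ≥ 2 on [1, 2], with equality at 2. -/
lemma one_div_ten_le_mul_gaussianPDFReal {x : ℝ} (h1 : 1 ≤ x) (h2 : x ≤ 2) :
    (1 / 10 : ℝ) ≤ x * gaussianPDFReal 0 1 x := by
  have h3 := gaussianPDFReal_two_le
  have h4 : gaussianPDFReal 0 1 2 * (1 + (4 - x ^ 2) / 2) ≤ gaussianPDFReal 0 1 x := by
    simp only [gaussianPDFReal, NNReal.coe_one, mul_one, sub_zero]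
    rw [mul_assoc]
    apply mul_le_mul_of_nonneg_left _ (by positivity)
    have h5 : Real.exp (-x ^ 2 / 2) = Real.exp (-2 ^ 2 / 2) * Real.exp ((4 - x ^ 2) / 2) := by
      rw [← Real.exp_add]; congr 1; ring
    rw [h5]
    apply mul_le_mul_of_nonneg_left _ (Real.exp_pos _).le
    have := Real.add_one_le_exp ((4 - x ^ 2) / 2)
    linarith
  have h6 : 2 ≤ x * (1 + (4 - x ^ 2) / 2) := by
    nlinarith [mul_nonneg (sub_nonneg.2 h2) (by nlinarith : 0 ≤ x ^ 2 + 2 * x - 2)]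
  calc (1 / 10 : ℝ) ≤ 2 * gaussianPDFReal 0 1 2 := by linarith
    _ ≤ x * (1 + (4 - x ^ 2) / 2) * gaussianPDFReal 0 1 2 := by gcongr
    _ = x * (gaussianPDFReal 0 1 2 * (1 + (4 - x ^ 2) / 2)) := by ring
    _ ≤ _ := by gcongr

/-- The event `-2 ≤ x ≤ -1`, on which the two copies move away from large separation. -/
lemma one_div_twenty_le_integral_indicator :
    (1 / 20 : ℝ) ≤
      ∫ y, (Icc (-2 : ℝ) (-1)).indicator (fun _ => (1 : ℝ)) y.1 ∂((gaussianReal 0 1).prod unif) := by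
  rw [integral_fun_fst (μ := gaussianReal 0 1) (ν := unif)
    (f := (Icc (-2 : ℝ) (-1)).indicator fun _ => (1 : ℝ)), probReal_univ, one_smul,
    integral_gaussianReal_eq_integral_smul one_ne_zero]
  have h1 : (fun x => gaussianPDFReal 0 1 x • (Icc (-2 : ℝ) (-1)).indicator (fun _ => (1 : ℝ)) x) =
      (Icc (-2 : ℝ) (-1)).indicator (gaussianPDFReal 0 1) := by
    ext x
    by_cases hx : x ∈ Icc (-2 : ℝ) (-1) <;> simp [hx]
  rw [h1, integral_indicator measurableSet_Icc]
  have h2 := setIntegral_mono_on (μ := volume) (s := Icc (-2 : ℝ) (-1)) (f := fun _ => (1 / 20 : ℝ))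
    (g := gaussianPDFReal 0 1) (by simp) (integrable_gaussianPDFReal 0 1).integrableOn
    measurableSet_Icc (fun x hx => gaussianPDFReal_two_le.trans
      (gaussianPDFReal_two_le_of_abs_le (abs_le.2 ⟨hx.1, by linarith [hx.2]⟩)))
  refine le_trans ?_ h2
  simp
  norm_num

/-- `x` on the event that `1 ≤ x ≤ 2` and the coupling reflects. -/
noncomputable def reflGain (b : ℝ) (y : ℝ × ℝ) : ℝ :=
  if (1 ≤ y.1 ∧ y.1 ≤ 2) ∧ Real.exp (-(b * y.1 + b ^ 2 / 2)) < y.2 then y.1 else 0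

lemma measurable_reflGain (b : ℝ) : Measurable (reflGain b) := by
  unfold reflGain
  refine Measurable.ite ?_ (by fun_prop) (by fun_prop)
  have h1 : MeasurableSet {y : ℝ × ℝ | 1 ≤ y.1} := measurableSet_le (by fun_prop) (by fun_prop)
  have h2 : MeasurableSet {y : ℝ × ℝ | y.1 ≤ 2} := measurableSet_le (by fun_prop) (by fun_prop)
  have h3 : MeasurableSet {y : ℝ × ℝ | Real.exp (-(b * y.1 + b ^ 2 / 2)) < y.2} :=
    measurableSet_lt (by fun_prop) (by fun_prop)
  exact (h1.inter h2).inter h3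

lemma integrable_reflGain (b : ℝ) : Integrable (reflGain b) ((gaussianReal 0 1).prod unif) := by
  refine Integrable.of_bound (measurable_reflGain b).aestronglyMeasurable 2 (ae_of_all _ fun y => ?_)
  rw [reflGain]
  split_ifs with h
  · rw [Real.norm_of_nonneg (by linarith [h.1.1])]
    exact h.1.2
  · simp

/-- Given x in [1, 2], reflection has probability at least 1 - e^{-b} ≥ b/3, where b ≤ 2 is needed;
the weight x times the normal density is at least 1/10 there. -/
lemma le_integral_reflGain {b : ℝ} (hb : 0 ≤ b) (hb2 : b ≤ 2) :
    b / 30 ≤ ∫ y, reflGain b y ∂((gaussianReal 0 1).prod unif) := by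
  rw [integral_prod _ (integrable_reflGain b), integral_gaussianReal_eq_integral_smul one_ne_zero]
  have hin : ∀ x, ∫ u, reflGain b (x, u) ∂unif =
      (Icc (1 : ℝ) 2).indicator (fun x => x * (1 - Real.exp (-(b * x + b ^ 2 / 2)))) x := by
    intro x
    by_cases hx : x ∈ Icc (1 : ℝ) 2
    · have hE : Real.exp (-(b * x + b ^ 2 / 2)) ≤ 1 := by
        apply Real.exp_le_one_iff.2
        have := mul_nonneg hb (by linarith [hx.1] : 0 ≤ x)
        nlinarith
      have hE0 := Real.exp_pos (-(b * x + b ^ 2 / 2))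
      have hfun : (fun u => reflGain b (x, u)) =
          (Ioi (Real.exp (-(b * x + b ^ 2 / 2)))).indicator fun _ => x := by
        ext u
        have hx1 : (1 ≤ x ∧ x ≤ 2) := hx
        simp [reflGain, hx1, indicator_apply]
      rw [hfun, integral_indicator measurableSet_Ioi, indicator_of_mem hx, unif,
        Measure.restrict_restrict measurableSet_Ioi, setIntegral_const]
      have : Ioi (Real.exp (-(b * x + b ^ 2 / 2))) ∩ Icc 0 1 =
          Ioc (Real.exp (-(b * x + b ^ 2 / 2))) 1 := by
        ext u
        simp only [mem_inter_iff, mem_Ioi, mem_Icc, mem_Ioc]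
        constructor
        · rintro ⟨h1, h2, h3⟩; exact ⟨h1, h3⟩
        · rintro ⟨h1, h2⟩; exact ⟨h1, by linarith, h2⟩
      rw [this, Real.volume_real_Ioc_of_le hE, smul_eq_mul, mul_comm]
    · have hx1 : ¬(1 ≤ x ∧ x ≤ 2) := hx
      rw [indicator_of_notMem hx]
      simp [reflGain, hx1]
  simp_rw [hin]
  have hfun : (fun x => gaussianPDFReal 0 1 x •
      (Icc (1 : ℝ) 2).indicator (fun x => x * (1 - Real.exp (-(b * x + b ^ 2 / 2)))) x) =
      (Icc (1 : ℝ) 2).indicator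
        fun x => x * gaussianPDFReal 0 1 x * (1 - Real.exp (-(b * x + b ^ 2 / 2))) := by
    ext x
    by_cases hx : x ∈ Icc (1 : ℝ) 2
    · simp only [indicator_of_mem hx, smul_eq_mul]; ring
    · simp [indicator_of_notMem hx]
  rw [hfun, integral_indicator measurableSet_Icc]
  have hexp : b / 3 ≤ 1 - Real.exp (-b) := by
    have h1 : Real.exp (-b) ≤ 1 / (1 + b) := by
      rw [Real.exp_neg, one_div]
      apply inv_anti₀ (by positivity)
      have := Real.add_one_le_exp b
      linarith
    have h2 : 1 / (1 + b) ≤ 1 - b / 3 := by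
      rw [div_le_iff₀ (by positivity)]
      nlinarith
    linarith
  have hcont : ContinuousOn
      (fun x => x * gaussianPDFReal 0 1 x * (1 - Real.exp (-(b * x + b ^ 2 / 2)))) (Icc 1 2) := by
    simp only [gaussianPDFReal]
    fun_prop
  have h2 := setIntegral_mono_on (μ := volume) (s := Icc (1 : ℝ) 2) (f := fun _ => (b / 30 : ℝ))
    (g := fun x => x * gaussianPDFReal 0 1 x * (1 - Real.exp (-(b * x + b ^ 2 / 2)))) (by simp)
    (hcont.integrableOn_compact isCompact_Icc) measurableSet_Icc (fun x hx => by
      have k1 := one_div_ten_le_mul_gaussianPDFReal hx.1 hx.2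
      have k2 : Real.exp (-(b * x + b ^ 2 / 2)) ≤ Real.exp (-b) := by
        apply Real.exp_le_exp.2
        nlinarith [mul_le_mul_of_nonneg_left hx.1 hb]
      calc b / 30 = 1 / 10 * (b / 3) := by ring
        _ ≤ x * gaussianPDFReal 0 1 x * (1 - Real.exp (-(b * x + b ^ 2 / 2))) := by
          apply mul_le_mul k1 (by linarith) (by positivity) (by linarith))
  refine le_trans ?_ h2
  simp
  norm_num

/-! ### Integrating a pathwise bound -/

section

variable {d : ℕ}

lemma map_inner_prod {e : Pos d} (he : ‖e‖ = 1) :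
    ((noise₂ d).prod unif).map (fun n => ((inner ℝ e n.1.1 : ℝ), n.2)) =
      (gaussianReal 0 1).prod unif := by
  have hm1 : Measurable fun ξ : Pos d × Pos d => (inner ℝ e ξ.1 : ℝ) := by fun_prop
  have h1 : (noise₂ d).map (fun ξ => (inner ℝ e ξ.1 : ℝ)) = gaussianReal 0 1 := by
    have hm2 : Measurable fun ξ : Pos d => (inner ℝ e ξ : ℝ) := by fun_prop
    rw [← map_inner_stdGaussian he, noise₂]
    conv_rhs => rw [← Measure.fst_prod (μ := stdGaussian (Pos d)) (ν := stdGaussian (Pos d))]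
    rw [Measure.fst, Measure.map_map hm2 measurable_fst]
    rfl
  have h2 := Measure.map_prod_map (noise₂ d) unif hm1 measurable_id
  rw [h1, Measure.map_id] at h2
  exact h2.symm

/-- The term with `c₁` has mean zero, so only the constant and the gain G survive. Everything
depends on the noise through e·ξ₁ and u, which reduces the expectation to the one-dimensional
coupling. -/
lemma lintegral_ofReal_le_of_pathwise {F : (Pos d × Pos d) × ℝ → ℝ} (hF : Measurable F)
    (hF0 : ∀ n, 0 ≤ F n) {e : Pos d} (he : ‖e‖ = 1) (b c₀ c₁ g : ℝ) {G : ℝ × ℝ → ℝ}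
    (hG : Integrable G ((gaussianReal 0 1).prod unif))
    (hg : g ≤ ∫ y, G y ∂((gaussianReal 0 1).prod unif))
    (hle : ∀ n : (Pos d × Pos d) × ℝ, n.2 ≤ 1 → F n ≤
      c₀ + c₁ * (inner ℝ e n.1.1 - reflCoupling b (inner ℝ e n.1.1) n.2) -
        G (inner ℝ e n.1.1, n.2)) :
    ∫⁻ n, ENNReal.ofReal (F n) ∂((noise₂ d).prod unif) ≤ ENNReal.ofReal (c₀ - g) := by
  set T : (Pos d × Pos d) × ℝ → ℝ × ℝ := fun n => (inner ℝ e n.1.1, n.2) with hT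
  have hTm : Measurable T := by fun_prop
  have hmap : ((noise₂ d).prod unif).map T = (gaussianReal 0 1).prod unif := map_inner_prod he
  set H : ℝ × ℝ → ℝ := fun y => c₀ + c₁ * (y.1 - reflCoupling b y.1 y.2) - G y with hH
  have hHi : Integrable H ((gaussianReal 0 1).prod unif) :=
    ((integrable_const c₀).add ((integrable_sub_reflCoupling b).const_mul c₁)).sub hG
  have hi1 : Integrable (fun y : ℝ × ℝ => c₁ * (y.1 - reflCoupling b y.1 y.2))
      ((gaussianReal 0 1).prod unif) := (integrable_sub_reflCoupling b).const_mul c₁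
  have hi2 : Integrable (fun y : ℝ × ℝ => c₀ + c₁ * (y.1 - reflCoupling b y.1 y.2))
      ((gaussianReal 0 1).prod unif) := (integrable_const c₀).add hi1
  have hHint : ∫ y, H y ∂((gaussianReal 0 1).prod unif) ≤ c₀ - g := by
    rw [integral_sub hi2 hG, integral_add (integrable_const c₀) hi1,
      integral_const_mul, integral_sub_reflCoupling, mul_zero, add_zero, integral_const,
      probReal_univ, one_smul]
    linarith
  have hHT : Integrable (fun n => H (T n)) ((noise₂ d).prod unif) := by
    rw [← hmap] at hHi
    exact hHi.comp_measurable hTm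
  have hae : ∀ᵐ n ∂((noise₂ d).prod unif), F n ≤ H (T n) := by
    have h1 : ∀ᵐ n ∂((noise₂ d).prod unif), n.2 ∈ Icc (0 : ℝ) 1 :=
      Measure.quasiMeasurePreserving_snd.ae unif_ae_mem
    filter_upwards [h1] with n hn
    exact hle n hn.2
  have hFi : Integrable F ((noise₂ d).prod unif) := by
    refine hHT.mono' hF.aestronglyMeasurable ?_
    filter_upwards [hae] with n hn
    rwa [Real.norm_of_nonneg (hF0 n)]
  rw [← ofReal_integral_eq_lintegral_ofReal hFi (ae_of_all _ hF0)]
  apply ENNReal.ofReal_le_ofReal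
  calc ∫ n, F n ∂((noise₂ d).prod unif) ≤ ∫ n, H (T n) ∂((noise₂ d).prod unif) :=
        integral_mono_ae hFi hHT hae
    _ = ∫ y, H y ∂((gaussianReal 0 1).prod unif) := by
        rw [← hmap] at hHi ⊢
        exact (integral_map hTm.aemeasurable hHi.aestronglyMeasurable).symm
    _ ≤ _ := hHint

end

end KineticLangevin

namespace KineticLangevin

variable {d : ℕ} {U : Pos d → ℝ} {p : Params d} {h : ℝ}

namespace PotentialAssumption

/-! ### Growth of the distances in one coupled step -/

/-- With W = σ(ξ - ξ') and kick k, q becomes q + W - k and z becomes (1 - δ)z + (δ - θ)q + θ(q + W)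
- δk. Keeping |q + W| intact retains the noise increment exactly. For r_l a crude bound on the
increment by the triangle inequality is enough. -/
lemma exists_step_bounds (hU : PotentialAssumption U p) (hγ : 0 < p.γ) (hh : 0 < h)
    (hfric : p.FrictionCondition) (hstep : p.StepCondition h) (a b : Phase d) :
    ∃ m : ℝ, 1 ≤ m ∧ ∀ ξ ξ' ζ : Pos d,
      p.rs (stepU p.γ h (stepB U h a) (ξ, ζ)) (stepU p.γ h (stepB U h b) (ξ', ζ)) ≤
        p.rs a b - 0.46 * (p.α * (p.γ * h)) * ‖a.1 - b.1‖ + p.α * (p.γ * h) * ‖p.q a b‖ +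
          m * (‖p.q a b + √(2 * p.γ⁻¹ * h) • (ξ - ξ')‖ - ‖p.q a b‖) ∧
      p.ε * p.rl (stepU p.γ h (stepB U h a) (ξ, ζ)) (stepU p.γ h (stepB U h b) (ξ', ζ)) ≤
        p.ε * p.rl a b + p.α * (p.γ * h) * (‖a.1 - b.1‖ + ‖p.q a b‖ +
          1 / 2 * ‖p.q a b + √(2 * p.γ⁻¹ * h) • (ξ - ξ')‖) +
          1 / 2 * ‖√(2 * p.γ⁻¹ * h) • (ξ - ξ')‖ := by
  obtain ⟨g, hg1, -, -, hk⟩ := hU.exists_kick hγ hfric hh.le a b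
  set k := (p.γ * h) • (p.Ks (a.1 - b.1) + g) with hkdef
  have hs0 : 0 < p.γ * h := by positivity
  have hs15 := hstep.mul_le hU hγ
  have hαs := hstep.α_mul_le hU hγ
  have hα := hU.α_pos hγ
  have hδ1 : p.γ * h - (p.γ * h) ^ 2 / 2 ≤ 1 - Real.exp (-p.γ * h) := by
    rw [neg_mul]; exact sub_sq_div_two_le_one_sub_exp hs0.le
  have hδ2 : 1 - Real.exp (-p.γ * h) ≤ p.γ * h := by
    rw [neg_mul]; exact one_sub_exp_neg_le _
  have hstepU := fun ξ ξ' ζ => stepU_sub hγ hh (stepB U h a) (stepB U h b) ξ ξ' ζ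
  simp only [hg1] at hstepU
  have hB : ∀ c : Phase d, (stepB U h c).1 = c.1 := fun _ => rfl
  simp only [hB] at hstepU
  set δ := 1 - Real.exp (-p.γ * h) with hδ
  set s := p.γ * h with hs
  set σ := √(2 * p.γ⁻¹ * h) with hσ
  -- θ is the share of the noise difference that enters the position; the share 1 - θ enters the
  -- velocity.
  set θ := 1 - δ / s with hθ
  have hδs : δ / s = 1 - θ := by rw [hθ]; ring
  have hθ0 : 0 ≤ θ := by
    rw [hθ, sub_nonneg]
    exact (div_le_one hs0).2 hδ2
  have hθ1 : θ ≤ s / 2 := by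
    have : 1 - s / 2 ≤ δ / s := by
      rw [le_div_iff₀ hs0]
      linarith
    rw [hθ]; linarith
  have hδ3 : 29 / 30 * s ≤ δ := by nlinarith
  have hθδ : 0 ≤ δ - θ := by linarith
  have hδ0 : 0 ≤ δ := by linarith
  have hδ4 : 0 ≤ 1 - δ := by linarith
  set Z := a.1 - b.1 with hZ
  have hqdef : p.q a b = Z + p.γ⁻¹ • (a.2 - b.2) := rfl
  have hrs : p.rs a b = p.α * ‖Z‖ + ‖p.q a b‖ := rfl
  set q := p.q a b with hq
  have hx : p.α * s ≤ 1 / 9600 := by nlinarith [mul_pos hα hs0]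
  -- |q + W| enters r_s with weight 1 through q and αθ through z. The constant 0.46 is what remains
  -- of the flight's 29/30 after the kick's 1/2 and a small correction.
  refine ⟨1 + p.α * θ, by nlinarith, fun ξ ξ' ζ => ?_⟩
  obtain ⟨e1, e2⟩ := hstepU ξ ξ' ζ
  set a' := stepU p.γ h (stepB U h a) (ξ, ζ)
  set b' := stepU p.γ h (stepB U h b) (ξ', ζ)
  set W := σ • (ξ - ξ') with hW
  have hu : p.γ⁻¹ • (a.2 - b.2) = q - Z := by rw [hqdef]; abel
  have f1 : a'.1 - b'.1 = (1 - δ) • Z + (δ - θ) • q + θ • (q + W) - δ • k := by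
    rw [e1, hu, hW]
    module
  have f2 : p.γ⁻¹ • (a'.2 - b'.2) = (1 - δ) • (q - Z - k) + (1 - θ) • W := by
    rw [e2, hu, hδs, hW]
    module
  have f3 : p.q a' b' = (q + W) - k := by
    rw [Params.q, f1, f2]
    module
  have n0 : ‖δ • k‖ ≤ s * (p.α * s / 2 * ‖Z‖) := by
    rw [norm_smul, Real.norm_of_nonneg hδ0]
    exact mul_le_mul hδ2 hk (norm_nonneg _) hs0.le
  have n1 : ‖(1 - δ) • Z‖ = (1 - δ) * ‖Z‖ := by rw [norm_smul, Real.norm_of_nonneg hδ4]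
  have n2 : ‖(δ - θ) • q‖ = (δ - θ) * ‖q‖ := by rw [norm_smul, Real.norm_of_nonneg hθδ]
  have n3 : ‖θ • (q + W)‖ = θ * ‖q + W‖ := by rw [norm_smul, Real.norm_of_nonneg hθ0]
  have n4 : ‖δ • Z‖ = δ * ‖Z‖ := by rw [norm_smul, Real.norm_of_nonneg hδ0]
  have hZ0 := norm_nonneg Z
  have hq0 := norm_nonneg q
  have hH0 := norm_nonneg (q + W)
  have hαsZ : 0 ≤ p.α * s * ‖Z‖ := by positivity
  have hsk : s * (p.α * s / 2 * ‖Z‖) ≤ 1 / 15 * (p.α * s / 2 * ‖Z‖) :=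
    mul_le_mul_of_nonneg_right hs15 (by positivity)
  have hαsk : p.α * (s * (p.α * s / 2 * ‖Z‖)) ≤ 1 / 9600 * (p.α * s / 2 * ‖Z‖) := by
    rw [← mul_assoc]
    exact mul_le_mul_of_nonneg_right hx (by positivity)
  constructor
  · rw [hrs, Params.rs, f1, f3]
    have k1 : ‖(1 - δ) • Z + (δ - θ) • q + θ • (q + W) - δ • k‖ ≤
        (1 - δ) * ‖Z‖ + (δ - θ) * ‖q‖ + θ * ‖q + W‖ + s * (p.α * s / 2 * ‖Z‖) := by
      refine (norm_sub_le _ _).trans (add_le_add ?_ n0)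
      refine (norm_add_le _ _).trans (add_le_add ?_ n3.le)
      exact (norm_add_le _ _).trans (add_le_add n1.le n2.le)
    have k2 : ‖q + W - k‖ ≤ ‖q + W‖ + p.α * s / 2 * ‖Z‖ :=
      (norm_sub_le _ _).trans (add_le_add le_rfl hk)
    have k3 := mul_le_mul_of_nonneg_left k1 hα.le
    have k4 : p.α * (29 / 30 * s) * ‖Z‖ ≤ p.α * δ * ‖Z‖ := by gcongr
    have k5 : p.α * δ * ‖q‖ ≤ p.α * s * ‖q‖ := by gcongr
    clear * - k2 k3 k4 k5 hαsk hαsZ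
    linarith
  · have hMink := sqrt_twistedForm_add_le (τ := p.τ) hU.Ks_symm hU.inner_Ks_nonneg Z
      (a'.1 - b'.1 - Z) (p.γ⁻¹ • (a.2 - b.2)) (p.γ⁻¹ • (a'.2 - b'.2) - p.γ⁻¹ • (a.2 - b.2))
    rw [add_sub_cancel, add_sub_cancel, ← p.rl_eq, ← p.rl_eq] at hMink
    have hup := sqrt_twistedForm_le (τ := p.τ) hU.inner_Ks_le hU.lam_nonneg (hU.τ_pos hγ).le
      (min_le_left _ _) (a'.1 - b'.1 - Z) (p.γ⁻¹ • (a'.2 - b'.2) - p.γ⁻¹ • (a.2 - b.2))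
    have g1 : a'.1 - b'.1 - Z = (δ - θ) • q + θ • (q + W) - δ • Z - δ • k := by
      rw [f1]; module
    have g2 : a'.1 - b'.1 - Z + (p.γ⁻¹ • (a'.2 - b'.2) - p.γ⁻¹ • (a.2 - b.2)) = W - k := by
      rw [f1, f2, hu]; module
    rw [g2] at hup
    have k1 : ‖a'.1 - b'.1 - Z‖ ≤
        (δ - θ) * ‖q‖ + θ * ‖q + W‖ + δ * ‖Z‖ + s * (p.α * s / 2 * ‖Z‖) := by
      rw [g1]
      refine (norm_sub_le _ _).trans (add_le_add ?_ n0)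
      refine (norm_sub_le _ _).trans (add_le_add ?_ n4.le)
      exact (norm_add_le _ _).trans (add_le_add n2.le n3.le)
    have k2 : ‖W - k‖ ≤ ‖W‖ + p.α * s / 2 * ‖Z‖ :=
      (norm_sub_le _ _).trans (add_le_add le_rfl hk)
    have hε := (hU.ε_pos hγ).le
    have l1 := hU.ε_mul_sqrt_lam_le hγ
    have l2 := p.ε_le_half
    have l3 := p.ε_le_half_α
    have k3 := mul_le_mul_of_nonneg_left (hMink.trans (add_le_add le_rfl hup)) hε
    set N := ‖a'.1 - b'.1 - Z‖
    have hN0 : 0 ≤ N := norm_nonneg _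
    have k4 : p.ε * √p.lam * N ≤ p.α / 3 * N := mul_le_mul_of_nonneg_right l1 hN0
    have k5 : p.ε * N ≤ 1 / 2 * p.α * N := mul_le_mul_of_nonneg_right l3 hN0
    have k6 : p.ε * ‖W - k‖ ≤ 1 / 2 * ‖W - k‖ := mul_le_mul_of_nonneg_right l2 (norm_nonneg _)
    have k7 := mul_le_mul_of_nonneg_left k1 hα.le
    have k8 : p.α * (δ - θ) * ‖q‖ ≤ p.α * s * ‖q‖ := by
      gcongr
      linarith
    have k9 : p.α * θ * ‖q + W‖ ≤ p.α * (s / 2) * ‖q + W‖ := by gcongr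
    have k10 : p.α * δ * ‖Z‖ ≤ p.α * s * ‖Z‖ := by gcongr
    have k11 : 0 ≤ p.α * s * ‖q‖ := by positivity
    have k12 : 0 ≤ p.α * s * ‖q + W‖ := by positivity
    clear * - k2 k3 k4 k5 k6 k7 k8 k9 k10 k11 k12 hαsk hαsZ
    linarith

/-! ### Gain from the concavity of `f` -/

/-- Gain when the two copies approach each other by at least `2σ`. -/
lemma f_le_of_approach (hU : PotentialAssumption U p) (hγ : 0 < p.γ) {σ x r Q r' A Y : ℝ}
    (hσ : 0 < σ) (hσx : p.α * p.γ ^ 2 * σ ^ 2 = 2 * x) (hQr : Q ≤ r) (hrR : r ≤ p.R₁)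
    (hQσ : 2 * σ ≤ Q) (hr' : 0 ≤ r') (hA : A ≤ σ / 2) (hY : Y ≤ -2 * σ) (hle : r' ≤ r + A + Y) :
    p.f r' ≤ p.f r + p.fd r * (A + Y) - 96 * (x * Q) * p.fd r := by
  have hα := hU.α_pos hγ
  have h0 : 0 ≤ r - σ := by linarith
  have h0r : 0 ≤ r := by linarith
  -- The two tangents, at r - σ and at r, replace the single one: below r - σ the slope is larger by
  -- the factor 1 + t, and r' lies at least σ/2 below r - σ.
  have t1 := hU.f_le_tangent hγ h0 hr'
  have t2 := hU.f_le_tangent hγ h0r h0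
  have hfd := (hU.fd_pos hγ h0r).le
  have hexp := hU.fd_le_mul_exp hγ h0 (by linarith : r - σ ≤ r)
  rw [min_eq_left hrR, min_eq_left (by linarith : r - σ ≤ p.R₁)] at hexp
  set t := 64 * p.α * p.γ ^ 2 * (r ^ 2 - (r - σ) ^ 2) with ht
  have hfd2 : p.fd r * (1 + t) ≤ p.fd (r - σ) := by
    have h1 : 1 + t ≤ Real.exp t := by linarith [Real.add_one_le_exp t]
    calc p.fd r * (1 + t) ≤ p.fd r * Real.exp t := mul_le_mul_of_nonneg_left h1 hfd
      _ ≤ p.fd (r - σ) * Real.exp (-t) * Real.exp t :=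
        mul_le_mul_of_nonneg_right hexp (Real.exp_pos _).le
      _ = p.fd (r - σ) := by rw [mul_assoc, ← Real.exp_add]; simp
  have ht2 : 192 * (x * Q) ≤ t * σ := by
    have h1 : t * σ = 64 * (p.α * p.γ ^ 2 * σ ^ 2) * (2 * r - σ) := by rw [ht]; ring
    rw [h1, hσx]
    have hx : 0 ≤ x := by
      have : 0 ≤ p.α * p.γ ^ 2 * σ ^ 2 := by positivity
      linarith
    have := mul_le_mul_of_nonneg_left (by linarith : 3 / 2 * Q ≤ 2 * r - σ) hx
    linarith
  have h3 : p.fd (r - σ) * (r' - (r - σ)) ≤ p.fd (r - σ) * (A + Y + σ) :=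
    mul_le_mul_of_nonneg_left (by linarith) (hU.fd_pos hγ h0).le
  have h4 : (p.fd (r - σ) - p.fd r) * (A + Y + σ) ≤ (p.fd (r - σ) - p.fd r) * (-(σ / 2)) := by
    apply mul_le_mul_of_nonneg_left (by linarith)
    have := hU.fd_antitone hγ h0 (by linarith : r - σ ≤ r)
    linarith
  have h5 : p.fd r * t * (σ / 2) ≤ (p.fd (r - σ) - p.fd r) * (σ / 2) :=
    mul_le_mul_of_nonneg_right (by linarith) (by positivity)
  have h6 := mul_le_mul_of_nonneg_left ht2 hfd
  clear * - t1 t2 h3 h4 h5 h6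
  linarith

/-- Gain when the two copies move apart by reflection. -/
lemma f_le_of_reflect (hU : PotentialAssumption U p) (hγ : 0 < p.γ)
    {σ x r Q z l r' l' A X Y : ℝ}
    (hσ : 0 < σ) (hσx : p.α * p.γ ^ 2 * σ ^ 2 = 2 * x) (hx : x ≤ 1 / 9600) (hr : 0 < r)
    (hrR : r ≤ p.R₁) (hQσ : Q ≤ 2 * σ) (hz : z ≤ 4 * Q) (hX : 1 ≤ X) (hl : 0 ≤ l)
    (hDK : p.DK * r ≤ p.R₁ * (r - l)) (hm0 : 0 ≤ min r' l') (hA : 0 ≤ A) (hY : 2 * σ * X ≤ Y)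
    (hle : r' ≤ r + A + Y)
    (hl' : l' ≤ p.DK + l + x * (z + Q + 1 / 2 * (Q + 2 * σ * X)) + 1 / 2 * (2 * σ * X)) :
    p.f (min r' l') ≤ p.f r + p.fd r * (A + Y) - 46 * (x * σ) * p.fd r * X := by
  have hα := hU.α_pos hγ
  have hfd := (hU.fd_pos hγ hr.le).le
  have hx0 : 0 ≤ x := by
    have : 0 ≤ p.α * p.γ ^ 2 * σ ^ 2 := by positivity
    linarith
  have hσX : σ ≤ σ * X := le_mul_of_one_le_right hσ.le hX
  -- With room for σ/2 below R₁, the slope has dropped at r + σ/2 while r_s may overshoot further;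
  -- 31 · 3/2 exceeds 46. Otherwise r is within σ/2 of R₁ ≥ D_K + l, and the second entry of the
  -- minimum is smaller, because it receives only half of the noise increment.
  rcases le_or_gt (r + σ / 2) p.R₁ with hR | hR
  · have h0 : 0 ≤ r + σ / 2 := by linarith
    have t1 := hU.f_le_tangent hγ h0 hm0
    have t2 := hU.f_le_tangent hγ hr.le h0
    have hexp := hU.fd_le_mul_exp hγ hr.le (by linarith : r ≤ r + σ / 2)
    rw [min_eq_left hR, min_eq_left hrR] at hexp
    set t := 64 * p.α * p.γ ^ 2 * ((r + σ / 2) ^ 2 - r ^ 2) with ht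
    have hxt : 32 * x ≤ t := by
      have h1 : t = 16 * (p.α * p.γ ^ 2 * σ ^ 2) + 64 * p.α * p.γ ^ 2 * (r * σ) := by
        rw [ht]; ring
      have h2 : 0 ≤ 64 * p.α * p.γ ^ 2 * (r * σ) := by positivity
      linarith
    have hE : Real.exp (-t) ≤ 1 - 31 * x := by
      have h1 : Real.exp (-t) ≤ Real.exp (-(32 * x)) := Real.exp_le_exp.2 (by linarith)
      have h2 := sub_sq_div_two_le_one_sub_exp (s := 32 * x) (by linarith)
      nlinarith
    have h2 : p.fd (r + σ / 2) ≤ p.fd r * (1 - 31 * x) :=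
      hexp.trans (mul_le_mul_of_nonneg_left hE hfd)
    have h3 : p.fd (r + σ / 2) * (min r' l' - (r + σ / 2)) ≤
        p.fd (r + σ / 2) * (A + Y - σ / 2) :=
      mul_le_mul_of_nonneg_left (by linarith [min_le_left r' l']) (hU.fd_pos hγ h0).le
    have h4 : p.fd r * (31 * x) * (3 / 2 * (σ * X)) ≤
        (p.fd r - p.fd (r + σ / 2)) * (A + Y - σ / 2) := by
      apply mul_le_mul
      · linarith
      · linarith
      · positivity
      · have : 0 ≤ p.fd r * (31 * x) := by positivity
        linarith
    have h5 : 0 ≤ p.fd r * x * (σ * X) := by positivity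
    clear * - t1 t2 h3 h4 h5
    linarith
  · have t1 := hU.f_le_tangent hγ hr.le hm0
    have hDl : p.DK + l ≤ p.R₁ := by
      have h1 : (p.DK + l) * r ≤ p.R₁ * r := by
        have := mul_nonneg (sub_nonneg.2 hrR) hl
        linarith
      exact le_of_mul_le_mul_right h1 hr
    have h1 : x * (z + Q + 1 / 2 * (Q + 2 * σ * X)) ≤ 1 / 9600 * (12 * (σ * X)) := by
      refine mul_le_mul_of_nonneg hx ?_ hx0 (by positivity)
      linarith
    have h2 : min r' l' - r ≤ A + Y - 46 * (x * σ * X) := by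
      have h3 : x * (σ * X) ≤ 1 / 9600 * (σ * X) := mul_le_mul_of_nonneg_right hx (by linarith)
      have h4 := min_le_right r' l'
      clear * - h1 h3 h4 hDl hl' hR hA hY hσX hσ
      linarith
    have h3 := mul_le_mul_of_nonneg_left h2 hfd
    clear * - t1 h3
    linarith

end PotentialAssumption

end KineticLangevin

namespace KineticLangevin

variable {d : ℕ} {U : Pos d → ℝ} {p : Params d} {h : ℝ}

namespace PotentialAssumption

/-! ### Small distances -/

/-- The two rate bounds serve different terms of r = αZ + Q: 1/16 for αZ and α/4 for Q ≤ Z/4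
together give αZ/8. -/
lemma rate_mul_f_le_of_four_mul_le (hU : PotentialAssumption U p) (hγ : 0 < p.γ) (hh : 0 < h)
    {r Q Z : ℝ} (hr : r = p.α * Z + Q) (hQ : 0 ≤ Q) (hZ : 4 * Q ≤ Z) :
    p.rate h * h * p.f r ≤ 1 / 8 * (p.α * (p.γ * h)) * Z * p.fd r := by
  have hα := hU.α_pos hγ
  have hZ0 : 0 ≤ Z := by linarith
  have hr0 : 0 ≤ r := by rw [hr]; positivity
  obtain ⟨h1, h2⟩ := hU.rate_mul_le_near hγ hh
  have hF := hU.f_nonneg hγ hr0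
  have hR := (hU.fd_pos hγ (hU.R₁_nonneg hγ)).le
  have hself := hU.f_le_self hγ hr0
  have hle := hU.fd_R₁_le hγ hr0
  set c := p.rate h * h
  set t := p.fd p.R₁ * (p.γ * h) with ht
  have ht0 : 0 ≤ t := by positivity
  set m := min (t * (1 / 16)) (t * (p.α / 4)) with hm
  have hm0 : 0 ≤ m := le_min (by positivity) (by positivity)
  calc c * p.f r ≤ m * p.f r := mul_le_mul_of_nonneg_right (le_min h1 h2) hF
    _ ≤ m * (p.α * Z + Z / 4) := mul_le_mul_of_nonneg_left (by linarith) hm0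
    _ = m * (p.α * Z) + m * (Z / 4) := by ring
    _ ≤ t * (1 / 16) * (p.α * Z) + t * (p.α / 4) * (Z / 4) :=
      add_le_add (mul_le_mul_of_nonneg_right (min_le_left _ _) (by positivity))
        (mul_le_mul_of_nonneg_right (min_le_right _ _) (by positivity))
    _ = 1 / 8 * (p.α * (p.γ * h)) * Z * p.fd p.R₁ := by rw [ht]; ring
    _ ≤ _ := mul_le_mul_of_nonneg_left hle (by positivity)

/-- The same split with Z ≤ 4Q gives (4/16)αQ + (α/4)Q = αQ/2. -/
lemma rate_mul_f_le_of_le_four_mul (hU : PotentialAssumption U p) (hγ : 0 < p.γ) (hh : 0 < h)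
    {r Q Z : ℝ} (hr : r = p.α * Z + Q) (hZ0 : 0 ≤ Z) (hQ : 0 ≤ Q) (hZ : Z ≤ 4 * Q) :
    p.rate h * h * p.f r ≤ 1 / 2 * (p.α * (p.γ * h)) * Q * p.fd r := by
  have hα := hU.α_pos hγ
  have hr0 : 0 ≤ r := by rw [hr]; positivity
  obtain ⟨h1, h2⟩ := hU.rate_mul_le_near hγ hh
  have hF := hU.f_nonneg hγ hr0
  have hR := (hU.fd_pos hγ (hU.R₁_nonneg hγ)).le
  have hself := hU.f_le_self hγ hr0
  have hle := hU.fd_R₁_le hγ hr0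
  have hαZ := mul_le_mul_of_nonneg_left hZ hα.le
  set c := p.rate h * h
  set t := p.fd p.R₁ * (p.γ * h) with ht
  have ht0 : 0 ≤ t := by positivity
  set m := min (t * (1 / 16)) (t * (p.α / 4)) with hm
  have hm0 : 0 ≤ m := le_min (by positivity) (by positivity)
  calc c * p.f r ≤ m * p.f r := mul_le_mul_of_nonneg_right (le_min h1 h2) hF
    _ ≤ m * (p.α * (4 * Q) + Q) := mul_le_mul_of_nonneg_left (by linarith) hm0
    _ = m * (p.α * (4 * Q)) + m * Q := by ring
    _ ≤ t * (1 / 16) * (p.α * (4 * Q)) + t * (p.α / 4) * Q :=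
      add_le_add (mul_le_mul_of_nonneg_right (min_le_left _ _) (by positivity))
        (mul_le_mul_of_nonneg_right (min_le_right _ _) (by positivity))
    _ = 1 / 2 * (p.α * (p.γ * h)) * Q * p.fd p.R₁ := by rw [ht]; ring
    _ ≤ _ := mul_le_mul_of_nonneg_left hle (by positivity)

lemma ρ_le_f_rs (hU : PotentialAssumption U p) (hγ : 0 < p.γ) (a b : Phase d) :
    p.ρ a b ≤ p.f (p.rs a b) := by
  rw [ρ_eq]
  exact hU.f_mono hγ (hU.min_nonneg' hγ a b) (min_le_left _ _)

lemma measurable_ρ_coupledStepBU (hU : PotentialAssumption U p) (h : ℝ) (z : Phase d × Phase d) :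
    Measurable fun n => p.ρ (p.coupledStepBU U h z n).1 (p.coupledStepBU U h z n).2 := by
  have h1 : Measurable fun n => p.coupledStepBU U h z n :=
    (hU.measurable_coupledStepBU h).comp (f := fun n => (z, n)) (by fun_prop)
  exact p.continuous_ρ.measurable.comp h1

lemma lintegral_ofReal_le_of_bound {F : (Pos d × Pos d) × ℝ → ℝ} {c : ℝ}
    (hF : ∀ n : (Pos d × Pos d) × ℝ, n.2 ≤ 1 → F n ≤ c) :
    ∫⁻ n, ENNReal.ofReal (F n) ∂((noise₂ d).prod unif) ≤ ENNReal.ofReal c := by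
  have hae : ∀ᵐ n ∂((noise₂ d).prod unif), ENNReal.ofReal (F n) ≤ ENNReal.ofReal c := by
    have h1 : ∀ᵐ n ∂((noise₂ d).prod unif), n.2 ∈ Icc (0 : ℝ) 1 :=
      Measure.quasiMeasurePreserving_snd.ae unif_ae_mem
    filter_upwards [h1] with n hn
    exact ENNReal.ofReal_le_ofReal (hF n hn.2)
  refine (lintegral_mono_ae hae).trans ?_
  simp

/-- One coupled step in the regime of small distances, if the `q`-components agree. -/
lemma lintegral_ρ_coupledStepBU_le_of_q_eq_zero (hU : PotentialAssumption U p) (hγ : 0 < p.γ)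
    (hh : 0 < h) (hfric : p.FrictionCondition) (hstep : p.StepCondition h) {a b : Phase d}
    (hnear : p.rs a b < p.DK + p.ε * p.rl a b) (hq : p.q a b = 0) :
    ∫⁻ n, ENNReal.ofReal (p.ρ (p.coupledStepBU U h (a, b) n).1 (p.coupledStepBU U h (a, b) n).2)
      ∂((noise₂ d).prod unif) ≤ ENNReal.ofReal ((1 - p.rate h * h) * p.ρ a b) := by
  apply lintegral_ofReal_le_of_bound
  intro n hn
  obtain ⟨m, -, hm⟩ := hU.exists_step_bounds hγ hh hfric hstep a b
  have h1 := (hm n.1.1 n.1.1 n.1.2).1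
  rw [sub_self, smul_zero, add_zero, sub_self, mul_zero, add_zero, hq, norm_zero, mul_zero,
    add_zero] at h1
  have hr0 := hU.rs_nonneg hγ a b
  have hrate := hU.rate_mul_f_le_of_four_mul_le hγ hh (r := p.rs a b) (Q := 0) (Z := ‖a.1 - b.1‖)
    (by rw [Params.rs, hq, norm_zero]) le_rfl (by simp)
  rw [ρ_eq p a b, min_eq_left hnear.le]
  refine (hU.ρ_le_f_rs hγ _ _).trans ?_
  refine (hU.f_le_tangent hγ hr0 (hU.rs_nonneg hγ _ _)).trans ?_
  simp only [Params.coupledStepBU, coupledNoise_of_q_eq_zero hq _ hn]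
  have hfd := (hU.fd_pos hγ hr0).le
  have hα := hU.α_pos hγ
  have hd : 0 ≤ p.α * (p.γ * h) * ‖a.1 - b.1‖ := by positivity
  have h2 : p.fd (p.rs a b) * (p.rs (stepU p.γ h (stepB U h a) (n.1.1, n.1.2))
      (stepU p.γ h (stepB U h b) (n.1.1, n.1.2)) - p.rs a b) ≤
      p.fd (p.rs a b) * (-(1 / 8 * (p.α * (p.γ * h)) * ‖a.1 - b.1‖)) := by
    apply mul_le_mul_of_nonneg_left _ hfd
    linarith
  have h3 : p.fd (p.rs a b) * (p.rs (stepU p.γ h (stepB U h a) n.1)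
      (stepU p.γ h (stepB U h b) n.1) - p.rs a b) ≤
      p.fd (p.rs a b) * (-(1 / 8 * (p.α * (p.γ * h)) * ‖a.1 - b.1‖)) := h2
  linarith

/-- Pathwise bounds on one coupled step in terms of the one-dimensional coupling. -/
lemma exists_pathwise_bounds (hU : PotentialAssumption U p) (hγ : 0 < p.γ)
    (hh : 0 < h) (hfric : p.FrictionCondition) (hstep : p.StepCondition h) {a b : Phase d}
    (hnear : p.rs a b < p.DK + p.ε * p.rl a b) (hq : p.q a b ≠ 0) :
    ∃ m : ℝ, 1 ≤ m ∧ ∀ n : (Pos d × Pos d) × ℝ, n.2 ≤ 1 → ∀ x y : ℝ,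
      x = inner ℝ (‖p.q a b‖⁻¹ • p.q a b) n.1.1 →
      y = √(2 * p.γ⁻¹ * h) *
        (x - reflCoupling (1 / √(2 * p.γ⁻¹ * h) * ‖p.q a b‖) x n.2) →
      p.rs (p.coupledStepBU U h (a, b) n).1 (p.coupledStepBU U h (a, b) n).2 ≤
        p.rs a b - 0.46 * (p.α * (p.γ * h)) * ‖a.1 - b.1‖ + p.α * (p.γ * h) * ‖p.q a b‖ + m * y ∧
      p.ε * p.rl (p.coupledStepBU U h (a, b) n).1 (p.coupledStepBU U h (a, b) n).2 ≤
        p.ε * p.rl a b + p.α * (p.γ * h) * (‖a.1 - b.1‖ + ‖p.q a b‖ +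
          1 / 2 * (‖p.q a b‖ + y)) + 1 / 2 * |y| := by
  obtain ⟨m, hm1, hm⟩ := hU.exists_step_bounds hγ hh hfric hstep a b
  refine ⟨m, hm1, fun n hn x y hx hy => ?_⟩
  have hσ : 0 < √(2 * p.γ⁻¹ * h) := Real.sqrt_pos.2 (by positivity)
  have hQ : 0 < ‖p.q a b‖ := norm_pos_iff.2 hq
  have he := norm_inv_norm_smul hq
  have hqe : p.q a b = ‖p.q a b‖ • (‖p.q a b‖⁻¹ • p.q a b) := by
    rw [smul_smul, mul_inv_cancel₀ hQ.ne', one_smul]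
  obtain ⟨h1, h2⟩ := hm n.1.1 (p.coupledNoise h a b n.1.1 n.2) n.1.2
  have hxr := reflCoupling_le (b := 1 / √(2 * p.γ⁻¹ * h) * ‖p.q a b‖) (x := x) (by positivity) hn
  have hW : √(2 * p.γ⁻¹ * h) • (n.1.1 - p.coupledNoise h a b n.1.1 n.2) =
      y • (‖p.q a b‖⁻¹ • p.q a b) := by
    rw [coupledNoise_of_near hnear hq, ← hx, hy, mul_smul]
    congr 1
    rw [replaceComp, ← hx]
    module
  have hy0 : 0 ≤ ‖p.q a b‖ + y := by
    have := mul_nonneg hσ.le hxr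
    have h3 : √(2 * p.γ⁻¹ * h) * (1 / √(2 * p.γ⁻¹ * h) * ‖p.q a b‖) = ‖p.q a b‖ := by
      field_simp
    rw [mul_add, h3, ← hy] at this
    exact this
  have hN1 : ‖p.q a b + √(2 * p.γ⁻¹ * h) • (n.1.1 - p.coupledNoise h a b n.1.1 n.2)‖ =
      ‖p.q a b‖ + y := by
    have : p.q a b + y • (‖p.q a b‖⁻¹ • p.q a b) =
        (‖p.q a b‖ + y) • (‖p.q a b‖⁻¹ • p.q a b) := by
      rw [add_smul, ← hqe]
    rw [hW, this, norm_smul, he, mul_one, Real.norm_of_nonneg hy0]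
  have hN2 : ‖√(2 * p.γ⁻¹ * h) • (n.1.1 - p.coupledNoise h a b n.1.1 n.2)‖ = |y| := by
    rw [hW, norm_smul, he, mul_one, Real.norm_eq_abs]
  rw [hN1] at h1 h2
  rw [hN2] at h2
  rw [add_sub_cancel_left] at h1
  exact ⟨h1, h2⟩

set_option maxHeartbeats 400000 in
/-- One coupled step in the regime of small distances. -/
lemma lintegral_ρ_coupledStepBU_le_of_q_ne_zero (hU : PotentialAssumption U p) (hγ : 0 < p.γ)
    (hh : 0 < h) (hfric : p.FrictionCondition) (hstep : p.StepCondition h) {a b : Phase d}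
    (hnear : p.rs a b < p.DK + p.ε * p.rl a b) (hq : p.q a b ≠ 0) :
    ∫⁻ n, ENNReal.ofReal (p.ρ (p.coupledStepBU U h (a, b) n).1 (p.coupledStepBU U h (a, b) n).2)
      ∂((noise₂ d).prod unif) ≤ ENNReal.ofReal ((1 - p.rate h * h) * p.ρ a b) := by
  obtain ⟨m, hm1, hm⟩ := hU.exists_pathwise_bounds hγ hh hfric hstep hnear hq
  have he := norm_inv_norm_smul hq
  have hQ : 0 < ‖p.q a b‖ := norm_pos_iff.2 hq
  have hF := hU.measurable_ρ_coupledStepBU h (a, b)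
  have hF0 := fun n => hU.ρ_nonneg hγ (p.coupledStepBU U h (a, b) n).1
    (p.coupledStepBU U h (a, b) n).2
  have hα := hU.α_pos hγ
  have hr0 := hU.rs_nonneg hγ a b
  have hrdef : p.rs a b = p.α * ‖a.1 - b.1‖ + ‖p.q a b‖ := rfl
  have hrR : p.rs a b ≤ p.R₁ := hU.rs_le_R₁ hγ (by rw [Params.Δ]; linarith)
  have hfd := (hU.fd_pos hγ hr0).le
  have hσ : 0 < √(2 * p.γ⁻¹ * h) := Real.sqrt_pos.2 (by positivity)
  have hσx : p.α * p.γ ^ 2 * √(2 * p.γ⁻¹ * h) ^ 2 = 2 * (p.α * (p.γ * h)) := by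
    rw [Real.sq_sqrt (by positivity)]
    field_simp
  have hx : p.α * (p.γ * h) ≤ 1 / 9600 := by
    have := hstep.α_mul_le hU hγ
    have h2 : 0 ≤ p.α * (p.γ * h) := by positivity
    nlinarith
  have hR₁ := hstep.mul_R₁_le hU hγ hh
  have hDK := hU.DK_mul_rs_le hγ a b
  have hl := mul_nonneg (hU.ε_pos hγ).le (p.rl_nonneg a b)
  rw [ρ_eq p a b, min_eq_left hnear.le]
  have hs' := fun n => hU.rs_nonneg hγ (p.coupledStepBU U h (a, b) n).1
    (p.coupledStepBU U h (a, b) n).2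
  have hZ0 : 0 ≤ ‖a.1 - b.1‖ := norm_nonneg _
  have hxp : 0 < p.α * (p.γ * h) := by positivity
  set σ := √(2 * p.γ⁻¹ * h)
  set Q := ‖p.q a b‖
  set Z := ‖a.1 - b.1‖
  set r := p.rs a b
  set x := p.α * (p.γ * h)
  have hb : 0 ≤ 1 / σ * Q := by positivity
  rw [one_sub_mul]
  -- If |z| ≥ 4|q|, the drift is at most (-0.46 + 1/4)x|z|, better than the x|z|/8 needed, and no
  -- curvature is used.
  rcases le_or_gt (4 * Q) Z with hZQ | hZQ
  · have hrate := hU.rate_mul_f_le_of_four_mul_le hγ hh hrdef hQ.le hZQ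
    refine (lintegral_ofReal_le_of_pathwise hF hF0 he (1 / σ * Q)
      (p.f r + p.fd r * (-(1 / 8 * x * Z))) (p.fd r * (m * σ)) 0 (G := fun _ => 0)
      (integrable_zero _ _ _) (by simp) ?_).trans (ENNReal.ofReal_le_ofReal (by linarith))
    intro n hn
    obtain ⟨h1, -⟩ := hm n hn _ _ rfl rfl
    refine (hU.ρ_le_f_rs hγ _ _).trans ((hU.f_le_tangent hγ hr0 (hs' n)).trans ?_)
    have h2 : x * Q ≤ x * (Z / 4) := mul_le_mul_of_nonneg_left (by linarith) hxp.le
    have h3 : 0 ≤ x * Z := by positivity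
    have h4 := mul_le_mul_of_nonneg_left (b := p.rs (p.coupledStepBU U h (a, b) n).1
      (p.coupledStepBU U h (a, b) n).2 - r) (c := -(1 / 8 * x * Z) + m * (σ *
        (inner ℝ ((Q)⁻¹ • p.q a b) n.1.1 - reflCoupling (1 / σ * Q)
          (inner ℝ ((Q)⁻¹ • p.q a b) n.1.1) n.2))) (by linarith) hfd
    linarith
  have hrate := hU.rate_mul_f_le_of_le_four_mul hγ hh hrdef hZ0 hQ.le hZQ.le
  have hQr : Q ≤ r := by
    rw [hrdef]
    have : 0 ≤ p.α * Z := by positivity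
    linarith
  have hA0 : 0 ≤ x * Q := by positivity
  have hxQfd : 0 ≤ x * Q * p.fd r := by positivity
  have hgen : ∀ (n : (Pos d × Pos d) × ℝ) (y : ℝ),
      p.rs (p.coupledStepBU U h (a, b) n).1 (p.coupledStepBU U h (a, b) n).2 ≤
        r - 0.46 * x * Z + x * Q + m * y →
      p.rs (p.coupledStepBU U h (a, b) n).1 (p.coupledStepBU U h (a, b) n).2 ≤
        r + x * Q + m * y ∧
      p.ρ (p.coupledStepBU U h (a, b) n).1 (p.coupledStepBU U h (a, b) n).2 ≤
        p.f r + p.fd r * (x * Q + m * y) := by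
    intro n y h1
    have h2 : 0 ≤ x * Z := by positivity
    refine ⟨by linarith, ?_⟩
    refine (hU.ρ_le_f_rs hγ _ _).trans ((hU.f_le_tangent hγ hr0 (hs' n)).trans ?_)
    have := mul_le_mul_of_nonneg_left (b := p.rs (p.coupledStepBU U h (a, b) n).1
      (p.coupledStepBU U h (a, b) n).2 - r) (c := x * Q + m * y) (by linarith) hfd
    linarith
  -- In both remaining cases the gain must exceed 3/2 · xQ: the drift xQ plus the rate term xQ/2.
  -- For Q ≥ 2σ it is 96/20 · xQ.
  rcases le_or_gt (2 * σ) Q with hQσ | hQσ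
  · refine (lintegral_ofReal_le_of_pathwise hF hF0 he (1 / σ * Q)
      (p.f r + p.fd r * (x * Q)) (p.fd r * (m * σ)) (96 * (x * Q) * p.fd r * (1 / 20))
      (G := fun y => 96 * (x * Q) * p.fd r * (Icc (-2 : ℝ) (-1)).indicator (fun _ => (1 : ℝ)) y.1)
      ?_ ?_ ?_).trans (ENNReal.ofReal_le_ofReal (by linarith))
    · apply Integrable.const_mul
      exact ((integrable_const (1 : ℝ)).indicator measurableSet_Icc).comp_fst unif
    · rw [integral_const_mul]
      exact mul_le_mul_of_nonneg_left one_div_twenty_le_integral_indicator (by positivity)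
    · intro n hn
      obtain ⟨h1, -⟩ := hm n hn _ _ rfl rfl
      obtain ⟨h2, h3⟩ := hgen n _ h1
      set X : ℝ := inner ℝ ((Q)⁻¹ • p.q a b) n.1.1
      by_cases hX : X ∈ Icc (-2 : ℝ) (-1)
      · have hy : σ * (X - reflCoupling (1 / σ * Q) X n.2) ≤ -2 * σ := by
          -- Acceptance closes the whole gap Q ≥ 2σ, and reflection changes it by 2σX ≤ -2σ, so both
          -- branches approach enough.
          rcases reflCoupling_cases (1 / σ * Q) X n.2 with hr | ⟨-, hr⟩
          · rw [hr]
            have : σ * (X - (X + 1 / σ * Q)) = -Q := by field_simp; ring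
            rw [this]
            linarith
          · rw [hr]
            have := mul_le_mul_of_nonneg_left hX.2 hσ.le
            linarith
        have hmy : m * (σ * (X - reflCoupling (1 / σ * Q) X n.2)) ≤ -2 * σ := by
          clear * - hy hm1 hσ
          nlinarith
        have h4 := hU.f_le_of_approach hγ hσ hσx hQr hrR hQσ (hs' n)
          ((mul_le_mul_of_nonneg_left (hQr.trans hrR) hxp.le).trans hR₁) hmy h2
        have h5 := (hU.ρ_le_f_rs hγ _ _).trans h4
        rw [indicator_of_mem hX]
        linarith
      · rw [indicator_of_notMem hX]
        linarith
  · refine (lintegral_ofReal_le_of_pathwise hF hF0 he (1 / σ * Q)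
      (p.f r + p.fd r * (x * Q)) (p.fd r * (m * σ)) (46 * (x * σ) * p.fd r * (1 / σ * Q / 30))
      (G := fun y => 46 * (x * σ) * p.fd r * reflGain (1 / σ * Q) y)
      ((integrable_reflGain _).const_mul _) ?_ ?_).trans (ENNReal.ofReal_le_ofReal ?_)
    · rw [integral_const_mul]
      refine mul_le_mul_of_nonneg_left (le_integral_reflGain hb ?_) (by positivity)
      rw [one_div, inv_mul_le_iff₀ hσ]
      linarith
    · intro n hn
      obtain ⟨h1, h1'⟩ := hm n hn _ _ rfl rfl
      obtain ⟨h2, h3⟩ := hgen n _ h1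
      set X : ℝ := inner ℝ ((Q)⁻¹ • p.q a b) n.1.1
      rw [reflGain]
      split_ifs with hX
      · simp only at hX
        rw [reflCoupling_of_lt hX.2] at h1' h2 ⊢
        have hX1 := hX.1.1
        have hσX : 0 < σ * X := by positivity
        have hy : σ * (X - -X) = 2 * σ * X := by ring
        rw [hy] at h1' h2
        rw [abs_of_nonneg (by linarith)] at h1'
        have h4 := hU.f_le_of_reflect hγ hσ hσx hx (hQ.trans_le hQr) hrR hQσ.le hZQ.le hX1 hl
          (by rw [Params.Δ] at hDK; exact hDK)
          (hU.min_nonneg' hγ (p.coupledStepBU U h (a, b) n).1 (p.coupledStepBU U h (a, b) n).2)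
          hA0 (Y := m * (2 * σ * X)) (le_mul_of_one_le_left (by positivity) hm1) h2
          (by clear * - h1'; linarith)
        rw [ρ_eq]
        clear * - h4
        linarith
      · clear * - h3
        linarith
    -- The separation b = Q/σ cancels σ, leaving a gain of 46/30 · xQ, just above 3/2 · xQ.
    · have : 46 * (x * σ) * p.fd r * (1 / σ * Q / 30) = 46 / 30 * (x * Q * p.fd r) := by
        field_simp
      linarith

lemma rate_mul_le (hU : PotentialAssumption U p) (hγ : 0 < p.γ) (hh : 0 < h) :
    p.rate h * h ≤ Real.exp (-(p.γ * h)) * (p.γ * h / 16) := by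
  have h1 : p.rate h ≤ _ := (rate_le_rateMain p h).trans ((min_le_right _ _).trans
    ((min_le_right _ _).trans (min_le_left _ _)))
  rw [p.deriv_f, neg_mul] at h1
  have h2 := hU.fd_le_one hγ (hU.R₁_nonneg hγ)
  have h3 := Real.exp_pos (-(p.γ * h))
  have h4 : p.fd p.R₁ * Real.exp (-(p.γ * h)) * (p.γ / 16) ≤
      1 * Real.exp (-(p.γ * h)) * (p.γ / 16) := by gcongr
  have := mul_le_mul_of_nonneg_right (h1.trans h4) hh.le
  linarith

lemma rate_mul_le_one (hU : PotentialAssumption U p) (hγ : 0 < p.γ) (hh : 0 < h)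
    (hstep : p.StepCondition h) : p.rate h * h ≤ 1 := by
  have h1 := hU.rate_mul_le hγ hh
  have h2 := hstep.mul_le hU hγ
  have hs : 0 < p.γ * h := by positivity
  have h3 : Real.exp (-(p.γ * h)) ≤ 1 := Real.exp_le_one_iff.2 (by linarith)
  nlinarith

/-- Pays for the one contraction factor missing among the k - 1 coupled steps. It is the reason for
e^{-γh} in the rate: e^{-s}(1 + s/16) ≤ 1 gives (1 + s/16)ch ≤ s/16. -/
lemma one_le_mul_one_sub_rate (hU : PotentialAssumption U p) (hγ : 0 < p.γ) (hh : 0 < h) :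
    1 ≤ (1 + p.γ * h / 16) * (1 - p.rate h * h) := by
  have h1 := hU.rate_mul_le hγ hh
  have hs : 0 < p.γ * h := by positivity
  have h2 : Real.exp (-(p.γ * h)) * (1 + p.γ * h) ≤ 1 := by
    have h3 : Real.exp (-(p.γ * h)) * Real.exp (p.γ * h) = 1 := by rw [← Real.exp_add]; simp
    refine (mul_le_mul_of_nonneg_left ?_ (Real.exp_pos _).le).trans h3.le
    linarith [Real.add_one_le_exp (p.γ * h)]
  have h4 := Real.exp_pos (-(p.γ * h))
  have h5 : Real.exp (-(p.γ * h)) * (1 + p.γ * h / 16) ≤ 1 :=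
    (mul_le_mul_of_nonneg_left (by linarith) h4.le).trans h2
  have h6 := mul_le_mul_of_nonneg_right h1 (by positivity : 0 ≤ 1 + p.γ * h / 16)
  have h7 := mul_le_mul_of_nonneg_right h5 (by positivity : 0 ≤ p.γ * h / 16)
  linarith

/-- Contraction of one coupled step. -/
lemma lintegral_ρ_coupledStepBU_le (hU : PotentialAssumption U p) (hγ : 0 < p.γ)
    (hh : 0 < h) (hfric : p.FrictionCondition) (hstep : p.StepCondition h)
    (z : Phase d × Phase d) :
    ∫⁻ n, ENNReal.ofReal (p.ρ (p.coupledStepBU U h z n).1 (p.coupledStepBU U h z n).2)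
      ∂((noise₂ d).prod unif) ≤
      ENNReal.ofReal (1 - p.rate h * h) * ENNReal.ofReal (p.ρ z.1 z.2) := by
  obtain ⟨a, b⟩ := z
  rw [← ENNReal.ofReal_mul (sub_nonneg.2 (hU.rate_mul_le_one hγ hh hstep))]
  rcases le_or_gt (p.DK + p.ε * p.rl a b) (p.rs a b) with hfar | hnear
  · exact lintegral_ofReal_le_of_bound fun n _ =>
      hU.ρ_coupledStepBU_le_far hγ hh hfric hstep hfar n
  · by_cases hq : p.q a b = 0
    · exact hU.lintegral_ρ_coupledStepBU_le_of_q_eq_zero hγ hh hfric hstep hnear hq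
    · exact hU.lintegral_ρ_coupledStepBU_le_of_q_ne_zero hγ hh hfric hstep hnear hq

end PotentialAssumption

end KineticLangevin

namespace KineticLangevin

variable {d : ℕ} {U : Pos d → ℝ} {p : Params d} {h : ℝ}

/-! ### The first and the last step -/

/-- Bound on the growth of `ρ` in the first and in the last step of the coupling. -/
noncomputable def Params.halfStepFactor (p : Params d) (h : ℝ) : ℝ :=
  max (1 + p.α * (p.γ * h) / 2) √(1 + p.γ * h * max 1 p.lam)

lemma exp_half_bounds {γ : ℝ} (hγ : 0 < γ) (hh : 0 < h) :
    γ * h / 2 - (γ * h) ^ 2 / 8 ≤ 1 - Real.exp (-γ * (h / 2)) ∧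
      1 - Real.exp (-γ * (h / 2)) ≤ γ * h / 2 ∧ 0 ≤ 1 - Real.exp (-γ * (h / 2)) := by
  have e : -γ * (h / 2) = -(γ * h / 2) := by ring
  rw [e]
  have h0 : 0 < γ * h / 2 := by positivity
  refine ⟨?_, one_sub_exp_neg_le _, ?_⟩
  · have := sub_sq_div_two_le_one_sub_exp h0.le
    linarith
  · rw [sub_nonneg]
    exact Real.exp_le_one_iff.2 (by linarith)

namespace PotentialAssumption

lemma one_le_halfStepFactor (hU : PotentialAssumption U p) (hγ : 0 < p.γ) (hh : 0 < h) :
    1 ≤ p.halfStepFactor h := by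
  have hα := hU.α_pos hγ
  have : 0 < p.α * (p.γ * h) := by positivity
  exact (by linarith : (1 : ℝ) ≤ 1 + p.α * (p.γ * h) / 2).trans (le_max_left _ _)

lemma halfStepFactor_sq (p : Params d) (hγ : 0 < p.γ) (hh : 0 < h) :
    p.halfStepFactor h ^ 2 ≤
      max ((1 + p.α * p.γ * h / 2) ^ 2) (1 + p.γ * h * max 1 (p.LK / p.γ ^ 2)) := by
  have hlam : p.lam = p.LK / p.γ ^ 2 := rfl
  rw [← hlam, mul_assoc p.α, Params.halfStepFactor]
  have hM : 0 ≤ max 1 p.lam := zero_le_one.trans (le_max_left _ _)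
  have hY : 0 ≤ 1 + p.γ * h * max 1 p.lam := by positivity
  rcases max_choice (1 + p.α * (p.γ * h) / 2) √(1 + p.γ * h * max 1 p.lam) with e | e
  · rw [e]
    exact le_max_left _ _
  · rw [e, Real.sq_sqrt hY]
    exact le_max_right _ _

/-- The flight fixes q and moves z to the convex combination (1 - δ)z + δq, so r_s grows only
through αδ|q|. -/
lemma ρ_syncHalfU_le (hU : PotentialAssumption U p) (hγ : 0 < p.γ) (hh : 0 < h)
    (hstep : p.StepCondition h) (a b : Phase d) (ξ : Pos d × Pos d) :
    p.ρ (p.syncHalfU h (a, b) ξ).1 (p.syncHalfU h (a, b) ξ).2 ≤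
      p.halfStepFactor h * p.ρ a b := by
  obtain ⟨e1, e2⟩ := stepU_sub hγ (half_pos hh) a b ξ.1 ξ.1 ξ.2
  rw [sub_self, smul_zero, add_zero] at e1 e2
  obtain ⟨hδ1, hδ2, hδ0⟩ := exp_half_bounds hγ hh
  have hα := hU.α_pos hγ
  have hs : 0 < p.γ * h := by positivity
  have hs15 := hstep.mul_le hU hγ
  set δ := 1 - Real.exp (-p.γ * (h / 2))
  set a' := stepU p.γ (h / 2) a (ξ.1, ξ.2)
  set b' := stepU p.γ (h / 2) b (ξ.1, ξ.2)
  have hu : p.γ⁻¹ • (a.2 - b.2) = p.q a b - (a.1 - b.1) := by rw [Params.q]; abel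
  have hq : p.q a' b' = p.q a b := by
    rw [Params.q, e1, e2, Params.q]
    module
  change p.ρ a' b' ≤ _
  refine hU.ρ_le_mul hγ (hU.one_le_halfStepFactor hγ hh) ?_ ?_
  · refine le_trans ?_ (mul_le_mul_of_nonneg_right (le_max_left _ _) (hU.rs_nonneg hγ a b))
    rw [Params.rs, hq, Params.rs, e1, hu]
    have k1 : ‖a.1 - b.1 + δ • (p.q a b - (a.1 - b.1))‖ ≤
        (1 - δ) * ‖a.1 - b.1‖ + δ * ‖p.q a b‖ := by
      have : a.1 - b.1 + δ • (p.q a b - (a.1 - b.1)) = (1 - δ) • (a.1 - b.1) + δ • p.q a b := by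
        module
      rw [this]
      refine (norm_add_le _ _).trans (le_of_eq ?_)
      rw [norm_smul, norm_smul, Real.norm_of_nonneg hδ0, Real.norm_of_nonneg (by linarith)]
    have k2 := mul_le_mul_of_nonneg_left k1 hα.le
    have k3 : p.α * δ * ‖p.q a b‖ ≤ p.α * (p.γ * h / 2) * ‖p.q a b‖ := by gcongr
    have k4 : 0 ≤ p.α * δ * ‖a.1 - b.1‖ := by positivity
    have k5 : 0 ≤ p.α * (p.γ * h) * (p.α * ‖a.1 - b.1‖) := by positivity
    linarith
  · refine le_trans ?_ (mul_le_mul_of_nonneg_right (le_max_right _ _) (p.rl_nonneg a b))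
    rw [p.rl_eq, p.rl_eq, e1, e2, ← Real.sqrt_mul]
    · exact Real.sqrt_le_sqrt (twistedForm_half_flight_le p.τ δ (p.γ * h) p.lam p.kap
        (max 1 p.lam) p.Ks hU.Ks_symm hU.inner_Ks_le hU.norm_Ks_sq_le hU.le_inner_Ks
        (hU.τ_pos hγ).le (min_le_left _ _) (four_τ_le p) hU.lam_nonneg hs.le hs15
        (hstep.mul_lam_le hU hγ) hδ0 hδ2 (le_max_left _ _) (le_max_right _ _) _ _)
    · have : 0 ≤ max 1 p.lam := zero_le_one.trans (le_max_left _ _)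
      positivity

lemma ρ_syncBHalfU_le (hU : PotentialAssumption U p) (hγ : 0 < p.γ) (hh : 0 < h)
    (hfric : p.FrictionCondition) (hstep : p.StepCondition h) (a b : Phase d) (ξ : Pos d × Pos d) :
    p.ρ (p.syncBHalfU U h (a, b) ξ).1 (p.syncBHalfU U h (a, b) ξ).2 ≤
      p.halfStepFactor h * p.ρ a b := by
  obtain ⟨e1, e2⟩ := stepU_sub hγ (half_pos hh) (stepB U h a) (stepB U h b) ξ.1 ξ.1 ξ.2
  obtain ⟨g, hg1, hg2, -, hk⟩ := hU.exists_kick hγ hfric hh.le a b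
  rw [sub_self, smul_zero, add_zero, hg1] at e1 e2
  have hB : ∀ c : Phase d, (stepB U h c).1 = c.1 := fun _ => rfl
  rw [hB, hB] at e1
  obtain ⟨hδ1, hδ2, hδ0⟩ := exp_half_bounds hγ hh
  have hα := hU.α_pos hγ
  have hs : 0 < p.γ * h := by positivity
  have hs15 := hstep.mul_le hU hγ
  have hαs := hstep.α_mul_le hU hγ
  set δ := 1 - Real.exp (-p.γ * (h / 2))
  set a' := stepU p.γ (h / 2) (stepB U h a) (ξ.1, ξ.2)
  set b' := stepU p.γ (h / 2) (stepB U h b) (ξ.1, ξ.2)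
  have hM1 : 1 ≤ max 1 p.lam := le_max_left _ _
  change p.ρ a' b' ≤ _
  refine hU.ρ_le_mul hγ (hU.one_le_halfStepFactor hγ hh) ?_ ?_
  · set s := p.γ * h
    set k := s • (p.Ks (a.1 - b.1) + g)
    have hu : p.γ⁻¹ • (a.2 - b.2) = p.q a b - (a.1 - b.1) := by rw [Params.q]; abel
    have hq : p.q a' b' = p.q a b - k := by
      rw [Params.q, e1, e2, Params.q]
      module
    have hz : a'.1 - b'.1 = (1 - δ) • (a.1 - b.1) + δ • p.q a b - δ • k := by
      rw [e1, hu]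
      module
    have hx : p.α * s ≤ 1 / 9600 := by nlinarith [mul_pos hα hs]
    have hC1 : 1 + p.α * s / 2 ≤ p.halfStepFactor h := le_max_left _ _
    -- In r_s the coefficient of α|z| gains s/2 from the kick and loses δ ≥ s/2 - s²/8 from the
    -- flight. The small net growth need not be covered by 1 + αs/2 when α is small, so the other
    -- entry of the factor is used.
    have hC2 : 1 + s / 100 ≤ p.halfStepFactor h := by
      refine le_trans ?_ (le_max_right _ _)
      apply Real.le_sqrt_of_sq_le
      have : s * 1 ≤ s * max 1 p.lam := mul_le_mul_of_nonneg_left hM1 hs.le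
      nlinarith
    rw [Params.rs, hq, Params.rs, hz]
    have hZ0 := norm_nonneg (a.1 - b.1)
    have hQ0 := norm_nonneg (p.q a b)
    set Z := ‖a.1 - b.1‖
    set Q := ‖p.q a b‖
    have k1 : ‖(1 - δ) • (a.1 - b.1) + δ • p.q a b - δ • k‖ ≤
        (1 - δ) * Z + δ * Q + δ * (p.α * s / 2 * Z) := by
      refine (norm_sub_le _ _).trans (add_le_add ((norm_add_le _ _).trans (add_le_add ?_ ?_)) ?_)
      · rw [norm_smul, Real.norm_of_nonneg (by linarith)]
      · rw [norm_smul, Real.norm_of_nonneg hδ0]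
      · rw [norm_smul, Real.norm_of_nonneg hδ0]
        exact mul_le_mul_of_nonneg_left hk hδ0
    have k2 : ‖p.q a b - k‖ ≤ Q + p.α * s / 2 * Z := (norm_sub_le _ _).trans (add_le_add le_rfl hk)
    have k3 := mul_le_mul_of_nonneg_left k1 hα.le
    have k4 : p.α * δ * Q ≤ p.α * (s / 2) * Q := by gcongr
    have k5 : (1 + p.α * s / 2) * Q ≤ p.halfStepFactor h * Q := mul_le_mul_of_nonneg_right hC1 hQ0
    have k6 : (1 + s / 100) * (p.α * Z) ≤ p.halfStepFactor h * (p.α * Z) :=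
      mul_le_mul_of_nonneg_right hC2 (by positivity)
    have k7 : (1 - δ + δ * (p.α * s / 2) + s / 2) * (p.α * Z) ≤ (1 + s / 100) * (p.α * Z) := by
      apply mul_le_mul_of_nonneg_right _ (by positivity)
      have l1 : δ * (p.α * s / 2) ≤ s / 2 * (1 / 9600 / 2) := by gcongr
      have l2 : s ^ 2 ≤ s * (1 / 15) := by rw [sq]; exact mul_le_mul_of_nonneg_left hs15 hs.le
      linarith
    clear * - k2 k3 k4 k5 k6 k7
    linarith
  · refine le_trans ?_ (mul_le_mul_of_nonneg_right (le_max_right _ _) (p.rl_nonneg a b))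
    rw [p.rl_eq, p.rl_eq, e1, e2, ← Real.sqrt_mul]
    · exact Real.sqrt_le_sqrt (twistedForm_kick_half_step_le p.τ δ (p.γ * h) p.lam p.kap
        (max 1 p.lam) p.Ks hU.Ks_symm hU.inner_Ks_le hU.norm_Ks_sq_le hU.le_inner_Ks
        (hU.τ_pos hγ).le (min_le_left _ _) (four_τ_le p) hU.lam_nonneg hs.le hs15
        (hstep.mul_lam_le hU hγ) hδ1 hδ2 (le_max_left _ _) (le_max_right _ _) _ _ g hg2)
    · positivity

/-! ### Contraction of the coupling -/

lemma lintegral_ρ_iterKernel_le (hU : PotentialAssumption U p) (hγ : 0 < p.γ)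
    (hh : 0 < h) (hfric : p.FrictionCondition) (hstep : p.StepCondition h) (k : ℕ)
    (z : Phase d × Phase d) :
    ∫⁻ y, ENNReal.ofReal (p.ρ y.1 y.2)
      ∂(iterKernel (noisyStep ((noise₂ d).prod unif) (p.coupledStepBU U h)) k z) ≤
      ENNReal.ofReal (1 - p.rate h * h) ^ k * ENNReal.ofReal (p.ρ z.1 z.2) := by
  have hm : Measurable fun z : Phase d × Phase d => ENNReal.ofReal (p.ρ z.1 z.2) :=
    p.continuous_ρ.measurable.ennreal_ofReal
  induction k with
  | zero => rw [iterKernel, Kernel.id_apply, lintegral_dirac' _ hm, pow_zero, one_mul]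
  | succ k ih =>
    rw [iterKernel, Kernel.lintegral_comp _ _ _ hm]
    simp_rw [lintegral_noisyStep (hU.measurable_coupledStepBU h) _ hm]
    refine (lintegral_mono fun y => hU.lintegral_ρ_coupledStepBU_le hγ hh hfric hstep y).trans ?_
    rw [lintegral_const_mul _ hm, pow_succ', mul_assoc]
    gcongr

lemma lintegral_ρ_ubuCoupling_succ_le (hU : PotentialAssumption U p) (hγ : 0 < p.γ)
    (hh : 0 < h) (hfric : p.FrictionCondition) (hstep : p.StepCondition h) (k : ℕ)
    (a b : Phase d) :
    ∫⁻ y, ENNReal.ofReal (p.ρ y.1 y.2) ∂(p.ubuCoupling U h (k + 1) (a, b)) ≤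
      ENNReal.ofReal (p.halfStepFactor h) * (ENNReal.ofReal (1 - p.rate h * h) ^ k *
        (ENNReal.ofReal (p.halfStepFactor h) * ENNReal.ofReal (p.ρ a b))) := by
  have hm : Measurable fun z : Phase d × Phase d => ENNReal.ofReal (p.ρ z.1 z.2) :=
    p.continuous_ρ.measurable.ennreal_ofReal
  have hC := zero_le_one.trans (hU.one_le_halfStepFactor hγ hh)
  have h1 : ∀ z : Phase d × Phase d,
      ∫⁻ y, ENNReal.ofReal (p.ρ y.1 y.2) ∂(noisyStep (noise₂ d) (p.syncBHalfU U h) z) ≤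
        ENNReal.ofReal (p.halfStepFactor h) * ENNReal.ofReal (p.ρ z.1 z.2) := by
    rintro ⟨a, b⟩
    rw [lintegral_noisyStep (hU.measurable_syncBHalfU h) _ hm, ← ENNReal.ofReal_mul hC]
    refine (lintegral_mono fun ξ => ENNReal.ofReal_le_ofReal
      (hU.ρ_syncBHalfU_le hγ hh hfric hstep a b ξ)).trans ?_
    simp
  have h2 : ∫⁻ y, ENNReal.ofReal (p.ρ y.1 y.2) ∂(noisyStep (noise₂ d) (p.syncHalfU h) (a, b)) ≤
        ENNReal.ofReal (p.halfStepFactor h) * ENNReal.ofReal (p.ρ a b) := by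
    rw [lintegral_noisyStep (measurable_syncHalfU p h) _ hm, ← ENNReal.ofReal_mul hC]
    refine (lintegral_mono fun ξ => ENNReal.ofReal_le_ofReal
      (hU.ρ_syncHalfU_le hγ hh hstep a b ξ)).trans ?_
    simp
  rw [Params.ubuCoupling, Kernel.lintegral_comp _ _ _ hm]
  refine (lintegral_mono h1).trans ?_
  rw [lintegral_const_mul _ hm, Kernel.lintegral_comp _ _ _ hm]
  gcongr
  refine (lintegral_mono fun y => hU.lintegral_ρ_iterKernel_le hγ hh hfric hstep k y).trans ?_
  rw [lintegral_const_mul _ hm]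
  gcongr

lemma lintegral_ρ_ubuCoupling_le (hU : PotentialAssumption U p) (hγ : 0 < p.γ)
    (hh : 0 < h) (hfric : p.FrictionCondition) (hstep : p.StepCondition h) (k : ℕ)
    (a b : Phase d) :
    ∫⁻ y, ENNReal.ofReal (p.ρ y.1 y.2) ∂(p.ubuCoupling U h k (a, b)) ≤
      ENNReal.ofReal (p.prefactor h * (1 - p.rate h * h) ^ k * p.ρ a b) := by
  have hm : Measurable fun z : Phase d × Phase d => ENNReal.ofReal (p.ρ z.1 z.2) :=
    p.continuous_ρ.measurable.ennreal_ofReal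
  have hρ := hU.ρ_nonneg hγ a b
  have hC := hU.one_le_halfStepFactor hγ hh
  have hC2 := halfStepFactor_sq p hγ hh
  have hC3 : 1 ≤ p.halfStepFactor h ^ 2 := one_le_pow₀ hC
  have hs : 0 < p.γ * h := by positivity
  have hr : 0 ≤ 1 - p.rate h * h := sub_nonneg.2 (hU.rate_mul_le_one hγ hh hstep)
  cases k with
  -- No step is taken, so the prefactor only has to be at least 1.
  | zero =>
    rw [Params.ubuCoupling, Kernel.id_apply, lintegral_dirac' _ hm, pow_zero, mul_one]
    apply ENNReal.ofReal_le_ofReal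
    apply le_mul_of_one_le_left hρ
    rw [Params.prefactor]
    have h1 := hC3.trans hC2
    nlinarith
  | succ k =>
    refine (hU.lintegral_ρ_ubuCoupling_succ_le hγ hh hfric hstep k a b).trans ?_
    have hC0 : 0 ≤ p.halfStepFactor h := by linarith
    rw [← ENNReal.ofReal_pow hr, ← ENNReal.ofReal_mul hC0, ← ENNReal.ofReal_mul (by positivity),
      ← ENNReal.ofReal_mul hC0]
    apply ENNReal.ofReal_le_ofReal
    have h1 := hU.one_le_mul_one_sub_rate hγ hh
    have hB : 0 ≤ (1 - p.rate h * h) ^ k * p.ρ a b := by positivity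
    rw [Params.prefactor]
    set Y := max ((1 + p.α * p.γ * h / 2) ^ 2) (1 + p.γ * h * max 1 (p.LK / p.γ ^ 2))
    have hY : 0 ≤ Y := by linarith
    calc p.halfStepFactor h * ((1 - p.rate h * h) ^ k * (p.halfStepFactor h * p.ρ a b))
        = p.halfStepFactor h ^ 2 * ((1 - p.rate h * h) ^ k * p.ρ a b) := by ring
      _ ≤ Y * ((1 - p.rate h * h) ^ k * p.ρ a b) := mul_le_mul_of_nonneg_right hC2 hB
      -- Raises the power of 1 - ch from k to k + 1.
      _ ≤ ((1 + p.γ * h / 16) * (1 - p.rate h * h)) * (Y * ((1 - p.rate h * h) ^ k * p.ρ a b)) :=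
        le_mul_of_one_le_left (by positivity) h1
      _ = _ := by ring

end PotentialAssumption

end KineticLangevin

theorem mainTheorem3 (d : ℕ) (U : KineticLangevin.Pos d → ℝ) (p : KineticLangevin.Params d)
    (hU : KineticLangevin.PotentialAssumption U p) (h : ℝ) (hh : 0 < h) (hγ : 0 < p.γ)
    (hfric : p.FrictionCondition) (hstep : p.StepCondition h)
    (k : ℕ) (a b : KineticLangevin.Phase d) :
    -- the joint law of the two copies after `k` steps is a coupling of the laws of the UBU chains
    (p.ubuCoupling U h k (a, b)).map Prod.fst = KineticLangevin.ubu U p.γ h k a ∧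
    (p.ubuCoupling U h k (a, b)).map Prod.snd = KineticLangevin.ubu U p.γ h k b ∧
    -- contraction in expectation
    Integrable (fun z => p.ρ z.1 z.2) (p.ubuCoupling U h k (a, b)) ∧
    ∫ z, p.ρ z.1 z.2 ∂(p.ubuCoupling U h k (a, b)) ≤
      p.prefactor h * (1 - p.rate h * h) ^ k * p.ρ a b := by

  have hm : Measurable fun z : KineticLangevin.Phase d × KineticLangevin.Phase d => p.ρ z.1 z.2 :=
    p.continuous_ρ.measurable
  have hρ : ∀ z : KineticLangevin.Phase d × KineticLangevin.Phase d, 0 ≤ p.ρ z.1 z.2 :=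
    fun z => hU.ρ_nonneg hγ z.1 z.2
  have hle := hU.lintegral_ρ_ubuCoupling_le hγ hh hfric hstep k a b
  have hint : Integrable (fun z => p.ρ z.1 z.2) (p.ubuCoupling U h k (a, b)) :=
    ⟨hm.aestronglyMeasurable, (hasFiniteIntegral_iff_ofReal (Filter.Eventually.of_forall hρ)).2
      (hle.trans_lt ENNReal.ofReal_lt_top)⟩
  have hB : 0 ≤ p.prefactor h * (1 - p.rate h * h) ^ k * p.ρ a b := by
    have hr : 0 ≤ 1 - p.rate h * h := sub_nonneg.2 (hU.rate_mul_le_one hγ hh hstep)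
    have hC : 0 ≤ p.prefactor h := by
      rw [KineticLangevin.Params.prefactor]
      have := le_max_left ((1 + p.α * p.γ * h / 2) ^ 2) (1 + p.γ * h * max 1 (p.LK / p.γ ^ 2))
      have h2 := (sq_nonneg (1 + p.α * p.γ * h / 2)).trans this
      positivity
    have := hρ (a, b)
    positivity
  refine ⟨hU.map_fst_ubuCoupling hγ hh k a b, hU.map_snd_ubuCoupling hγ hh k a b, hint, ?_⟩
  rw [integral_eq_lintegral_of_nonneg_ae (Filter.Eventually.of_forall hρ) hm.aestronglyMeasurable]
  exact ENNReal.toReal_le_of_le_ofReal hB hle
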